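/- **Language.** Values are booleans and natural numbers. Input channels and output channels (disjoint sets) carry levels $H$ or $L$. Programs are built from $\textbf{skip}$, assignment, sequence, $\textbf{if}$, $\textbf{while}$, $\textbf{input}\ x\ \textbf{from}\ c$ and $\textbf{output}\ e\ \textbf{to}\ c$, with the usual deterministic small-step semantics (a guard must be boolean). A queue is a finite list of items $(c,v)$; $Q|_c$ and $Q|_l$ are its restrictions to a channel and to a level. An input instruction on $c$ consumes the first item of the input queue, which must be on $c$; an output appends an item to the output queue. $(\pi,I)\Downarrow O$ means that $\pi$, started with a fixed initial value in every variable, reaches $\textbf{skip}$ with $I$ consumed completely and output $O$. Fix default values $df(c)$, one for each channel. Write $Q=_LQ'$ for $Q|_L=Q'|_L$, and call a queue $H$-default if each item $(c,v)$ in it with $c$ of level $H$ has $v=df(c)$. **Properties.** * RI: whenever $(\pi,I)\Downarrow O$, there are $I',O'$ with $I'=_LI$, $I'$ $H$-default, $|I'|_c|\le|I|_c|$ for each input channel $c$, $(\pi,I')\Downarrow O'$ and $O'=_LO$. * DI: whenever $(\pi,\,I_1.(c,v).I_2)\Downarrow O$ with $c$ of level $H$ and $I_2$ $H$-default, there are $I_1',I_2',O'$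 such that $I'=I_1'.(c,df(c)).I_2'$ satisfies $I'=_L I_1.(c,v).I_2$, $I_1'|_H=I_1|_H$, $I_2'$ is $H$-default, $(\pi,I')\Downarrow O'$ and $O'=_LO$. * TSNI: whenever $(\pi,I)\Downarrow O$, then for any streams of values offered on the $H$ input channels there are $I',O'$ with $I'=_LI$, the values of $I'$ on each $H$ channel forming a finite prefix of the stream of that channel, $(\pi,I')\Downarrow O'$ and $O'=_LO$. * TINI: whenever $I'=_LI$, $(\pi,I)\Downarrow O$ and $(\pi,I')\Downarrow O'$, then $O'=_LO$. **Mechanisms.** $EM(\pi)$ runs local copies of $\pi$, initially $\pi[0]$ (high) and $\pi[1]$ (low), each with its own memory, input queue and output queue, together with the components MAP and REDUCE. A local input on $c$ takes the first item on $c$ from the local queue; if there is none, the copy emits a signal and sleeps. A local output is put in the local output queue, and the copy emits a signal and sleeps. MAP (REDUCE), when idle, may take up, and thereby remove, the signal of any one copy sleeping on an input (output), and it then runs its program for this request of copy $i$ on channel $c$, whose instructions are executed atomically one by one, interleaved with the other components. Tables $T_M$, $T_R$ give the privileges $a$ (ask) and $t$ (tell) of each copy on each channel. Let $\mathrm{fetch}(c)$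 be: read the first item of the global input queue, which must be on $c$; append it to the input queues of all copies with $t\in T_M[\cdot][c]$; append $(c,df(c))$ to those of all other copies; wake all copies that sleep on an input from $c$ and now have an item on $c$ (waking removes signals). Let $\mathrm{default}(i,c)$ be: append $(c,df(c))$ to the input queue of copy $i$; wake copy $i$. In all three mechanisms REDUCE sends the item of $\pi[i]$ to the global output exactly if $i=0$ and $c$ is $H$, or $i=1$ and $c$ is $L$ ($T_R=at$ there, $-$ elsewhere); in every case it then removes the item from the local queue and wakes copy $i$. In all three, $T_M[0]$ is $at$ on $H$ and $t$ on $L$ channels, and $T_M[1]$ is $at$ on $L$ channels. * RI: $T_M[1]=a$ on $H$ channels. MAP: if $a\in T_M[i][c]$ then $\mathrm{fetch}(c)$, else nothing. * NI (style of secure multi-execution): $T_M[1]=-$ on $H$ channels. MAP: if $a\in T_M[i][c]$ then $\mathrm{fetch}(c)$; else if $t\notin T_M[i][c]$ then $\mathrm{default}(i,c)$; else nothing. * DI: $T_M[1]=a$ on $H$ channels. MAP: if $c$ is $H$ and $i=0$, first append to the stack a sleeping copy of the current configuration of $\pi[0]$, with $T_M=a$ on $H$ channels, $T_M=t$ on $L$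 channels, $T_R=-$. Then, if $a\in T_M[i][c]$: $\mathrm{fetch}(c)$ if $t\in T_M[i][c]$, and $\mathrm{default}(i,c)$ otherwise; if $a\notin T_M[i][c]$, nothing. $EM(\pi)$ has terminated when all local programs and those of MAP and REDUCE are $\textbf{skip}$, the global input queue is empty, and no copy is asleep. An order of execution picks, at each time, one of the components that can move (no fairness is required). A mechanism is *precise* for a property $P$ if for every program $\pi$ that satisfies $P$, all $I,O$ with $(\pi,I)\Downarrow O$, and every order of execution, there are $I^*,O^*$ with $I^*|_c=I|_c$ for all input channels $c$ and $O^*|_c=O|_c$ for all output channels $c$, such that $EM(\pi)$, started on the global input $I^*$ and executed in this order, terminates with global output $O^*$. **Theorem.** For all levels, all initial values and all default values $df$: the RI mechanism is precise for RI, the DI mechanism is precise for DI, and the NI mechanism is precise for TSNI. If there is at least one input channel of level $H$, the NI mechanism is not precise for TINI. -/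

import Mathlib

namespace InfoFlow

universe u v

/-! ### Values, memories, queues -/

/-- Values are booleans and non-negative integers. -/
inductive Val where
  | bool (b : Bool)
  | nat (n : ℕ)
  deriving DecidableEq

/-- Security levels. -/
inductive Level where
  | high
  | low
  deriving DecidableEq

/-- Program variables. -/
abbrev Var := ℕ

/-- Memories map variables to values. -/
abbrev Mem := Var → Val

/-- `m[x ↦ w]`. -/
def Mem.upd (m : Mem) (x : Var) (w : Val) : Mem := fun y => if y = x then w else m y

/-- Queues of input (or output) vectors.  A vector assigns to every channel a value or the
undefined value, and exactly one channel is defined; such a vector is the pair consisting of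
its only defined channel and the value there. -/
abbrev Queue (C : Type u) := List (C × Val)

section Queue
variable {C : Type u}

/-- `Q|_c`, the restriction of a queue to a channel. -/
def Queue.onChannel [DecidableEq C] (Q : Queue C) (c : C) : Queue C :=
  Q.filter fun q => q.1 = c

/-- `Q|_l`, the restriction of a queue to a security level. -/
def Queue.onLevel (lvl : C → Level) (Q : Queue C) (l : Level) : Queue C :=
  Q.filter fun q => lvl q.1 = l

/-- `Q|_H` consists of default values only. -/
def Queue.HighDefault (lvl : C → Level) (d : C → Val) (Q : Queue C) : Prop :=
  ∀ q ∈ Q, lvl q.1 = Level.high → q.2 = d q.1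

/-- The dequeue operator: the first item on channel `c`, and the queue without it
(`none` if there is no such item). -/
def Queue.deq [DecidableEq C] (c : C) : Queue C → Option (Val × Queue C)
  | [] => none
  | q :: Q =>
    if q.1 = c then some (q.2, Q)
    else (Queue.deq c Q).map fun r => (r.1, q :: r.2)

/-- Remove the first item on channel `c`, if there is one. -/
def Queue.remove [DecidableEq C] (c : C) (Q : Queue C) : Queue C :=
  match Queue.deq c Q with
  | some r => r.2
  | none => Q

end Queue

/-! ### The common core of the languages

Controlled programs, MAP programs and REDUCE programs share assignment, sequence, if, while
and skip; they differ in their expressions `E` and in their further instructions `A`. -/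

inductive Stmt (E : Type u) (A : Type v) where
  | skip
  | assign (x : Var) (e : E)
  | seq (p q : Stmt E A)
  | cond (e : E) (p q : Stmt E A)
  | loop (e : E) (p : Stmt E A)
  | act (a : A)

/-- One small step (`none`: no rule applies).  `ev` evaluates expressions, `run` is the
semantics of the further instructions, `s` is the part of the configuration on which these
act besides the memory. -/
def Stmt.step {E : Type*} {A : Type*} {σ : Type*} (ev : E → Mem → σ → Val)
    (run : A → Mem → σ → Option (Stmt E A × Mem × σ)) :
    Stmt E A → Mem → σ → Option (Stmt E A × Mem × σ)
  | .skip, _, _ => none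
  | .assign x e, m, s => some (.skip, m.upd x (ev e m s), s)
  | .seq .skip q, m, s => some (q, m, s)
  | .seq p q, m, s => (Stmt.step ev run p m s).map fun r => (.seq r.1 q, r.2)
  | .cond e p q, m, s =>
    match ev e m s with
    | .bool true => some (p, m, s)
    | .bool false => some (q, m, s)
    | .nat _ => none
  | .loop e p, m, s =>
    match ev e m s with
    | .bool true => some (.seq p (.loop e p), m, s)
    | .bool false => some (.skip, m, s)
    | .nat _ => none
  | .act a, m, s => run a m s

/-- The further instruction that is to be executed next, if the next instruction is one. -/
def Stmt.next {E : Type*} {A : Type*} : Stmt E A → Option A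
  | .act a => some a
  | .seq p _ => p.next
  | _ => none

/-! ### Controlled programs -/

/-- Expressions, given by their meaning: the value in a memory. -/
abbrev Expr := Mem → Val

/-- `input x from c` and `output e to c`. -/
inductive Act (Cin : Type u) (Cout : Type v) where
  | input (x : Var) (c : Cin)
  | output (e : Expr) (c : Cout)

/-- Controlled programs. -/
abbrev Prog (Cin : Type u) (Cout : Type v) := Stmt Expr (Act Cin Cout)

/-- The data that are fixed throughout: the levels of the channels and the initial value of
all variables. -/
structure Setting (Cin : Type u) (Cout : Type v) where
  lvlIn : Cin → Level
  lvlOut : Cout → Level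
  init : Val

/-- The initial memory. -/
def Setting.m0 {Cin : Type u} {Cout : Type v} (S : Setting Cin Cout) : Mem := fun _ => S.init

section
variable {Cin : Type u} {Cout : Type v} [DecidableEq Cin] [DecidableEq Cout]

/-- Input and output of controlled programs: an input instruction consumes the first item of
the input queue, which has to be on the right channel. -/
def Act.run : Act Cin Cout → Mem → Queue Cin × Queue Cout →
    Option (Prog Cin Cout × Mem × (Queue Cin × Queue Cout))
  | .input _ _, _, ([], _) => none
  | .input x c, m, (q :: I, O) => if q.1 = c then some (.skip, m.upd x q.2, (I, O)) else none
  | .output e c, m, (I, O) => some (.skip, m, (I, O ++ [(c, e m)]))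

/-- The transition relation of controlled programs. -/
def Prog.Trans (γ γ' : Prog Cin Cout × Mem × (Queue Cin × Queue Cout)) : Prop :=
  Stmt.step (fun e m _ => e m) Act.run γ.1 γ.2.1 γ.2.2 = some γ'

/-- `(π, I) ⇓ O`: the program terminates on the input `I`, consuming it completely, with
output `O`. -/
def Terminates (S : Setting Cin Cout) (π : Prog Cin Cout) (I : Queue Cin) (O : Queue Cout) :
    Prop :=
  ∃ m : Mem, Relation.ReflTransGen Prog.Trans (π, S.m0, (I, [])) (.skip, m, ([], O))

/-! ### The properties -/

/-- Default values, channel by channel (those of output channels only occur inside REDUCE). -/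
structure Defaults (Cin : Type u) (Cout : Type v) where
  inp : Cin → Val
  out : Cout → Val

/-- Removal of inputs, for the default values `d`. -/
def RI (S : Setting Cin Cout) (d : Defaults Cin Cout) (π : Prog Cin Cout) : Prop :=
  ∀ (I : Queue Cin) (O : Queue Cout), Terminates S π I O →
    ∃ (I' : Queue Cin) (O' : Queue Cout),
      I'.onLevel S.lvlIn .low = I.onLevel S.lvlIn .low ∧
      I'.HighDefault S.lvlIn d.inp ∧
      (∀ c : Cin, (I'.onChannel c).length ≤ (I.onChannel c).length) ∧
      Terminates S π I' O' ∧
      O'.onLevel S.lvlOut .low = O.onLevel S.lvlOut .low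

/-- Deletion of inputs, for the default values `d`: the last high input item that need not be
a default one is replaced by the default item of its channel, the earlier high items are kept,
and the later high items, all of them default ones, may be removed or supplemented. -/
def DI (S : Setting Cin Cout) (d : Defaults Cin Cout) (π : Prog Cin Cout) : Prop :=
  ∀ (I₁ I₂ : Queue Cin) (c : Cin) (w : Val) (O : Queue Cout),
    S.lvlIn c = .high → I₂.HighDefault S.lvlIn d.inp →
    Terminates S π (I₁ ++ (c, w) :: I₂) O →
    ∃ (I₁' I₂' : Queue Cin) (O' : Queue Cout),
      Queue.onLevel S.lvlIn (I₁' ++ (c, d.inp c) :: I₂') .low =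
        Queue.onLevel S.lvlIn (I₁ ++ (c, w) :: I₂) .low ∧
      I₁'.onLevel S.lvlIn .high = I₁.onLevel S.lvlIn .high ∧
      I₂'.HighDefault S.lvlIn d.inp ∧
      Terminates S π (I₁' ++ (c, d.inp c) :: I₂') O' ∧
      O'.onLevel S.lvlOut .low = O.onLevel S.lvlOut .low

/-- Termination-sensitive non-interference: if `π` terminates on `I`, then it terminates with
low-equivalent output on the same low input, whatever the values offered on the high channels
are.  The input queue of a terminating run is consumed completely and in order, so the high
values are offered as streams `h c`, and the queue `I'` holds those that `π` asks for. -/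
def TSNI (S : Setting Cin Cout) (π : Prog Cin Cout) : Prop :=
  ∀ (I : Queue Cin) (O : Queue Cout), Terminates S π I O →
    ∀ h : Cin → ℕ → Val, ∃ (I' : Queue Cin) (O' : Queue Cout),
      I'.onLevel S.lvlIn .low = I.onLevel S.lvlIn .low ∧
      (∀ c : Cin, S.lvlIn c = .high →
        ∃ n : ℕ, (I'.onChannel c).map Prod.snd = (List.range n).map (h c)) ∧
      Terminates S π I' O' ∧
      O'.onLevel S.lvlOut .low = O.onLevel S.lvlOut .low

set_option linter.unusedSectionVars false in
/-- The stronger requirement that `π` terminates on *every* low-equivalent queue (which, where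
there is a high input channel, no program that terminates on some input meets, since a
terminating run has to consume its queue) implies `TSNI`. -/
theorem TSNI.of_forall {S : Setting Cin Cout} {π : Prog Cin Cout}
    (hπ : ∀ (I I' : Queue Cin) (O : Queue Cout),
      I'.onLevel S.lvlIn .low = I.onLevel S.lvlIn .low → Terminates S π I O →
      ∃ O' : Queue Cout, Terminates S π I' O' ∧
        O'.onLevel S.lvlOut .low = O.onLevel S.lvlOut .low) : TSNI S π := by
  intro I O hI h
  obtain ⟨O', h1, h2⟩ := hπ I (I.onLevel S.lvlIn .low) O
    (by simp [Queue.onLevel, List.filter_filter]) hI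
  refine ⟨_, O', by simp [Queue.onLevel, List.filter_filter], ?_, h1, h2⟩
  intro c hc
  refine ⟨0, ?_⟩
  simp only [Queue.onLevel, Queue.onChannel, List.filter_filter, List.range_zero, List.map_nil,
    List.map_eq_nil_iff, List.filter_eq_nil_iff]
  intro q _ hq
  simp only [Bool.and_eq_true, decide_eq_true_eq] at hq
  rw [hq.1, hc] at hq
  exact absurd hq.2 (by decide)

/-- Termination-insensitive non-interference. -/
def TINI (S : Setting Cin Cout) (π : Prog Cin Cout) : Prop :=
  ∀ (I I' : Queue Cin) (O O' : Queue Cout),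
    I'.onLevel S.lvlIn .low = I.onLevel S.lvlIn .low →
    Terminates S π I O → Terminates S π I' O' →
    O'.onLevel S.lvlOut .low = O.onLevel S.lvlOut .low

/-! ### Local executions -/

/-- States of a local execution: executing or sleeping. -/
inductive State where
  | E
  | S
  deriving DecidableEq

/-- State, interrupt signal, input queue and output queue of a local execution. -/
structure Port (Cin : Type u) (Cout : Type v) where
  stt : State
  sig : Option (Cin ⊕ Cout)
  inq : Queue Cin
  outq : Queue Cout

/-- The configuration of a local execution. -/
structure LocalConf (Cin : Type u) (Cout : Type v) where
  prg : Prog Cin Cout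
  mem : Mem
  port : Port Cin Cout

/-- Input (with the item at hand, or emitting a signal) and output of local executions. -/
def Act.runLocal : Act Cin Cout → Mem → Port Cin Cout →
    Option (Prog Cin Cout × Mem × Port Cin Cout)
  | .input x c, m, p =>
    match Queue.deq c p.inq with
    | some r => some (.skip, m.upd x r.1, { p with inq := r.2 })
    | none =>
      if p.sig = none then some (.act (.input x c), m, { p with stt := .S, sig := some (.inl c) })
      else none
  | .output e c, m, p =>
    if p.sig = none then
      some (.skip, m, { p with stt := .S, sig := some (.inr c), outq := p.outq ++ [(c, e m)] })
    else none

/-- A step of a local execution; only in the executing state. -/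
def LocalConf.step (l : LocalConf Cin Cout) : Option (LocalConf Cin Cout) :=
  if l.port.stt = .E then
    (Stmt.step (fun e m _ => e m) Act.runLocal l.prg l.mem l.port).map
      fun r => ⟨r.1, r.2.1, r.2.2⟩
  else none

/-- `some c` if the execution sleeps on an input instruction on `c` and has a pending signal. -/
def LocalConf.asksInput (l : LocalConf Cin Cout) : Option Cin :=
  match l.port.stt, l.port.sig, l.prg.next with
  | .S, some (.inl c), some (.input _ c') => if c' = c then some c else none
  | _, _, _ => none

/-- `some c` if the execution sleeps on an output to `c` and has a pending signal. -/
def LocalConf.asksOutput (l : LocalConf Cin Cout) : Option Cout :=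
  match l.port.stt, l.port.sig with
  | .S, some (.inr c) => some c
  | _, _ => none

/-! ### MAP and REDUCE -/

/-- The privileges `a` and `t`. -/
inductive Priv where
  | ask
  | tell
  deriving DecidableEq

/-- A configuration table: the privileges `T[i][c]` of local execution `i` on channel `c`. -/
abbrev Table (C : Type u) := ℕ → C → Finset Priv

/-- Predicates on local executions, which may refer to the index of the execution, to its
column in the table of MAP, and to its configuration. -/
abbrev LPred (Cin : Type u) (Cout : Type v) :=
  ℕ → (Cin → Finset Priv) → LocalConf Cin Cout → Bool

/-- The instructions of MAP besides the common ones. -/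
inductive MapAct (Cin : Type u) (Cout : Type v) where
  | input (x : Var) (c : Cin)
  | map (e : Table Cin → Mem → Val) (c : Cin) (P : LPred Cin Cout)
  | wake (P : LPred Cin Cout)
  | clone (P : LPred Cin Cout) (privIn : Cin → Finset Priv) (privOut : Cout → Finset Priv)

/-- MAP programs; expressions may consult the table of MAP. -/
abbrev MapProg (Cin : Type u) (Cout : Type v) :=
  Stmt (Table Cin → Mem → Val) (MapAct Cin Cout)

/-- The instructions of REDUCE besides the common ones. -/
inductive RedAct (Cin : Type u) (Cout : Type v) where
  | retrieve (x : Var) (i : ℕ) (c : Cout)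
  | output (e : Table Cout → Mem → Val) (c : Cout)
  | wake (P : LPred Cin Cout)
  | clean (c : Cout) (P : LPred Cin Cout)

/-- REDUCE programs; expressions may consult the table of REDUCE. -/
abbrev RedProg (Cin : Type u) (Cout : Type v) :=
  Stmt (Table Cout → Mem → Val) (RedAct Cin Cout)

/-- The part of the configuration that MAP and REDUCE act upon: the tables, the stack of local
executions (with indices `0, …, TOP`), and the global input and output queues. -/
structure Env (Cin : Type u) (Cout : Type v) where
  tm : Table Cin
  tr : Table Cout
  ex : List (LocalConf Cin Cout)
  inq : Queue Cin
  outq : Queue Cout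

/-- Apply `f` simultaneously to the ports of all local executions that satisfy `P`. -/
def Env.modify (s : Env Cin Cout) (P : LPred Cin Cout) (f : Port Cin Cout → Port Cin Cout) :
    Env Cin Cout :=
  { s with ex := s.ex.mapIdx fun i l => if P i (s.tm i) l then { l with port := f l.port } else l }

/-- Wake the local executions that satisfy `P`, and remove their signals. -/
def Env.wake (s : Env Cin Cout) (P : LPred Cin Cout) : Env Cin Cout :=
  s.modify P fun p => { p with stt := .E, sig := none }

/-- Append a sleeping copy of each local execution that satisfies `P`, and give the copies the
stated privileges. -/
def Env.clone (s : Env Cin Cout) (P : LPred Cin Cout) (privIn : Cin → Finset Priv)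
    (privOut : Cout → Finset Priv) : Env Cin Cout :=
  let new := (s.ex.zipIdx.filter fun r => P r.2 (s.tm r.2) r.1).map
    fun r => { r.1 with port := { r.1.port with stt := .S } }
  let isNew : ℕ → Bool := fun j => s.ex.length ≤ j ∧ j < s.ex.length + new.length
  { s with
    ex := s.ex ++ new
    tm := fun j => if isNew j then privIn else s.tm j
    tr := fun j => if isNew j then privOut else s.tr j }

/-- Semantics of the instructions of MAP. -/
def MapAct.run : MapAct Cin Cout → Mem → Env Cin Cout →
    Option (MapProg Cin Cout × Mem × Env Cin Cout)
  | .input x c, m, s =>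
    match s.inq with
    | [] => none
    | q :: I => if q.1 = c then some (.skip, m.upd x q.2, { s with inq := I }) else none
  | .map e c P, m, s =>
    some (.skip, m, s.modify P fun p => { p with inq := p.inq ++ [(c, e s.tm m)] })
  | .wake P, m, s => some (.skip, m, s.wake P)
  | .clone P privIn privOut, m, s => some (.skip, m, s.clone P privIn privOut)

/-- Semantics of the instructions of REDUCE. -/
def RedAct.run : RedAct Cin Cout → Mem → Env Cin Cout →
    Option (RedProg Cin Cout × Mem × Env Cin Cout)
  | .retrieve x i c, m, s =>
    match s.ex[i]? with
    | none => none
    | some l =>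
      match Queue.deq c l.port.outq with
      | none => none
      | some r => some (.skip, m.upd x r.1, s)
  | .output e c, m, s => some (.skip, m, { s with outq := s.outq ++ [(c, e s.tr m)] })
  | .wake P, m, s => some (.skip, m, s.wake P)
  | .clean c P, m, s =>
    some (.skip, m, s.modify P fun p => { p with outq := Queue.remove c p.outq })

/-! ### Enforcement mechanisms -/

/-- What a mechanism is configured by: the tables (for the two initial local executions; the
other columns are filled in when executions are cloned) and the programs of MAP and REDUCE
for a request of local execution `i` on channel `c`. -/
structure Mechanism (Cin : Type u) (Cout : Type v) where
  tm : Table Cin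
  tr : Table Cout
  mapProg : ℕ → Cin → MapProg Cin Cout
  redProg : ℕ → Cout → RedProg Cin Cout

/-- A configuration of an enforcement mechanism. -/
structure Config (Cin : Type u) (Cout : Type v) where
  env : Env Cin Cout
  mapPrg : MapProg Cin Cout
  mapMem : Mem
  redPrg : RedProg Cin Cout
  redMem : Mem

/-- The possible moves: a step of local execution `i`, a step of the program of MAP, the
activation of MAP for the request of local execution `i`, and the same for REDUCE. -/
inductive Move where
  | loc (i : ℕ)
  | mapStep
  | mapActivate (i : ℕ)
  | redStep
  | redActivate (i : ℕ)

/-- Replace the `i`-th local execution. -/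
def Config.setLocal (γ : Config Cin Cout) (i : ℕ) (l : LocalConf Cin Cout) : Config Cin Cout :=
  { γ with env := { γ.env with ex := γ.env.ex.set i l } }

/-- `l` without its interrupt signal. -/
def LocalConf.clearSig (l : LocalConf Cin Cout) : LocalConf Cin Cout :=
  { l with port := { l.port with sig := none } }

/-- The effect of a move (`none`: the move is not possible). -/
def Mechanism.step (S : Setting Cin Cout) (M : Mechanism Cin Cout) (γ : Config Cin Cout) :
    Move → Option (Config Cin Cout)
  | .loc i =>
    match γ.env.ex[i]? with
    | none => none
    | some l => l.step.map fun l' => γ.setLocal i l'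
  | .mapStep =>
    (Stmt.step (fun e m s => e s.tm m) MapAct.run γ.mapPrg γ.mapMem γ.env).map
      fun r => { γ with mapPrg := r.1, mapMem := r.2.1, env := r.2.2 }
  | .mapActivate i =>
    match γ.mapPrg, γ.env.ex[i]? with
    | .skip, some l =>
      l.asksInput.map fun c =>
        { γ.setLocal i l.clearSig with mapPrg := M.mapProg i c, mapMem := S.m0 }
    | _, _ => none
  | .redStep =>
    (Stmt.step (fun e m s => e s.tr m) RedAct.run γ.redPrg γ.redMem γ.env).map
      fun r => { γ with redPrg := r.1, redMem := r.2.1, env := r.2.2 }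
  | .redActivate i =>
    match γ.redPrg, γ.env.ex[i]? with
    | .skip, some l =>
      l.asksOutput.map fun c =>
        { γ.setLocal i l.clearSig with redPrg := M.redProg i c, redMem := S.m0 }
    | _, _ => none

/-- The initial configuration of a local execution of `π`. -/
def LocalConf.initial (S : Setting Cin Cout) (π : Prog Cin Cout) : LocalConf Cin Cout :=
  ⟨π, S.m0, ⟨.E, none, [], []⟩⟩

/-- The initial configuration of the mechanism on `π`, with global input `I`: a high
execution (index `0`) and a low execution (index `1`). -/
def Mechanism.initial (S : Setting Cin Cout) (M : Mechanism Cin Cout) (π : Prog Cin Cout)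
    (I : Queue Cin) : Config Cin Cout where
  env := ⟨M.tm, M.tr, [LocalConf.initial S π, LocalConf.initial S π], I, []⟩
  mapPrg := .skip
  mapMem := S.m0
  redPrg := .skip
  redMem := S.m0

/-- The mechanism has terminated: all programs are `skip`, the global input is consumed, and no
local execution still sleeps on an output that REDUCE has not dealt with. -/
def Config.Terminated (γ : Config Cin Cout) : Prop :=
  γ.mapPrg = .skip ∧ γ.redPrg = .skip ∧ γ.env.inq = [] ∧
    ∀ l ∈ γ.env.ex, l.prg = .skip ∧ l.port.stt = .E

/-- An order of execution: at each time it picks one of the moves that are possible.  No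
fairness is required. -/
structure Order where
  pick : ℕ → Set Move → Move
  pick_mem : ∀ (n : ℕ) (X : Set Move), X.Nonempty → pick n X ∈ X

/-- The configuration after `n` steps in the given order (it does not change any more once no
move is possible). -/
def Mechanism.run (S : Setting Cin Cout) (M : Mechanism Cin Cout) (π : Prog Cin Cout)
    (I : Queue Cin) (ord : Order) : ℕ → Config Cin Cout
  | 0 => M.initial S π I
  | n + 1 =>
    let γ := M.run S π I ord n
    (M.step S γ (ord.pick n {μ | (M.step S γ μ).isSome})).getD γ

/-- `(EM(π), I) ⇓ O` when executed in the given order. -/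
def Mechanism.TerminatesIn (S : Setting Cin Cout) (M : Mechanism Cin Cout) (π : Prog Cin Cout)
    (I : Queue Cin) (ord : Order) (O : Queue Cout) : Prop :=
  ∃ n : ℕ, (M.run S π I ord n).Terminated ∧ (M.run S π I ord n).env.outq = O

/-- The mechanism `M` is precise with respect to the property `P`. -/
def Mechanism.Precise (S : Setting Cin Cout) (M : Mechanism Cin Cout)
    (P : Prog Cin Cout → Prop) : Prop :=
  ∀ π : Prog Cin Cout, P π → ∀ (I : Queue Cin) (O : Queue Cout), Terminates S π I O →
    ∀ ord : Order, ∃ (I' : Queue Cin) (O' : Queue Cout),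
      (∀ c : Cin, I'.onChannel c = I.onChannel c) ∧
      (∀ c : Cout, O'.onChannel c = O.onChannel c) ∧
      M.TerminatesIn S π I' ord O'

/-! ### The configurations -/

/-- The test whether the privilege `a` (or `t`) is in `T[i][c]`. -/
def hasPriv {C : Type*} (r : Priv) (i : ℕ) (c : C) : Table C → Mem → Val :=
  fun T _ => .bool (decide (r ∈ T i c))

/-- The execution has the privilege `t` on the input channel `c`. -/
def canTell (c : Cin) : LPred Cin Cout := fun _ T _ => decide (Priv.tell ∈ T c)

/-- The execution does not have the privilege `t` on the input channel `c`. -/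
def cannotTell (c : Cin) : LPred Cin Cout := fun _ T _ => decide (Priv.tell ∉ T c)

/-- The execution sleeps on an input instruction on `c`, and the item has arrived. -/
def isReady (c : Cin) : LPred Cin Cout := fun _ _ l =>
  decide (l.port.stt = .S) &&
  (match l.prg.next with
    | some (.input _ c') => decide (c' = c)
    | _ => false) &&
  (Queue.deq c l.port.inq).isSome

/-- The execution is the one with index `i`. -/
def identical (i : ℕ) : LPred Cin Cout := fun j _ _ => decide (j = i)

/-- Read a real item from `c`, distribute it, and wake the executions that are ready. -/
def fetchAndMap (d : Defaults Cin Cout) (c : Cin) : MapProg Cin Cout :=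
  .seq (.act (.input 0 c)) <|
  .seq (.act (.map (fun _ m => m 0) c (canTell c))) <|
  .seq (.act (.map (fun _ _ => d.inp c) c (cannotTell c))) <|
  .act (.wake (isReady c))

/-- Give the default item to local execution `i` only, and wake it. -/
def mapDefault (d : Defaults Cin Cout) (i : ℕ) (c : Cin) : MapProg Cin Cout :=
  .seq (.act (.map (fun _ _ => d.inp c) c (identical i))) <|
  .act (.wake (identical i))

/-- The REDUCE program of all three mechanisms. -/
def reduceProg (d : Defaults Cin Cout) (i : ℕ) (c : Cout) : RedProg Cin Cout :=
  .seq (.assign 0 fun _ _ => d.out c) <|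
  .seq (.cond (hasPriv .ask i c) (.act (.retrieve 0 i c)) .skip) <|
  .seq (.cond (hasPriv .tell i c) (.act (.output (fun _ m => m 0) c)) .skip) <|
  .seq (.act (.clean c (identical i))) <|
  .act (.wake (identical i))

/-- The REDUCE table of all three mechanisms. -/
def reduceTable (S : Setting Cin Cout) : Table Cout
  | 0, c => match S.lvlOut c with
    | .high => {.ask, .tell}
    | .low => ∅
  | 1, c => match S.lvlOut c with
    | .high => ∅
    | .low => {.ask, .tell}
  | _, _ => ∅

/-- The mechanism for removal of inputs. -/
def mechRI (S : Setting Cin Cout) (d : Defaults Cin Cout) : Mechanism Cin Cout where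
  tm
    | 0, c => match S.lvlIn c with
      | .high => {.ask, .tell}
      | .low => {.tell}
    | 1, c => match S.lvlIn c with
      | .high => {.ask}
      | .low => {.ask, .tell}
    | _, _ => ∅
  tr := reduceTable S
  mapProg i c := .cond (hasPriv .ask i c) (fetchAndMap d c) .skip
  redProg := reduceProg d

/-- The mechanism for non-interference in the style of secure multi-execution. -/
def mechNI (S : Setting Cin Cout) (d : Defaults Cin Cout) : Mechanism Cin Cout where
  tm
    | 0, c => match S.lvlIn c with
      | .high => {.ask, .tell}
      | .low => {.tell}
    | 1, c => match S.lvlIn c with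
      | .high => ∅
      | .low => {.ask, .tell}
    | _, _ => ∅
  tr := reduceTable S
  mapProg i c := .cond (hasPriv .ask i c) (fetchAndMap d c)
    (.cond (hasPriv .tell i c) .skip (mapDefault d i c))
  redProg := reduceProg d

/-- The input privileges of clones. -/
def clonePrivIn (S : Setting Cin Cout) (c : Cin) : Finset Priv :=
  match S.lvlIn c with
  | .high => {.ask}
  | .low => {.tell}

/-- The mechanism for deletion of inputs. -/
def mechDI (S : Setting Cin Cout) (d : Defaults Cin Cout) : Mechanism Cin Cout where
  tm
    | 0, c => match S.lvlIn c with
      | .high => {.ask, .tell}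
      | .low => {.tell}
    | 1, c => match S.lvlIn c with
      | .high => {.ask}
      | .low => {.ask, .tell}
    | _, _ => ∅
  tr := reduceTable S
  mapProg i c :=
    .seq (.cond (fun _ _ => .bool (decide (S.lvlIn c = .high ∧ i = 0)))
      (.act (.clone (identical i) (clonePrivIn S) fun _ => ∅)) .skip) <|
    .cond (hasPriv .ask i c)
      (.cond (hasPriv .tell i c) (fetchAndMap d c) (mapDefault d i c))
      .skip
  redProg := reduceProg d

end

end InfoFlow

namespace InfoFlow

universe u v

set_option linter.unusedSectionVars false

/-! ### Queues restricted to channels and levels, and removal of the first item on a channel. -/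

section QueueLemmas
variable {C : Type u}

/-! Every copy executes `π` itself, so it terminates once the items it receives are those of some
complete run of `π`. The properties supply such runs. Copy 0 follows the given run on `I`. Copy 1
follows a run with default values on the high channels and the same low input and low output: RI
gives it directly, TSNI gives it for constant default streams, DI gives it by iteration. Each output
channel is served by one of these two copies, so the global output is right channel by channel
(`Kind.terminatesIn`). In the DI mechanism, a clone made where copy 0 is about to read a high item
needs a run with the same past and only default high values from there on. Replacing the high items
by default ones from the last one backwards yields it (`DI.terminatesOn`), and `Completes.clonable`
attaches it to every high input of the run of copy 0.

The order of reads depends on the order of execution, so the global input cannot be fixed in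
advance. The invariant `Inv` therefore ignores the actual global queue and refers to a queue `rem`
of items still to be read, of which only the restrictions to channels matter. All moves but a read
by MAP are independent of the global queue (`Mechanism.step_withInq`); a read on `c` takes the first
item on `c` in `rem`. `Inv.exists_queue` assembles these items into the required input.

The core of the invariant is `CopyInv`. On a channel where a copy has `t`, its outstanding input is
its local queue, then the item in the hands of MAP, then `rem`. On the other channels both its local
queue and its outstanding input contain default values only, so surplus items do no harm. For RI one
also counts: copy 1 can cause reads on high channels, and the bound on `|I'|_c|` ensures that an
item is left. For DI, copy 0 holds a high item only when about to consume it, so clones inherit no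
real high item.

Termination needs no fairness because every move decreases a lexicographic measure. Its second
component is 100 for each remaining step of each copy, plus a small summand for the state of the
copy, plus the sizes of the programs of MAP and REDUCE. Only cloning increases it; but each cloning
is followed by a read before the next one, so `2 * rem.length + credit` decreases at both. When
nothing can move (`Inv.terminated`), copy 1, which is never refused an item, has finished; hence no
low item remains, hence nobody waits, hence copy 0 has finished as well and `rem` is empty.

For the last claim, a program that reads a high item and loops unless it is a fixed non-default
value never outputs anything, so it satisfies TINI, but the low copy only ever sees the default
value and loops. -/

theorem Queue.mem_onLevel {lvl : C → Level} {Q : Queue C} {l : Level} {q : C × Val} :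
    q ∈ Q.onLevel lvl l ↔ q ∈ Q ∧ lvl q.1 = l := by
  simp [Queue.onLevel]

variable [DecidableEq C]

theorem Queue.onChannel_append (Q R : Queue C) (c : C) :
    Queue.onChannel (Q ++ R) c = Q.onChannel c ++ R.onChannel c :=
  List.filter_append ..

theorem Queue.onChannel_cons_self (Q : Queue C) (c : C) (w : Val) :
    Queue.onChannel ((c, w) :: Q) c = (c, w) :: Q.onChannel c := by
  simp [Queue.onChannel]

theorem Queue.onChannel_cons_ne (Q : Queue C) {c c' : C} (h : c ≠ c') (w : Val) :
    Queue.onChannel ((c, w) :: Q) c' = Q.onChannel c' := by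
  simp [Queue.onChannel, h]

theorem Queue.onChannel_singleton (c c' : C) (w : Val) :
    Queue.onChannel [(c, w)] c' = if c = c' then [(c, w)] else [] := by
  by_cases h : c = c' <;> simp [Queue.onChannel, h]

@[simp] theorem Queue.onChannel_nil (c : C) : Queue.onChannel ([] : Queue C) c = [] := rfl

theorem Queue.mem_onChannel {Q : Queue C} {c : C} {q : C × Val} :
    q ∈ Q.onChannel c ↔ q ∈ Q ∧ q.1 = c := by
  simp [Queue.onChannel]

theorem Queue.onChannel_onLevel (lvl : C → Level) (Q : Queue C) (c : C) :
    (Q.onLevel lvl (lvl c)).onChannel c = Q.onChannel c := by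
  simp only [Queue.onLevel, Queue.onChannel, List.filter_filter]
  refine List.filter_congr fun q _ => ?_
  by_cases h : q.1 = c <;> simp [h]

/-- The properties compare queues level by level, whereas the mechanisms preserve only the order
within each channel; this passes from the former to the latter. -/
theorem Queue.onChannel_eq_of_onLevel {lvl : C → Level} {Q R : Queue C} {l : Level}
    (h : Q.onLevel lvl l = R.onLevel lvl l) {c : C} (hc : lvl c = l) :
    Q.onChannel c = R.onChannel c := by
  subst hc
  rw [← Queue.onChannel_onLevel lvl, h, Queue.onChannel_onLevel]

theorem Queue.eq_nil_of_onChannel {Q : Queue C} (h : ∀ c, Q.onChannel c = []) : Q = [] := by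
  refine List.eq_nil_iff_forall_not_mem.2 fun q hq => ?_
  have : q ∈ Q.onChannel q.1 := Queue.mem_onChannel.2 ⟨hq, rfl⟩
  simp [h] at this

theorem Queue.deq_eq_none {Q : Queue C} {c : C} : Queue.deq c Q = none ↔ Q.onChannel c = [] := by
  induction Q with
  | nil => simp [Queue.deq]
  | cons q Q ih =>
    obtain ⟨c', w⟩ := q
    by_cases h : c' = c
    · subst h; simp [Queue.deq, Queue.onChannel_cons_self]
    · simp [Queue.deq, h, Queue.onChannel_cons_ne, ih]

/-- This is all that is needed to consume a queue known only through its restrictions: the length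
serves the termination measure, the membership clause the default-value invariant. -/
theorem Queue.deq_spec {Q Q' : Queue C} {c : C} {w : Val} (h : Queue.deq c Q = some (w, Q')) :
    Q.onChannel c = (c, w) :: Q'.onChannel c ∧ (∀ c', c' ≠ c → Q.onChannel c' = Q'.onChannel c') ∧
      Q.length = Q'.length + 1 ∧ ∀ q ∈ Q', q ∈ Q := by
  induction Q generalizing Q' with
  | nil => simp [Queue.deq] at h
  | cons q Q ih =>
    obtain ⟨c₁, w₁⟩ := q
    by_cases hc : c₁ = c
    · subst hc
      simp only [Queue.deq, if_true, Option.some.injEq, Prod.mk.injEq] at h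
      obtain ⟨rfl, rfl⟩ := h
      exact ⟨Queue.onChannel_cons_self .., fun c' hc' => Queue.onChannel_cons_ne _ hc'.symm _, rfl,
        fun q hq => List.mem_cons_of_mem _ hq⟩
    · simp only [Queue.deq, hc, if_false, Option.map_eq_some_iff, Prod.mk.injEq] at h
      obtain ⟨⟨w', R⟩, hR, rfl, rfl⟩ := h
      obtain ⟨h1, h2, h3, h4⟩ := ih hR
      refine ⟨?_, fun c' hc' => ?_, ?_, fun q hq => ?_⟩
      · simpa [Queue.onChannel_cons_ne _ hc] using h1
      · have := h2 c' hc'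
        by_cases h5 : c₁ = c'
        · subst h5; simp [Queue.onChannel_cons_self, this]
        · simpa [Queue.onChannel_cons_ne _ h5] using this
      · simpa using h3
      · rcases List.mem_cons.1 hq with rfl | hq
        · simp
        · exact List.mem_cons_of_mem _ (h4 q hq)

theorem Queue.exists_deq {Q : Queue C} {c : C} (h : Q.onChannel c ≠ []) :
    ∃ w Q', Queue.deq c Q = some (w, Q') := by
  cases hd : Queue.deq c Q with
  | none => exact absurd (Queue.deq_eq_none.1 hd) h
  | some r => exact ⟨r.1, r.2, rfl⟩

end QueueLemmas

/-! ### Decomposition of steps -/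

namespace Stmt
variable {E : Type*} {A : Type*}

/-- Replace the further instruction that is to be executed next by `q`. -/
def fill : Stmt E A → Stmt E A → Stmt E A
  | .act _, q => q
  | .seq p r, q => .seq (p.fill q) r
  | p, _ => p

theorem next_fill_skip (p : Stmt E A) (h : p.next.isSome) : (p.fill .skip).next = none := by
  induction p with
  | act a => rfl
  | seq p q ihp _ => exact ihp h
  | _ => simp [next] at h

theorem fill_act (p : Stmt E A) {a : A} (h : p.next = some a) : p.fill (.act a) = p := by
  induction p with
  | act b => simp only [next, Option.some.injEq] at h; subst h; rfl
  | seq p q ihp _ => simp only [fill, ihp h]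
  | _ => simp [next] at h

/-- Only the instruction in focus depends on the semantics `run`; its context is inert. The same
decomposition thus serves plain runs, local executions, MAP and REDUCE. -/
theorem step_of_next {σ : Type*} (ev : E → Mem → σ → Val)
    (run : A → Mem → σ → Option (Stmt E A × Mem × σ)) {p : Stmt E A} {a : A}
    (h : p.next = some a) (m : Mem) (s : σ) :
    p.step ev run m s = (run a m s).map fun r => (p.fill r.1, r.2) := by
  induction p with
  | act b =>
    simp only [next, Option.some.injEq] at h; subst h
    simp [step, fill]
  | seq p q ihp _ =>
    have h' : p.next = some a := h
    have hp : p ≠ .skip := by rintro rfl; simp [next] at h'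
    -- `step.eq_4` is the equation for a sequence whose first component is not `skip`.
    rw [step.eq_4 _ _ _ _ _ _ (fun hh => hp hh), ihp h', Option.map_map]
    rfl
  | _ => simp [next] at h

/-- A step that does not execute a further instruction, for expressions evaluated by `ev`. -/
def tau (ev : E → Mem → Val) (p : Stmt E A) (m : Mem) : Option (Stmt E A × Mem) :=
  (p.step (σ := Unit) (fun e m _ => ev e m) (fun _ _ _ => none) m ()).map fun r => (r.1, r.2.1)

/-- A silent step leaves the surroundings `s` alone and sees them only through `ev`; hence a copy
performs the silent steps of the plain run. -/
theorem step_of_next_none {σ : Type*} (ev : E → Mem → σ → Val)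
    (run : A → Mem → σ → Option (Stmt E A × Mem × σ)) {p : Stmt E A}
    (h : p.next = none) (m : Mem) (s : σ) :
    p.step ev run m s = (p.tau (fun e m => ev e m s) m).map fun r => (r.1, r.2, s) := by
  induction p with
  | skip => rfl
  | assign x e => rfl
  | act b => simp [next] at h
  | seq p q ihp _ =>
    have h' : p.next = none := h
    by_cases hp : p = .skip
    · subst hp; rfl
    · rw [step.eq_4 _ _ _ _ _ _ (fun hh => hp hh), ihp h', tau, tau,
        step.eq_4 _ _ _ _ _ _ (fun hh => hp hh)]
      simp only [Option.map_map]
      rfl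
  | cond e p q =>
    simp only [step, tau]
    rcases ev e m s with b | n
    · cases b <;> rfl
    · rfl
  | loop e p =>
    simp only [step, tau]
    rcases ev e m s with b | n
    · cases b <;> rfl
    · rfl

end Stmt

/-! ### Complete runs -/

section
variable {Cin : Type u} {Cout : Type v} [DecidableEq Cin] [DecidableEq Cout]

/-- A silent step of a controlled program. -/
abbrev Prog.tau (p : Prog Cin Cout) (m : Mem) : Option (Prog Cin Cout × Mem) :=
  Stmt.tau (fun (e : Expr) m => e m) p m

/-- `Completes G p m J n O`: from the configuration `(p, m)` the program terminates in `n` steps,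
consuming exactly `J` and producing `O`; `G` holds wherever an input instruction is executed. -/
inductive Completes (G : Prog Cin Cout → Mem → Queue Cin → Prop) :
    Prog Cin Cout → Mem → Queue Cin → ℕ → Queue Cout → Prop
  | skip (m : Mem) : Completes G .skip m [] 0 []
  | tau {p m p' m' J n O} : p.next = none → Prog.tau p m = some (p', m') →
      Completes G p' m' J n O → Completes G p m J (n + 1) O
  | inp {p m x c w J n O} : p.next = some (.input x c) → G p m ((c, w) :: J) →
      Completes G (p.fill .skip) (m.upd x w) J n O → Completes G p m ((c, w) :: J) (n + 1) O
  | out {p m e c J n O} : p.next = some (.output e c) →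
      Completes G (p.fill .skip) m J n O → Completes G p m J (n + 1) ((c, e m) :: O)

theorem Completes.mono {G G' : Prog Cin Cout → Mem → Queue Cin → Prop}
    (h : ∀ p m J, G p m J → G' p m J) {p m J n} {O : Queue Cout}
    (hc : Completes G p m J n O) : Completes G' p m J n O := by
  induction hc with
  | skip m => exact .skip m
  | tau h1 h2 _ ih => exact .tau h1 h2 ih
  | inp h1 h2 _ ih => exact .inp h1 (h _ _ _ h2) ih
  | out h1 _ ih => exact .out h1 ih

/-- Complete runs without side condition. -/
abbrev Completes₀ : Prog Cin Cout → Mem → Queue Cin → ℕ → Queue Cout → Prop :=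
  Completes fun _ _ _ => True

theorem Completes₀.exists_of_trans {p : Prog Cin Cout} {m m' : Mem} {J : Queue Cin}
    {O O' : Queue Cout}
    (h : Relation.ReflTransGen Prog.Trans (p, m, (J, O)) (.skip, m', ([], O'))) :
    ∃ n R, Completes₀ p m J n R ∧ O' = O ++ R := by
  generalize ha : ((p, m, (J, O)) : Prog Cin Cout × Mem × (Queue Cin × Queue Cout)) = a at h
  induction h using Relation.ReflTransGen.head_induction_on generalizing p m J O with
  | refl =>
    simp only [Prod.mk.injEq] at ha
    obtain ⟨rfl, rfl, rfl, rfl⟩ := ha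
    exact ⟨0, [], .skip _, by simp⟩
  | head hab _ ih =>
    subst ha
    simp only [Prog.Trans] at hab
    cases hn : p.next with
    | none =>
      rw [Stmt.step_of_next_none _ _ hn] at hab
      simp only [Option.map_eq_some_iff] at hab
      obtain ⟨⟨p', m₁⟩, h1, rfl⟩ := hab
      obtain ⟨n, R, h2, h3⟩ := ih rfl
      exact ⟨n + 1, R, .tau hn h1 h2, h3⟩
    | some a =>
      rw [Stmt.step_of_next _ _ hn] at hab
      cases a with
      | input x c =>
        rcases J with _ | ⟨⟨c', w⟩, J⟩
        · simp [Act.run] at hab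
        · by_cases hc : c' = c
          · subst hc
            simp only [Act.run, if_true, Option.map_some, Option.some.injEq] at hab
            subst hab
            obtain ⟨n, R, h2, h3⟩ := ih rfl
            exact ⟨n + 1, R, .inp hn trivial h2, h3⟩
          · simp [Act.run, hc] at hab
      | output e c =>
        simp only [Act.run, Option.map_some, Option.some.injEq] at hab
        subst hab
        obtain ⟨n, R, h2, h3⟩ := ih rfl
        exact ⟨n + 1, (c, e m) :: R, .out hn h2, by simp [h3]⟩

theorem Completes₀.trans {p : Prog Cin Cout} {m : Mem} {J : Queue Cin} {n : ℕ}
    {R : Queue Cout} (h : Completes₀ p m J n R) (O : Queue Cout) :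
    ∃ m', Relation.ReflTransGen Prog.Trans (p, m, (J, O)) (.skip, m', ([], O ++ R)) := by
  induction h generalizing O with
  | skip m => exact ⟨m, by simp [Relation.ReflTransGen.refl]⟩
  | tau h1 h2 _ ih =>
    obtain ⟨m', h3⟩ := ih O
    refine ⟨m', .head ?_ h3⟩
    simp only [Prog.Trans]
    rw [Stmt.step_of_next_none _ _ h1]
    simp only [Prog.tau] at h2
    simp [h2]
  | inp h1 _ _ ih =>
    obtain ⟨m', h3⟩ := ih O
    refine ⟨m', .head ?_ h3⟩
    simp only [Prog.Trans]
    rw [Stmt.step_of_next _ _ h1]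
    simp [Act.run]
  | @out p m e c J n R h1 _ ih =>
    obtain ⟨m', h3⟩ := ih (O ++ [(c, e m)])
    refine ⟨m', .head ?_ (by simpa using h3)⟩
    simp only [Prog.Trans]
    rw [Stmt.step_of_next _ _ h1]
    simp [Act.run]

/-- From here on termination means an inductive run with its number of steps, which enters the
termination measure. -/
theorem terminates_iff {S : Setting Cin Cout} {π : Prog Cin Cout} {I : Queue Cin}
    {O : Queue Cout} : Terminates S π I O ↔ ∃ n, Completes₀ π S.m0 I n O := by
  constructor
  · rintro ⟨m, h⟩
    obtain ⟨n, R, h1, rfl⟩ := Completes₀.exists_of_trans h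
    exact ⟨n, by simpa using h1⟩
  · rintro ⟨n, h⟩
    obtain ⟨m, h1⟩ := h.trans []
    exact ⟨m, by simpa using h1⟩

/-! ### Clonable runs -/

/-- At an input from a high channel there is a complete run in which only default values are read
from high channels from there on. -/
def Clonable (S : Setting Cin Cout) (d : Defaults Cin Cout) (p : Prog Cin Cout) (m : Mem)
    (J : Queue Cin) : Prop :=
  ∀ x c, p.next = some (.input x c) → S.lvlIn c = .high →
    ∃ J' n O', Completes₀ p m J' n O' ∧ J'.HighDefault S.lvlIn d.inp ∧
      J'.onLevel S.lvlIn .low = J.onLevel S.lvlIn .low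

theorem onLevel_cons {lvl : Cin → Level} (Q : Queue Cin) (q : Cin × Val) (l : Level) :
    Queue.onLevel lvl (q :: Q) l = if lvl q.1 = l then q :: Q.onLevel lvl l else Q.onLevel lvl l := by
  by_cases h : lvl q.1 = l <;> simp [Queue.onLevel, h]

theorem highDefault_iff {lvl : Cin → Level} {f : Cin → Val} {Q : Queue Cin} :
    Q.HighDefault lvl f ↔ ∀ q ∈ Q.onLevel lvl .high, q.2 = f q.1 := by
  simp only [Queue.HighDefault, Queue.mem_onLevel]
  exact ⟨fun h q hq => h q hq.1 hq.2, fun h q h1 h2 => h q ⟨h1, h2⟩⟩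

/-- By determinism, an alternative run that agrees with the given one on the high items `X` and on
the low input proceeds in lockstep until `X` is used up. If the item it replaces is the one about to
be read, the rest of the alternative run is what a clone needs. -/
theorem Completes.clonable {S : Setting Cin Cout} {d : Defaults Cin Cout} {p : Prog Cin Cout}
    {m : Mem} {J : Queue Cin} {n : ℕ} {O : Queue Cout} (h : Completes₀ p m J n O)
    (H : ∀ X c w Z, J.onLevel S.lvlIn .high = X ++ (c, w) :: Z →
      ∃ J' n' O' Y, Completes₀ p m J' n' O' ∧ J'.onLevel S.lvlIn .low = J.onLevel S.lvlIn .low ∧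
        J'.onLevel S.lvlIn .high = X ++ (c, d.inp c) :: Y ∧ ∀ q ∈ Y, q.2 = d.inp q.1) :
    Completes (Clonable S d) p m J n O := by
  induction h with
  | skip m => exact .skip m
  | tau h1 h2 _ ih =>
    refine .tau h1 h2 (ih fun X c w Z hJ => ?_)
    obtain ⟨J', n', O', Y, h3, h4⟩ := H X c w Z hJ
    cases h3 with
    | skip m => simp [Stmt.tau, Stmt.step] at h2
    | tau _ h6 h7 =>
      rw [h2] at h6; cases h6
      exact ⟨_, _, _, _, h7, h4⟩
    | inp h5 => rw [h1] at h5; cases h5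
    | out h5 => rw [h1] at h5; cases h5
  | @inp p m x c w J n O h1 _ _ ih =>
    refine .inp h1 ?_ (ih fun X c' w' Z hJ => ?_)
    · intro x' c' hx hc
      rw [h1] at hx; cases hx
      -- The empty prefix replaces the item about to be read, so all high items of the alternative
      -- run are default ones.
      obtain ⟨J', n', O', Y, h3, h4, h5, h6⟩ := H [] c w (Queue.onLevel S.lvlIn J .high)
        (by simp [onLevel_cons, hc])
      refine ⟨J', n', O', h3, ?_, h4⟩
      rw [highDefault_iff, h5]
      simpa using h6
    · cases hc : S.lvlIn c with
      | high =>
        -- The item just read belongs to the common prefix, so the alternative run reads the same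
        -- value here.
        obtain ⟨J', n', O', Y, h3, h4, h5, h6⟩ := H ((c, w) :: X) c' w' Z
          (by simp [onLevel_cons, hc, hJ])
        cases h3 with
        | skip m => simp [Stmt.next] at h1
        | tau h7 => rw [h1] at h7; cases h7
        | out h7 => rw [h1] at h7; cases h7
        | inp h7 _ h8 =>
          rw [h1] at h7; cases h7
          simp only [onLevel_cons, hc, if_true, List.cons_append, List.cons.injEq] at h5 h4
          obtain ⟨h5, h9⟩ := h5
          cases h5
          exact ⟨_, _, _, _, h8, by simpa using h4, h9, h6⟩
      | low =>
        obtain ⟨J', n', O', Y, h3, h4, h5, h6⟩ := H X c' w' Z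
          (by simp [onLevel_cons, hc, hJ])
        cases h3 with
        | skip m => simp [Stmt.next] at h1
        | tau h7 => rw [h1] at h7; cases h7
        | out h7 => rw [h1] at h7; cases h7
        | inp h7 _ h8 =>
          rw [h1] at h7; cases h7
          simp only [onLevel_cons, hc, if_true, List.cons.injEq] at h5 h4
          obtain ⟨h4, h9⟩ := h4
          cases h4
          exact ⟨_, _, _, _, h8, h9, by simpa using h5, h6⟩
  | out h1 _ ih =>
    refine .out h1 (ih fun X c w Z hJ => ?_)
    obtain ⟨J', n', O', Y, h3, h4⟩ := H X c w Z hJ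
    cases h3 with
    | skip m => simp [Stmt.next] at h1
    | tau h7 => rw [h1] at h7; cases h7
    | inp h7 => rw [h1] at h7; cases h7
    | out h7 h8 =>
      rw [h1] at h7; cases h7
      exact ⟨_, _, _, _, h8, h4⟩

/-- `π` terminates on some input with the given high and low parts. -/
def TerminatesOn (S : Setting Cin Cout) (π : Prog Cin Cout) (X L : Queue Cin) (R : Queue Cout) :
    Prop :=
  ∃ I O, Terminates S π I O ∧ I.onLevel S.lvlIn .high = X ∧ I.onLevel S.lvlIn .low = L ∧
    O.onLevel S.lvlOut .low = R

/-- DI replaces one high item, provided that all later ones are default. Applying it to the last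
element of `Z`, then to the one before, and so on, finally reaches `w`; the low input and low output
never change. -/
theorem DI.terminatesOn {S : Setting Cin Cout} {d : Defaults Cin Cout} {π : Prog Cin Cout}
    (hπ : DI S d π) (X L : Queue Cin) (R : Queue Cout) (Z : Queue Cin) :
    ∀ c w Y, (∀ q ∈ Y, q.2 = d.inp q.1) →
      TerminatesOn S π (X ++ (c, w) :: Z ++ Y) L R →
      ∃ Y', (∀ q ∈ Y', q.2 = d.inp q.1) ∧ TerminatesOn S π (X ++ (c, d.inp c) :: Y') L R := by
  -- A single use of DI, expressed through the high and low parts of the input instead of a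
  -- splitting of the input itself.
  have key : ∀ X c w Y, (∀ q ∈ Y, q.2 = d.inp q.1) →
      TerminatesOn S π (X ++ (c, w) :: Y) L R →
      ∃ Y', (∀ q ∈ Y', q.2 = d.inp q.1) ∧ TerminatesOn S π (X ++ (c, d.inp c) :: Y') L R := by
    rintro X c w Y hY ⟨I, O, h1, h2, h3, h4⟩
    simp only [Queue.onLevel] at h2
    obtain ⟨I₁, I', rfl, h5, h6⟩ := List.filter_eq_append_iff.1 h2
    obtain ⟨I₂, I₃, rfl, h7, h8, h9⟩ := List.filter_eq_cons_iff.1 h6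
    have hc : S.lvlIn c = .high := by simpa using h8
    have h10 : Queue.HighDefault S.lvlIn d.inp I₃ := by
      rw [highDefault_iff]; simpa only [Queue.onLevel, h9] using hY
    obtain ⟨J₁, J₂, O', h11, h12, h13, h14, h15⟩ := hπ (I₁ ++ I₂) I₃ c w O hc h10 (by simpa using h1)
    have h16 : I₂.filter (fun q => decide (S.lvlIn q.1 = .high)) = [] :=
      List.filter_eq_nil_iff.2 h7
    refine ⟨J₂.onLevel S.lvlIn .high, highDefault_iff.1 h13, _, _, h14, ?_, ?_, h15.trans h4⟩
    · simp only [Queue.onLevel, List.filter_append] at h12 ⊢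
      simp [h12, h5, h16, hc]
    · rw [h11, ← h3]; simp
  induction Z using List.reverseRecOn with
  | nil => intro c w Y hY h; exact key X c w Y hY (by simpa using h)
  | append_singleton Z q ih =>
    intro c w Y hY h
    obtain ⟨Y', h1, h2⟩ := key (X ++ (c, w) :: Z) q.1 q.2 Y hY (by simpa using h)
    -- The item just replaced joins the default tail.
    exact ih c w ((q.1, d.inp q.1) :: Y') (by simpa using h1) (by simpa using h2)

end

/-! ### Privileges, phases of MAP and REDUCE, and the invariant of one local execution. -/

section
variable {Cin : Type u} {Cout : Type v} [DecidableEq Cin] [DecidableEq Cout]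

/-- The three mechanisms. -/
inductive Kind where
  | ri
  | di
  | ni

/-- The mechanism of a given kind. -/
def Kind.mech (k : Kind) (S : Setting Cin Cout) (d : Defaults Cin Cout) : Mechanism Cin Cout :=
  match k with
  | .ri => mechRI S d
  | .di => mechDI S d
  | .ni => mechNI S d

/-- The column of local execution `j` in the table of MAP. -/
def Kind.column (k : Kind) (S : Setting Cin Cout) (j : ℕ) (c : Cin) : Finset Priv :=
  match S.lvlIn c with
  | .low => if j = 1 then {.ask, .tell} else {.tell}
  | .high => if j = 0 then {.ask, .tell} else
    match k with
    | .ri => {.ask}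
    | .di => {.ask}
    | .ni => ∅

/-- Local execution `j` receives the real items on `c`. -/
def Tells (S : Setting Cin Cout) (j : ℕ) (c : Cin) : Prop := S.lvlIn c = .low ∨ j = 0

/-- The privilege `t` is the same in all three mechanisms, so the distribution of real items is
treated uniformly. -/
theorem Kind.tell_mem_column (k : Kind) (S : Setting Cin Cout) (j : ℕ) (c : Cin) :
    Priv.tell ∈ k.column S j c ↔ Tells S j c := by
  cases h : S.lvlIn c <;> cases k <;> by_cases h0 : j = 0 <;> by_cases h1 : j = 1 <;>
    simp [Kind.column, Tells, h, h0, h1]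

/-- The local execution whose outputs on `c` are the real ones. -/
def Setting.owner (S : Setting Cin Cout) (c : Cout) : ℕ :=
  match S.lvlOut c with
  | .high => 0
  | .low => 1

theorem mem_reduceTable (S : Setting Cin Cout) (r : Priv) (j : ℕ) (c : Cout) :
    r ∈ reduceTable S j c ↔ S.owner c = j := by
  rcases j with _ | _ | j <;> cases h : S.lvlOut c <;> cases r <;>
    simp [reduceTable, Setting.owner, h]

/-! ### Phases of MAP and REDUCE -/

/-- What MAP is doing: nothing; deciding on a request (after having cloned or not); having read a
real item; having sent it to those entitled; having sent the default item to the others; having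
sent a default item to one execution. -/
inductive MapPhase (Cin : Type u) where
  | idle
  | dec (b : Bool) (i : ℕ) (c : Cin)
  | fetched (i : ℕ) (c : Cin) (w : Val)
  | told (i : ℕ) (c : Cin)
  | mapped (i : ℕ) (c : Cin)
  | given (i : ℕ) (c : Cin)

namespace MapPhase

/-- The request that is being dealt with. -/
def req : MapPhase Cin → Option (ℕ × Cin)
  | idle => none
  | dec _ i c => some (i, c)
  | fetched i c _ => some (i, c)
  | told i c => some (i, c)
  | mapped i c => some (i, c)
  | given i c => some (i, c)

/-- The real items on `c` that have been read and not yet been distributed. -/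
def flight : MapPhase Cin → Cin → Queue Cin
  | fetched _ c w, c' => if c = c' then [(c, w)] else []
  | _, _ => []

/-- The number of default items on `c` that are still to be distributed. -/
def dflight : MapPhase Cin → Cin → ℕ
  | fetched _ c _, c' => if c = c' then 1 else 0
  | told _ c, c' => if c = c' then 1 else 0
  | _, _ => 0

/-- A sleeping execution `j` that waits for `c` may already have an item there. -/
def Busy : MapPhase Cin → ℕ → Cin → Prop
  | told _ c, _, c' => c = c'
  | mapped _ c, _, c' => c = c'
  | given i c, j, c' => i = j ∧ c = c'
  | _, _, _ => False

/-- The execution `j`, whose request is dealt with, already has an item. -/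
def Served (S : Setting Cin Cout) : MapPhase Cin → ℕ → Cin → Prop
  | told i c, j, c' => i = j ∧ c = c' ∧ Tells S j c
  | mapped i c, j, c' => i = j ∧ c = c'
  | given i c, j, c' => i = j ∧ c = c'
  | _, _, _ => False

/-- A default item on `c` will be distributed to, or is already at, each clone waiting for it. -/
def Promised : MapPhase Cin → Cin → Prop
  | dec true _ c, c' => c = c'
  | fetched _ c _, c' => c = c'
  | told _ c, c' => c = c'
  | mapped _ c, c' => c = c'
  | _, _ => False

/-- An item on `c` has been distributed to all executions. -/
def Distributed : MapPhase Cin → Cin → Prop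
  | mapped _ c, c' => c = c'
  | _, _ => False

/-- `0` between cloning and reading. -/
def credit : MapPhase Cin → ℕ
  | dec true _ _ => 0
  | _ => 1

end MapPhase

/-- What REDUCE is doing: nothing; dealing with the output `(c, w)` of execution `i`, before or
after the decision on sending it; having cleaned the local output queue. -/
inductive RedPhase (Cout : Type v) where
  | idle
  | start (i : ℕ) (c : Cout) (w : Val)
  | sent (i : ℕ) (c : Cout) (w : Val)
  | cleaned (i : ℕ)

namespace RedPhase

/-- The execution that is being dealt with. -/
def req : RedPhase Cout → Option ℕ
  | idle => none
  | start i _ _ => some i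
  | sent i _ _ => some i
  | cleaned i => some i

/-- The contents of the output queue of the execution that is being dealt with. -/
def held : RedPhase Cout → Queue Cout
  | start _ c w => [(c, w)]
  | sent _ c w => [(c, w)]
  | _ => []

/-- The local output is already accounted for in the global output. -/
def Sent : RedPhase Cout → ℕ → Prop
  | sent i _ _, j => i = j
  | _, _ => False

end RedPhase

/-! ### The invariant of a local execution -/

/-- The possible states of local execution `j`. -/
inductive StateInv (S : Setting Cin Cout) (ph : MapPhase Cin) (rph : RedPhase Cout) (j : ℕ)
    (l : LocalConf Cin Cout) : Prop
  | run : l.port.stt = .E → l.port.sig = none → l.port.outq = [] →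
      (∀ c, ph.req ≠ some (j, c)) → rph.req ≠ some j → StateInv S ph rph j l
  | inSignal (x : Var) (c : Cin) : l.port.stt = .S → l.prg.next = some (.input x c) →
      l.port.outq = [] → rph.req ≠ some j → (ph.Busy j c ∨ l.port.inq.onChannel c = []) →
      l.port.sig = some (.inl c) → (∀ c', ph.req ≠ some (j, c')) → StateInv S ph rph j l
  | inServed (x : Var) (c : Cin) : l.port.stt = .S → l.prg.next = some (.input x c) →
      l.port.outq = [] → rph.req ≠ some j → (ph.Busy j c ∨ l.port.inq.onChannel c = []) →
      l.port.sig = none → ph.req = some (j, c) →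
      (ph.Served S j c → l.port.inq.onChannel c ≠ []) → StateInv S ph rph j l
  | inDenied (x : Var) (c : Cin) : l.port.stt = .S → l.prg.next = some (.input x c) →
      l.port.outq = [] → rph.req ≠ some j → (ph.Busy j c ∨ l.port.inq.onChannel c = []) →
      l.port.sig = none → (S.lvlIn c = .low ∨ ph.Promised c ∧ j ≠ 0) → j ≠ 1 →
      (S.lvlIn c = .high → ph.Distributed c → l.port.inq.onChannel c ≠ []) →
      (∀ c', ph.req ≠ some (j, c')) → StateInv S ph rph j l
  | outSignal (c : Cout) (w : Val) : l.port.stt = .S → l.prg.next = none →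
      (∀ c, ph.req ≠ some (j, c)) → l.port.sig = some (.inr c) → l.port.outq = [(c, w)] →
      rph.req ≠ some j → StateInv S ph rph j l
  | outServed : l.port.stt = .S → l.prg.next = none → (∀ c, ph.req ≠ some (j, c)) →
      l.port.sig = none → l.port.outq = rph.held → rph.req = some j → StateInv S ph rph j l

/-- The data that the invariants refer to: the kind of the mechanism, and the expected output. -/
structure Frame (Cin : Type u) (Cout : Type v) where
  k : Kind
  S : Setting Cin Cout
  d : Defaults Cin Cout
  target : Queue Cout

/-- The side condition on the run of local execution `j`. -/
def Frame.Guard (F : Frame Cin Cout) (j : ℕ) (p : Prog Cin Cout) (m : Mem) (J : Queue Cin) :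
    Prop :=
  F.k = .di → j = 0 → Clonable F.S F.d p m J

/-- The invariant of local execution `j`, where `rem` are the global inputs still to be read, `og`
is the global output, and the execution still has to read `J`, to do `n` steps, and to output
`O`. -/
structure CopyInv (F : Frame Cin Cout) (rem : Queue Cin) (og : Queue Cout) (ph : MapPhase Cin)
    (rph : RedPhase Cout) (j : ℕ) (l : LocalConf Cin Cout) (J : Queue Cin) (n : ℕ)
    (O : Queue Cout) : Prop where
  fin : Completes (F.Guard j) l.prg l.mem J n O
  tell : ∀ c, Tells F.S j c →
    J.onChannel c = l.port.inq.onChannel c ++ ph.flight c ++ rem.onChannel c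
  dfl : j ≠ 0 → J.HighDefault F.S.lvlIn F.d.inp ∧ l.port.inq.HighDefault F.S.lvlIn F.d.inp
  cnt : F.k = .ri → j ≠ 0 → ∀ c, F.S.lvlIn c = .high →
    (J.onChannel c).length ≤
      (l.port.inq.onChannel c).length + ph.dflight c + (rem.onChannel c).length
  single : F.k = .di → j = 0 → ∀ c, F.S.lvlIn c = .high → l.port.inq.onChannel c ≠ [] →
    (l.port.inq.onChannel c).length ≤ 1 ∧ ∃ x, l.prg.next = some (.input x c)
  state : StateInv F.S ph rph j l
  out : ∀ c, F.S.owner c = j → ∀ P : Queue Cout,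
    (rph.Sent j → P = []) → (¬ rph.Sent j → P = l.port.outq) →
    og.onChannel c ++ P.onChannel c ++ O.onChannel c = F.target.onChannel c

/-- The execution is about to fall asleep on an input. -/
def LocalConf.lacks (l : LocalConf Cin Cout) : Bool :=
  match l.prg.next with
  | some (.input _ c) => (Queue.deq c l.port.inq).isNone
  | _ => false

/-- A bound for the number of moves on behalf of a local execution with `n` steps left. -/
def LocalConf.weight (l : LocalConf Cin Cout) (n : ℕ) : ℕ :=
  100 * n +
    match l.port.stt with
    | .E => if l.lacks then 60 else 5
    | .S => if l.port.sig.isSome then 59 else 10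

/-- The invariant with the bound `b` for the weight. -/
def Bounded (F : Frame Cin Cout) (rem : Queue Cin) (og : Queue Cout) (ph : MapPhase Cin)
    (rph : RedPhase Cout) (j : ℕ) (l : LocalConf Cin Cout) (b : ℕ) : Prop :=
  ∃ J n O, CopyInv F rem og ph rph j l J n O ∧ l.weight n ≤ b

/-- A step of the program frees 100, which pays for any new state. -/
theorem LocalConf.weight_le (l : LocalConf Cin Cout) (n : ℕ) : l.weight n ≤ 100 * n + 60 := by
  unfold LocalConf.weight
  split
  · split <;> omega
  · split <;> omega

variable {F : Frame Cin Cout} {rem : Queue Cin} {og : Queue Cout} {ph : MapPhase Cin}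
  {rph : RedPhase Cout} {j : ℕ} {l : LocalConf Cin Cout} {b : ℕ}

/-! ### Moves of local executions -/

/-- The copy repeats the next step of its plain run, or falls asleep for lack of an item. In the
first case the step count pays; in the second the weight goes from 60 to 59. -/
theorem Bounded.step {l' : LocalConf Cin Cout} (h : Bounded F rem og ph rph j l b)
    (hl : l.step = some l') : ∃ b' < b, Bounded F rem og ph rph j l' b' := by
  obtain ⟨J, n, O, h, hb⟩ := h
  have hE : l.port.stt = .E := by
    by_contra hE
    simp [LocalConf.step, hE] at hl
  obtain ⟨hsig, hout, hreq, hrreq⟩ : l.port.sig = none ∧ l.port.outq = [] ∧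
      (∀ c, ph.req ≠ some (j, c)) ∧ rph.req ≠ some j := by
    cases h.state with
    | run _ h2 h3 h4 h5 => exact ⟨h2, h3, h4, h5⟩
    | _ => simp_all
  have hns : ¬ rph.Sent j := by
    intro hs
    cases rph <;> simp_all [RedPhase.Sent, RedPhase.req]
  obtain ⟨p, m, ⟨stt, sig, inq, outq⟩⟩ := l
  simp only at hE hsig hout
  subst hE hsig hout
  simp only [LocalConf.step, if_true, Option.map_eq_some_iff] at hl
  obtain ⟨⟨p', m', port'⟩, hs, rfl⟩ := hl
  have hfin := h.fin
  simp only at hfin hs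
  cases hfin with
  | skip => simp [Stmt.step] at hs
  | @tau _ _ p₁ m₁ _ n _ h1 h2 h3 =>
    rw [Stmt.step_of_next_none _ _ h1] at hs
    simp only [Prog.tau] at h2
    rw [h2] at hs
    simp only [Option.map_some, Option.some.injEq, Prod.mk.injEq] at hs
    obtain ⟨rfl, rfl, rfl⟩ := hs
    refine ⟨b - 1, ?_, J, n, O, ⟨h3, h.tell, h.dfl, h.cnt, ?_, .run rfl rfl rfl hreq hrreq, h.out⟩, ?_⟩
    · simp only [LocalConf.weight] at hb; split at hb <;> omega
    · intro hk hj c hc hne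
      obtain ⟨-, x, hx⟩ := h.single hk hj c hc hne
      simp [h1] at hx
    · refine (LocalConf.weight_le _ _).trans ?_
      simp only [LocalConf.weight] at hb; split at hb <;> omega
  | @inp _ _ x c w J n _ h1 h2 h3 =>
    rw [Stmt.step_of_next _ _ h1] at hs
    cases hd : Queue.deq c inq with
    | none =>
      simp only [Act.runLocal, hd, if_true, Option.map_some, Option.some.injEq,
        Prod.mk.injEq] at hs
      obtain ⟨rfl, rfl, rfl⟩ := hs
      rw [Stmt.fill_act _ h1]
      have hlack : LocalConf.lacks (Cin := Cin) (Cout := Cout) ⟨p, m, ⟨.E, none, inq, []⟩⟩ = true := by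
        simp [LocalConf.lacks, h1, hd]
      refine ⟨b - 1, ?_, (c, w) :: J, n + 1, O, ⟨.inp h1 h2 h3, h.tell, h.dfl, h.cnt, h.single,
        .inSignal x c rfl h1 rfl hrreq (.inr (Queue.deq_eq_none.1 hd)) rfl hreq, h.out⟩, ?_⟩
      · simp only [LocalConf.weight, hlack, if_true] at hb; omega
      · simp only [LocalConf.weight, hlack, if_true] at hb
        simp [LocalConf.weight]; omega
    | some r =>
      obtain ⟨w', inq'⟩ := r
      simp only [Act.runLocal, hd, Option.map_some, Option.some.injEq, Prod.mk.injEq] at hs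
      obtain ⟨rfl, rfl, rfl⟩ := hs
      obtain ⟨d1, d2, -, d4⟩ := Queue.deq_spec hd
      have hJ : Queue.onChannel ((c, w) :: J) c = (c, w) :: Queue.onChannel J c :=
        Queue.onChannel_cons_self ..
      -- The value at hand is the one the plain run reads: on channels with `t` the local queue is
      -- an initial part of the outstanding input, and on the others both values are the default.
      have hw : w' = w := by
        by_cases ht : Tells F.S j c
        · have := h.tell c ht
          simp only [hJ, d1, List.cons_append, List.cons.injEq, Prod.mk.injEq, true_and] at this
          exact this.1.symm
        · simp only [Tells, not_or] at ht
          have hc : F.S.lvlIn c = .high := by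
            cases hc : F.S.lvlIn c <;> simp_all
          obtain ⟨e1, e2⟩ := h.dfl ht.2
          have e3 : (c, w') ∈ inq := by
            have : (c, w') ∈ inq.onChannel c := by rw [d1]; simp
            exact (Queue.mem_onChannel.1 this).1
          exact (e2 _ e3 hc).trans (e1 (c, w) (by simp) hc).symm
      subst hw
      refine ⟨b - 1, ?_, J, n, O, ⟨h3, ?_, ?_, ?_, ?_, .run rfl rfl rfl hreq hrreq, h.out⟩, ?_⟩
      · simp only [LocalConf.weight] at hb; split at hb <;> omega
      · intro c' ht
        have := h.tell c' ht
        by_cases hcc : c = c'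
        · subst hcc
          simpa [hJ, d1] using this
        · rw [Queue.onChannel_cons_ne _ hcc] at this
          simpa [d2 _ (Ne.symm hcc)] using this
      · intro hj
        obtain ⟨e1, e2⟩ := h.dfl hj
        exact ⟨fun q hq => e1 q (List.mem_cons_of_mem _ hq), fun q hq => e2 q (d4 q hq)⟩
      · intro hk hj c' hc'
        have := h.cnt hk hj c' hc'
        by_cases hcc : c = c'
        · subst hcc
          simp only [hJ, d1, List.length_cons] at this
          simp only; omega
        · rw [Queue.onChannel_cons_ne _ hcc] at this
          simpa [d2 _ (Ne.symm hcc)] using this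
      -- In the DI mechanism copy 0 had at most the one high item that it has now consumed, so none
      -- is left.
      · intro hk hj c' hc' hne
        exfalso
        simp only at hne
        by_cases hcc : c = c'
        · subst hcc
          have := (h.single hk hj c hc' (by simp [d1])).1
          simp only [d1, List.length_cons] at this
          exact hne (List.length_eq_zero_iff.1 (by omega))
        · rw [← d2 _ (Ne.symm hcc)] at hne
          obtain ⟨-, x', hx'⟩ := h.single hk hj c' hc' hne
          simp only [h1, Option.some.injEq, Act.input.injEq] at hx'
          exact hcc hx'.2
      · refine (LocalConf.weight_le _ _).trans ?_
        simp only [LocalConf.weight] at hb; split at hb <;> omega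
  | @out _ _ e c _ n O h1 h2 =>
    rw [Stmt.step_of_next _ _ h1] at hs
    simp only [Act.runLocal, if_true, Option.map_some, Option.some.injEq, Prod.mk.injEq] at hs
    obtain ⟨rfl, rfl, rfl⟩ := hs
    -- An output is completed before the copy sleeps, so its next instruction is now a silent one;
    -- this is how output sleepers differ from input sleepers.
    have hn := Stmt.next_fill_skip p (by rw [h1]; rfl)
    refine ⟨b - 1, ?_, J, n, O, ⟨h2, h.tell, h.dfl, h.cnt, ?_,
      .outSignal c (e m) rfl hn hreq rfl rfl hrreq, ?_⟩, ?_⟩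
    · simp only [LocalConf.weight] at hb; split at hb <;> omega
    · intro hk hj c hc hne
      obtain ⟨-, x, hx⟩ := h.single hk hj c hc hne
      simp [h1] at hx
    · intro c' hc' P _ hP
      have := h.out c' hc' [] (fun _ => rfl) (fun _ => rfl)
      rw [hP hns]
      simp only [List.nil_append] at this ⊢
      rw [← this]
      by_cases hcc : c = c'
      · subst hcc; simp [Queue.onChannel_cons_self]
      · simp [Queue.onChannel_cons_ne _ hcc]
    · refine (LocalConf.weight_le _ _).trans ?_
      simp only [LocalConf.weight] at hb; split at hb <;> omega

/-- An execution that cannot move has terminated or sleeps. -/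
theorem Bounded.eq_skip (h : Bounded F rem og ph rph j l b) (hE : l.port.stt = .E)
    (hl : l.step = none) : l.prg = .skip := by
  obtain ⟨J, n, O, h, -⟩ := h
  have hsig : l.port.sig = none := by
    cases h.state <;> simp_all
  simp only [LocalConf.step, hE, if_true, Option.map_eq_none_iff] at hl
  have hfin := h.fin
  cases hp : l.prg.next with
  | none =>
    rw [Stmt.step_of_next_none _ _ hp] at hl
    generalize l.prg = p at *
    cases hfin with
    | skip => rfl
    | tau h1 h2 => simp only [Prog.tau] at h2; simp [h2] at hl
    | inp h1 => simp [hp] at h1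
    | out h1 => simp [hp] at h1
  | some a =>
    rw [Stmt.step_of_next _ _ hp, Option.map_eq_none_iff] at hl
    cases a with
    | input x c =>
      simp only [Act.runLocal, hsig, if_true] at hl
      split at hl <;> simp at hl
    | output e c => simp [Act.runLocal, hsig] at hl

end

/-! ### The effect of moves of MAP and REDUCE on one local execution. -/

section
variable {Cin : Type u} {Cout : Type v} [DecidableEq Cin] [DecidableEq Cout]

/-- Append an item to the input queue of a port. -/
def Port.push (c : Cin) (w : Val) (p : Port Cin Cout) : Port Cin Cout :=
  { p with inq := p.inq ++ [(c, w)] }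

/-- Wake a port. -/
def Port.awake (p : Port Cin Cout) : Port Cin Cout := { p with stt := .E, sig := none }

variable {F : Frame Cin Cout} {rem rem' : Queue Cin} {og : Queue Cout} {ph ph' : MapPhase Cin}
  {rph rph' : RedPhase Cout} {j : ℕ} {l : LocalConf Cin Cout} {b : ℕ}

/-! ### Change of phase -/

/-- Predicates of the phase that grant a permission (`Busy`, `Promised`) must be preserved; those
that impose an obligation (`Served`, `Distributed`) must be reflected. -/
theorem StateInv.congr {S : Setting Cin Cout} (h : StateInv S ph rph j l)
    (hB : ∀ c, ph.Busy j c → ph'.Busy j c) (hr : ∀ c, ph.req = some (j, c) ↔ ph'.req = some (j, c))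
    (hS : ∀ c, ph'.Served S j c → ph.Served S j c) (hP : ∀ c, ph.Promised c → ph'.Promised c)
    (hD : ∀ c, ph'.Distributed c → ph.Distributed c) (hR : rph.req = some j ↔ rph'.req = some j)
    (hh : rph.req = some j → rph'.held = rph.held) : StateInv S ph' rph' j l := by
  cases h with
  | run h1 h2 h3 h4 h5 =>
    exact .run h1 h2 h3 (fun c hc => h4 c ((hr c).2 hc)) (fun hc => h5 (hR.2 hc))
  | inSignal x c h1 h2 h3 h4 h5 h6 h7 =>
    exact .inSignal x c h1 h2 h3 (fun hc => h4 (hR.2 hc)) (h5.imp (hB c) id) h6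
      (fun c hc => h7 c ((hr c).2 hc))
  | inServed x c h1 h2 h3 h4 h5 h6 h7 h8 =>
    exact .inServed x c h1 h2 h3 (fun hc => h4 (hR.2 hc)) (h5.imp (hB c) id) h6 ((hr c).1 h7)
      (fun hc => h8 (hS c hc))
  | inDenied x c h1 h2 h3 h4 h5 h6 h7 h8 h9 h10 =>
    exact .inDenied x c h1 h2 h3 (fun hc => h4 (hR.2 hc)) (h5.imp (hB c) id) h6
      (h7.imp id fun h => ⟨hP c h.1, h.2⟩) h8 (fun hc hd => h9 hc (hD c hd))
      (fun c hc => h10 c ((hr c).2 hc))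
  | outSignal c w h1 h2 h3 h4 h5 h6 =>
    exact .outSignal c w h1 h2 (fun c hc => h3 c ((hr c).2 hc)) h4 h5 (fun hc => h6 (hR.2 hc))
  | outServed h1 h2 h3 h4 h5 h6 =>
    exact .outServed h1 h2 (fun c hc => h3 c ((hr c).2 hc)) h4 (by rw [h5, hh h6]) (hR.1 h6)

theorem Bounded.rephase (h : Bounded F rem og ph rph j l b)
    (hf : ∀ c, Tells F.S j c → ph'.flight c ++ rem'.onChannel c = ph.flight c ++ rem.onChannel c)
    (hd : j ≠ 0 → ∀ c, ph.dflight c + (rem.onChannel c).length ≤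
      ph'.dflight c + (rem'.onChannel c).length)
    (hs : StateInv F.S ph rph j l → StateInv F.S ph' rph j l) :
    Bounded F rem' og ph' rph j l b := by
  obtain ⟨J, n, O, h, hb⟩ := h
  refine ⟨J, n, O, ⟨h.fin, fun c hc => ?_, h.dfl, fun hk hj c hc => ?_, h.single, hs h.state,
    h.out⟩, hb⟩
  · rw [h.tell c hc, List.append_assoc, List.append_assoc, hf c hc]
  · have := h.cnt hk hj c hc
    have := hd hj c
    omega

/-- Losing the signal lowers the weight from 59 to 10; the difference 49 pays for the program that
MAP starts. -/
theorem Bounded.clearSig_input {c : Cin} (h : Bounded F rem og .idle rph j l b)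
    (hl : l.asksInput = some c) :
    ∃ b', b' + 49 ≤ b ∧ Bounded F rem og (.dec false j c) rph j l.clearSig b' := by
  obtain ⟨J, n, O, h, hb⟩ := h
  have key : ∃ x, l.port.stt = .S ∧ l.prg.next = some (.input x c) ∧ l.port.sig = some (.inl c) := by
    unfold LocalConf.asksInput at hl
    split at hl
    · split at hl
      · rename_i h4; subst h4; cases hl; exact ⟨_, by assumption, by assumption, by assumption⟩
      · cases hl
    · cases hl
  obtain ⟨x, k1, k2, k3⟩ := key
  cases h.state with
  | inSignal x' c' h1 h2 h3 h4 h5 h6 h7 =>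
    rw [k2] at h2; cases h2
    refine ⟨b - 49, ?_, J, n, O, ⟨h.fin, h.tell, h.dfl, h.cnt, h.single,
      .inServed x c k1 k2 h3 h4 (.inr ?_) rfl rfl (fun h => h.elim), h.out⟩, ?_⟩
    · simp [LocalConf.weight, k1, k3] at hb; omega
    · rcases h5 with h5 | h5
      · exact h5.elim
      · exact h5
    · simp [LocalConf.weight, k1, k3] at hb
      simp [LocalConf.weight, LocalConf.clearSig, k1]; omega
  | _ => simp_all

theorem Bounded.activate_other {c : Cin} {i : ℕ} (h : Bounded F rem og .idle rph j l b)
    (hij : j ≠ i) : Bounded F rem og (.dec false i c) rph j l b :=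
  h.rephase (fun _ _ => rfl) (fun _ _ => le_rfl) fun hs =>
    hs.congr (fun _ h => h) (fun c' => by simp [MapPhase.req, hij.symm]) (fun _ h => h)
      (fun _ h => h.elim) (fun _ h => h) Iff.rfl (fun _ => rfl)

/-- The refused copy stays asleep without a signal. This is harmless for a low channel, because copy
1 will eventually read the item there. -/
theorem Bounded.deny {c : Cin} {i : ℕ} (h : Bounded F rem og (.dec false i c) rph j l b)
    (hc : F.S.lvlIn c = .low) (hi : i ≠ 1) : Bounded F rem og .idle rph j l b := by
  refine h.rephase (fun _ _ => rfl) (fun _ _ => le_rfl) fun hs => ?_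
  by_cases hij : i = j
  · subst hij
    cases hs with
    | inServed x c' h1 h2 h3 h4 h5 h6 h7 h8 =>
      simp only [MapPhase.req, Option.some.injEq, Prod.mk.injEq, true_and] at h7
      subst h7
      exact .inDenied x c h1 h2 h3 h4 h5 h6 (.inl hc) hi (fun _ h => h.elim) (by simp [MapPhase.req])
    | run _ _ _ h => exact absurd rfl (h c)
    | inSignal _ _ _ _ _ _ _ _ h => exact absurd rfl (h c)
    | inDenied _ _ _ _ _ _ _ _ _ _ _ h => exact absurd rfl (h c)
    | outSignal _ _ _ _ h => exact absurd rfl (h c)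
    | outServed _ _ h => exact absurd rfl (h c)
  · exact hs.congr (fun _ h => h) (fun c' => by simp [MapPhase.req, hij]) (fun _ h => h)
      (fun _ h => h.elim) (fun _ h => h) Iff.rfl (fun _ => rfl)

/-- The state of the execution whose request is dealt with. -/
theorem StateInv.of_req {S : Setting Cin Cout} {c : Cin} (h : StateInv S ph rph j l)
    (hr : ph.req = some (j, c)) :
    l.port.stt = .S ∧ (∃ x, l.prg.next = some (.input x c)) ∧ l.port.sig = none ∧
      l.port.outq = [] ∧ rph.req ≠ some j ∧ (ph.Busy j c ∨ l.port.inq.onChannel c = []) ∧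
      (ph.Served S j c → l.port.inq.onChannel c ≠ []) := by
  cases h with
  | inServed x c' h1 h2 h3 h4 h5 h6 h7 h8 =>
    rw [hr] at h7; cases h7
    exact ⟨h1, ⟨x, h2⟩, h6, h3, h4, h5, h8⟩
  | run _ _ _ h => exact absurd hr (h c)
  | inSignal _ _ _ _ _ _ _ _ h => exact absurd hr (h c)
  | inDenied _ _ _ _ _ _ _ _ _ _ _ h => exact absurd hr (h c)
  | outSignal _ _ _ _ h => exact absurd hr (h c)
  | outServed _ _ h => exact absurd hr (h c)

theorem Bounded.cloned {c : Cin} (h : Bounded F rem og (.dec false 0 c) rph j l b) :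
    Bounded F rem og (.dec true 0 c) rph j l b :=
  h.rephase (fun _ _ => rfl) (fun _ _ => le_rfl) fun hs =>
    hs.congr (fun _ h => h) (fun _ => Iff.rfl) (fun _ h => h)
      (fun _ h => h.elim) (fun _ h => h) Iff.rfl (fun _ => rfl)

theorem not_sent_of_req (h : rph.req ≠ some j) : ¬ rph.Sent j := by
  intro hs
  cases rph <;> simp_all [RedPhase.Sent, RedPhase.req]

theorem Completes.cons_of_next {G : Prog Cin Cout → Mem → Queue Cin → Prop} {p : Prog Cin Cout}
    {m : Mem} {J : Queue Cin} {n : ℕ} {O : Queue Cout} (h : Completes G p m J n O) {x : Var}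
    {c : Cin} (hn : p.next = some (.input x c)) : J.onChannel c ≠ [] ∧ G p m J := by
  cases h with
  | skip => simp [Stmt.next] at hn
  | tau h1 => simp [hn] at h1
  | inp h1 h2 =>
    rw [hn] at h1; cases h1
    exact ⟨by simp [Queue.onChannel_cons_self], h2⟩
  | out h1 => simp [hn] at h1

/-- The clone continues with the default run attached to the present input of copy 0. Its low items
still to come are those of copy 0, and its outputs are discarded, so no condition on them arises.
Its weight is not bounded by anything known beforehand. -/
theorem Bounded.clone {c : Cin} {i : ℕ} (h : Bounded F rem og (.dec false 0 c) rph 0 l b)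
    (hk : F.k = .di) (hc : F.S.lvlIn c = .high) (hi : 2 ≤ i)
    (hri : rph.req ≠ some i) (ho : ∀ c, F.S.owner c ≠ i) :
    ∃ b', Bounded F rem og (.dec true 0 c) rph i { l with port := { l.port with stt := .S } } b' := by
  obtain ⟨J, n, O, h, -⟩ := h
  obtain ⟨h1, ⟨x, h2⟩, h3, h4, h5, h6, -⟩ := h.state.of_req rfl
  have h6 : l.port.inq.onChannel c = [] := h6.resolve_left fun h => h.elim
  obtain ⟨J', n', O', k1, k2, k3⟩ := (h.fin.cons_of_next h2).2 hk rfl x c h2 hc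
  refine ⟨_, J', n', O', ⟨k1.mono fun _ _ _ _ _ hi' => by omega, fun c' hc' => ?_, fun _ => ⟨k2, ?_⟩,
    fun hk' => by simp [hk] at hk', fun _ hi' => by omega,
    .inDenied x c rfl h2 h4 hri (.inr h6) h3 (.inr ⟨rfl, by omega⟩) (by omega) (fun _ h => h.elim)
      (fun c' hc' => by simp [MapPhase.req] at hc'; omega), fun c' hc' => absurd hc' (ho c')⟩, le_rfl⟩
  · have hc'' : F.S.lvlIn c' = .low := hc'.resolve_right (by omega)
    rw [Queue.onChannel_eq_of_onLevel k3 hc'']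
    exact h.tell c' (.inl hc'')
  -- The inherited queue has no high item at all: none on `c`, since copy 0 waits for one, and none
  -- elsewhere, since copy 0 holds a high item only on the channel it is about to read.
  · intro q hq hq'
    exfalso
    by_cases hqc : q.1 = c
    · have : q ∈ l.port.inq.onChannel c := Queue.mem_onChannel.2 ⟨hq, hqc⟩
      simp [h6] at this
    · have : q ∈ l.port.inq.onChannel q.1 := Queue.mem_onChannel.2 ⟨hq, rfl⟩
      obtain ⟨-, x', hx'⟩ := h.single hk rfl q.1 hq' (List.ne_nil_of_mem this)
      rw [h2] at hx'; cases hx'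
      exact hqc rfl

/-! ### Distribution of items -/

/-- The requesting copy has nothing on `c` locally but still has to read there. Where it has `t`,
its outstanding items on `c` are exactly those in `rem`; otherwise the count kept for RI leaves at
least one. -/
theorem Bounded.rem_ne_nil {c : Cin} {t : Bool} (h : Bounded F rem og (.dec t j c) rph j l b)
    (hc : Tells F.S j c ∨ F.k = .ri) : rem.onChannel c ≠ [] := by
  obtain ⟨J, n, O, h, -⟩ := h
  obtain ⟨-, ⟨x, h2⟩, -, -, -, h6, -⟩ := h.state.of_req rfl
  have h6 : l.port.inq.onChannel c = [] := h6.resolve_left fun h => by cases t <;> exact h.elim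
  have hJ := (h.fin.cons_of_next h2).1
  by_cases ht : Tells F.S j c
  · have := h.tell c ht
    rw [h6] at this
    simp only [MapPhase.flight, List.nil_append] at this
    rwa [← this]
  · simp only [Tells, not_or] at ht
    have := h.cnt (hc.resolve_left (by simpa [Tells] using ht)) ht.2 c
      (by cases hc : F.S.lvlIn c <;> simp_all)
    simp only [h6, MapPhase.dflight, List.length_nil, zero_add] at this
    intro hr
    rw [hr] at this
    exact hJ (List.length_eq_zero_iff.1 (by simpa using this))

theorem Bounded.fetch {c : Cin} {w : Val} {t : Bool} {i : ℕ}
    (h : Bounded F rem og (.dec t i c) rph j l b) (hd : Queue.deq c rem = some (w, rem')) :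
    Bounded F rem' og (.fetched i c w) rph j l b := by
  obtain ⟨d1, d2, -, -⟩ := Queue.deq_spec hd
  refine h.rephase (fun c' _ => ?_) (fun _ c' => ?_) fun hs => ?_
  · by_cases hc : c = c'
    · subst hc; simp [MapPhase.flight, d1]
    · simp [MapPhase.flight, d2 _ (Ne.symm hc), hc]
  · by_cases hc : c = c'
    · subst hc; simp [MapPhase.dflight, d1]
    · simp [MapPhase.dflight, d2 _ (Ne.symm hc), hc]
  · exact hs.congr (fun _ h => by cases t <;> exact h.elim) (fun c' => Iff.rfl) (fun _ h => h)
      (fun _ h => by cases t <;> first | exact h.elim | exact h) (fun _ h => h) Iff.rfl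
      (fun _ => rfl)

theorem onChannel_push (Q : Queue Cin) (c c' : Cin) (w : Val) :
    Queue.onChannel (Q ++ [(c, w)]) c' = Q.onChannel c' ++ if c = c' then [(c, w)] else [] := by
  rw [Queue.onChannel_append, Queue.onChannel_singleton]

theorem LocalConf.weight_push (l : LocalConf Cin Cout) (c : Cin) (w : Val) (n : ℕ) :
    LocalConf.weight { l with port := l.port.push c w } n ≤ l.weight n := by
  have hl : LocalConf.lacks { l with port := l.port.push c w } = true → l.lacks = true := by
    simp only [LocalConf.lacks, Port.push]
    split
    · simp only [Option.isNone_iff_eq_none, Queue.deq_eq_none, onChannel_push]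
      intro h; exact (List.append_eq_nil_iff.1 h).1
    · exact id
  have hs : (LocalConf.mk l.prg l.mem (l.port.push c w)).port.stt = l.port.stt := rfl
  unfold LocalConf.weight
  rw [hs]
  split
  · by_cases h : LocalConf.lacks { l with port := l.port.push c w } = true
    · rw [if_pos h, if_pos (hl h)]
    · rw [if_neg h]
      split <;> simp
  · exact le_rfl

/-- An item may reach a copy sleeping on that very channel only in a `Busy` phase, that is, before
the wake-up that follows. -/
theorem StateInv.push {S : Setting Cin Cout} {c : Cin} {w : Val} (h : StateInv S ph rph j l)
    (hB : ∀ c', ph.Busy j c' → ph'.Busy j c') (hB' : ph'.Busy j c ∨ l.port.stt = .E ∨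
      ∀ x, l.prg.next ≠ some (.input x c))
    (hr : ∀ c, ph.req = some (j, c) ↔ ph'.req = some (j, c))
    (hS : ∀ c', ph'.Served S j c' → c' ≠ c → ph.Served S j c')
    (hP : ∀ c, ph.Promised c → ph'.Promised c)
    (hD : ∀ c', ph'.Distributed c' → c' ≠ c → ph.Distributed c') :
    StateInv S ph' rph j { l with port := l.port.push c w } := by
  have hne : ∀ c' : Cin, (c' ≠ c → l.port.inq.onChannel c' ≠ []) →
      Queue.onChannel (l.port.inq ++ [(c, w)]) c' ≠ [] := by
    intro c' h
    rw [onChannel_push]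
    by_cases hc : c = c'
    · simp [hc]
    · simp [hc, h (Ne.symm hc)]
  have hbusy : ∀ x c', l.port.stt = .S → l.prg.next = some (.input x c') →
      (ph.Busy j c' ∨ l.port.inq.onChannel c' = []) →
      (ph'.Busy j c' ∨ Queue.onChannel (l.port.inq ++ [(c, w)]) c' = []) := by
    intro x c' h1 h2 h3
    by_cases hc : c = c'
    · subst hc
      refine .inl (hB'.resolve_right ?_)
      rintro (h | h)
      · simp [h1] at h
      · exact h x h2
    · simpa [onChannel_push, hc] using h3.imp (hB c') id
  cases h with
  | run h1 h2 h3 h4 h5 =>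
    exact .run h1 h2 h3 (fun c hc => h4 c ((hr c).2 hc)) h5
  | inSignal x c h1 h2 h3 h4 h5 h6 h7 =>
    exact .inSignal x c h1 h2 h3 h4 (hbusy x c h1 h2 h5) h6 (fun c hc => h7 c ((hr c).2 hc))
  | inServed x c h1 h2 h3 h4 h5 h6 h7 h8 =>
    exact .inServed x c h1 h2 h3 h4 (hbusy x c h1 h2 h5) h6 ((hr c).1 h7)
      (fun hc => hne c fun hcc => h8 (hS c hc hcc))
  | inDenied x c h1 h2 h3 h4 h5 h6 h7 h8 h9 h10 =>
    exact .inDenied x c h1 h2 h3 h4 (hbusy x c h1 h2 h5) h6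
      (h7.imp id fun h => ⟨hP c h.1, h.2⟩) h8 (fun hc hd => hne c fun hcc => h9 hc (hD c hd hcc))
      (fun c hc => h10 c ((hr c).2 hc))
  | outSignal c w h1 h2 h3 h4 h5 h6 =>
    exact .outSignal c w h1 h2 (fun c hc => h3 c ((hr c).2 hc)) h4 h5 h6
  | outServed h1 h2 h3 h4 h5 h6 =>
    exact .outServed h1 h2 (fun c hc => h3 c ((hr c).2 hc)) h4 h5 h6

theorem Bounded.tell {c : Cin} {w : Val} {i : ℕ} (h : Bounded F rem og (.fetched i c w) rph j l b)
    (hi : F.k ≠ .ri → Tells F.S i c) (ht : Tells F.S j c) :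
    Bounded F rem og (.told i c) rph j { l with port := l.port.push c w } b := by
  obtain ⟨J, n, O, h, hb⟩ := h
  refine ⟨J, n, O, ⟨h.fin, fun c' hc' => ?_, fun hj => ?_, fun hk hj c' hc' => ?_,
    fun hk hj c' hc' hne => ?_, h.state.push (fun _ h => h.elim) (.inl rfl) (fun _ => Iff.rfl)
      (fun c' h hne => absurd h.2.1.symm hne) (fun _ h => h) (fun _ h => h.elim), h.out⟩,
    (l.weight_push ..).trans hb⟩
  · have := h.tell c' hc'
    simp only [MapPhase.flight] at this
    simp only [Port.push, onChannel_push, MapPhase.flight, List.append_nil]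
    exact this
  · refine ⟨(h.dfl hj).1, fun q hq hq' => ?_⟩
    simp only [Port.push, List.mem_append, List.mem_singleton] at hq
    rcases hq with hq | rfl
    · exact (h.dfl hj).2 q hq hq'
    · rcases ht with ht | ht
      · simp [ht] at hq'
      · exact absurd ht hj
  · have := h.cnt hk hj c' hc'
    simp only [MapPhase.dflight] at this ⊢
    simp only [Port.push, onChannel_push, List.length_append]
    omega
  · by_cases hcc : c = c'
    · subst hcc
      -- Outside RI the requester has `t`, so a real high item is read only at the request of copy 0
      -- itself, which sleeps with nothing on this channel.
      have hi0 : i = j := by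
        rw [hj]
        exact (hi (by simp [hk])).resolve_left (by simp [hc'])
      subst hi0
      obtain ⟨-, h2, -, -, -, h6, -⟩ := h.state.of_req rfl
      have h6 : l.port.inq.onChannel c = [] := h6.resolve_left fun h => h.elim
      exact ⟨by simp [Port.push, onChannel_push, h6], h2⟩
    · have := h.single hk hj c' hc'
      simp only [Port.push, onChannel_push, hcc, if_false, List.append_nil] at hne ⊢
      exact this hne

theorem Bounded.tell_other {c : Cin} {w : Val} {i : ℕ}
    (h : Bounded F rem og (.fetched i c w) rph j l b) (ht : ¬ Tells F.S j c) :
    Bounded F rem og (.told i c) rph j l b := by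
  refine h.rephase (fun c' hc' => ?_) (fun _ _ => le_rfl) fun hs =>
    hs.congr (fun _ h => h.elim) (fun _ => Iff.rfl) (fun c' h => absurd (h.2.1 ▸ h.2.2) ht)
      (fun _ h => h) (fun _ h => h) Iff.rfl (fun _ => rfl)
  have : c ≠ c' := by rintro rfl; exact ht hc'
  simp [MapPhase.flight, this]

theorem Bounded.supply {c : Cin} {i : ℕ} (h : Bounded F rem og (.told i c) rph j l b)
    (ht : ¬ Tells F.S j c) :
    Bounded F rem og (.mapped i c) rph j { l with port := l.port.push c (F.d.inp c) } b := by
  obtain ⟨J, n, O, h, hb⟩ := h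
  refine ⟨J, n, O, ⟨h.fin, fun c' hc' => ?_, fun hj => ?_, fun hk hj c' hc' => ?_,
    fun hk hj => absurd (.inr hj) ht, h.state.push (fun _ h => h) (.inl rfl) (fun _ => Iff.rfl)
      (fun c' h hne => absurd h.2.symm hne) (fun _ h => h)
      (fun c' h hne => absurd (h : c = c').symm hne), h.out⟩, (l.weight_push ..).trans hb⟩
  · have hcc : c ≠ c' := by rintro rfl; exact ht hc'
    simpa [Port.push, onChannel_push, hcc, MapPhase.flight] using h.tell c' hc'
  · refine ⟨(h.dfl hj).1, fun q hq hq' => ?_⟩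
    simp only [Port.push, List.mem_append, List.mem_singleton] at hq
    rcases hq with hq | rfl
    · exact (h.dfl hj).2 q hq hq'
    · rfl
  · have := h.cnt hk hj c' hc'
    simp only [MapPhase.dflight] at this ⊢
    simp only [Port.push, onChannel_push, List.length_append]
    split at this <;> simp_all

theorem Bounded.supply_other {c : Cin} {i : ℕ} (h : Bounded F rem og (.told i c) rph j l b)
    (ht : Tells F.S j c) : Bounded F rem og (.mapped i c) rph j l b := by
  obtain ⟨J, n, O, h, hb⟩ := h
  refine ⟨J, n, O, ⟨h.fin, h.tell, h.dfl, fun hk hj c' hc' => ?_, h.single, ?_, h.out⟩, hb⟩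
  · have := h.cnt hk hj c' hc'
    have hcc : c ≠ c' := by
      rintro rfl
      rcases ht with ht | ht
      · simp [ht] at hc'
      · exact hj ht
    simpa [MapPhase.dflight, hcc] using this
  · cases h.state with
    | run h1 h2 h3 h4 h5 => exact .run h1 h2 h3 h4 h5
    | inSignal x c h1 h2 h3 h4 h5 h6 h7 => exact .inSignal x c h1 h2 h3 h4 h5 h6 h7
    | inServed x c h1 h2 h3 h4 h5 h6 h7 h8 =>
      refine .inServed x c h1 h2 h3 h4 h5 h6 h7 fun hS => h8 ?_
      obtain ⟨rfl, rfl⟩ := hS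
      exact ⟨rfl, rfl, ht⟩
    | inDenied x c' h1 h2 h3 h4 h5 h6 h7 h8 h9 h10 =>
      refine .inDenied x c' h1 h2 h3 h4 h5 h6 h7 h8 (fun hc hd => ?_) h10
      cases (hd : c = c')
      rcases h7 with h7 | h7
      · simp [h7] at hc
      · rcases ht with ht | ht
        · simp [ht] at hc
        · exact absurd ht h7.2
    | outSignal c w h1 h2 h3 h4 h5 h6 => exact .outSignal c w h1 h2 h3 h4 h5 h6
    | outServed h1 h2 h3 h4 h5 h6 => exact .outServed h1 h2 h3 h4 h5 h6

theorem Bounded.give {c : Cin} (h : Bounded F rem og (.dec false j c) rph j l b)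
    (ht : ¬ Tells F.S j c) :
    Bounded F rem og (.given j c) rph j { l with port := l.port.push c (F.d.inp c) } b := by
  obtain ⟨J, n, O, h, hb⟩ := h
  refine ⟨J, n, O, ⟨h.fin, fun c' hc' => ?_, fun hj => ?_, fun hk hj c' hc' => ?_,
    fun hk hj => absurd (.inr hj) ht, h.state.push (fun _ h => h.elim) (.inl ⟨rfl, rfl⟩)
      (fun _ => Iff.rfl) (fun _ h hne => absurd h.2.symm hne) (fun _ h => h.elim)
      (fun _ h _ => h.elim), h.out⟩, (l.weight_push ..).trans hb⟩
  · have hcc : c ≠ c' := by rintro rfl; exact ht hc'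
    simpa [Port.push, onChannel_push, hcc, MapPhase.flight] using h.tell c' hc'
  · refine ⟨(h.dfl hj).1, fun q hq hq' => ?_⟩
    simp only [Port.push, List.mem_append, List.mem_singleton] at hq
    rcases hq with hq | rfl
    · exact (h.dfl hj).2 q hq hq'
    · rfl
  · have := h.cnt hk hj c' hc'
    simp only [MapPhase.dflight] at this ⊢
    simp only [Port.push, onChannel_push, List.length_append]
    omega

theorem Bounded.give_other {c : Cin} {i : ℕ} (h : Bounded F rem og (.dec false i c) rph j l b)
    (hij : j ≠ i) : Bounded F rem og (.given i c) rph j l b :=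
  h.rephase (fun _ _ => rfl) (fun _ _ => le_rfl) fun hs =>
    hs.congr (fun _ h => h.elim) (fun _ => Iff.rfl) (fun _ h => absurd h.1.symm hij)
      (fun _ h => h.elim) (fun _ h => h) Iff.rfl (fun _ => rfl)

/-! ### Waking -/

/-- A copy is woken with its item at hand or after an output, so its summand becomes 5 and not 60.
-/
theorem LocalConf.weight_awake {l : LocalConf Cin Cout} (hS : l.port.stt = .S)
    (h : ∀ x c, l.prg.next = some (.input x c) → l.port.inq.onChannel c ≠ []) (n : ℕ) :
    LocalConf.weight { l with port := l.port.awake } n ≤ l.weight n := by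
  have : LocalConf.lacks { l with port := l.port.awake } = false := by
    simp only [LocalConf.lacks, Port.awake]
    split
    · rename_i x c hn
      obtain ⟨w, Q, hd⟩ := Queue.exists_deq (h x c hn)
      simp [hd]
    · rfl
  unfold LocalConf.weight
  rw [if_neg (by simp [this])]
  simp only [Port.awake, hS]
  split <;> simp

theorem isReady_iff {c : Cin} {T : Cin → Finset Priv} :
    isReady c j T l = true ↔ l.port.stt = .S ∧ (∃ x, l.prg.next = some (.input x c)) ∧
      l.port.inq.onChannel c ≠ [] := by
  unfold isReady
  simp only [Bool.and_eq_true, decide_eq_true_eq]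
  have h1 : (Queue.deq c l.port.inq).isSome = true ↔ l.port.inq.onChannel c ≠ [] := by
    rw [← not_iff_not, ne_eq, not_not, ← Queue.deq_eq_none]
    simp
  rw [h1, and_assoc]
  refine and_congr_right fun _ => and_congr_left fun _ => ?_
  split
  · rename_i x c' h; simp [h]
  · rename_i h
    simp only [Bool.false_eq_true, false_iff, not_exists]
    intro x hx
    exact h x c hx

theorem Bounded.wake_ready {c : Cin} {i : ℕ} {T : Cin → Finset Priv}
    (h : Bounded F rem og (.mapped i c) rph j l b) (hl : isReady c j T l = true) :
    Bounded F rem og .idle rph j { l with port := l.port.awake } b := by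
  obtain ⟨J, n, O, h, hb⟩ := h
  obtain ⟨h1, ⟨x, h2⟩, h3⟩ := isReady_iff.1 hl
  have key : l.port.outq = [] ∧ rph.req ≠ some j := by
    cases h.state <;> simp_all
  refine ⟨J, n, O, ⟨h.fin, h.tell, h.dfl, h.cnt, h.single,
    .run rfl rfl key.1 (by simp [MapPhase.req]) key.2, h.out⟩,
    (LocalConf.weight_awake h1 (fun x' c' hx => ?_) n).trans hb⟩
  rw [h2] at hx; cases hx
  exact h3

/-- The requester and the clones waiting on a high `c` have an item by now and hence are ready. A
copy still asleep for an input has no item on its channel, and either keeps its signal or was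
refused a low item. -/
theorem Bounded.wake_unready {c : Cin} {i : ℕ} {T : Cin → Finset Priv}
    (h : Bounded F rem og (.mapped i c) rph j l b) (hl : ¬ isReady c j T l = true) :
    Bounded F rem og .idle rph j l b := by
  rw [isReady_iff] at hl
  refine h.rephase (fun _ _ => rfl) (fun _ _ => le_rfl) fun hs => ?_
  have hemp : ∀ x c', l.port.stt = .S → l.prg.next = some (.input x c') →
      ((MapPhase.mapped i c).Busy j c' ∨ l.port.inq.onChannel c' = []) →
      (MapPhase.idle.Busy j c' ∨ l.port.inq.onChannel c' = []) := by
    intro x c' h1 h2 h3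
    right
    rcases h3 with h3 | h3
    · cases (h3 : c = c')
      by_contra h4
      exact hl ⟨h1, ⟨x, h2⟩, h4⟩
    · exact h3
  cases hs with
  | run h1 h2 h3 h4 h5 => exact .run h1 h2 h3 (by simp [MapPhase.req]) h5
  | inSignal x c h1 h2 h3 h4 h5 h6 h7 =>
    exact .inSignal x c h1 h2 h3 h4 (hemp x c h1 h2 h5) h6 (by simp [MapPhase.req])
  | inServed x c' h1 h2 h3 h4 h5 h6 h7 h8 =>
    cases (h7 : some (i, c) = some (j, c'))
    exact absurd ⟨h1, ⟨x, h2⟩, h8 ⟨rfl, rfl⟩⟩ hl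
  | inDenied x c' h1 h2 h3 h4 h5 h6 h7 h8 h9 h10 =>
    refine .inDenied x c' h1 h2 h3 h4 (hemp x c' h1 h2 h5) h6 (.inl ?_) h8 (fun _ h => h.elim)
      (by simp [MapPhase.req])
    rcases h7 with h7 | h7
    · exact h7
    · cases (h7.1 : c = c')
      cases hc : F.S.lvlIn c with
      | low => rfl
      | high => exact absurd ⟨h1, ⟨x, h2⟩, h9 hc rfl⟩ hl
  | outSignal c w h1 h2 h3 h4 h5 h6 =>
    exact .outSignal c w h1 h2 (by simp [MapPhase.req]) h4 h5 h6
  | outServed h1 h2 h3 h4 h5 h6 => exact .outServed h1 h2 (by simp [MapPhase.req]) h4 h5 h6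

theorem Bounded.wake_given {c : Cin} (h : Bounded F rem og (.given j c) rph j l b) :
    Bounded F rem og .idle rph j { l with port := l.port.awake } b := by
  obtain ⟨J, n, O, h, hb⟩ := h
  obtain ⟨h1, ⟨x, h2⟩, h3, h4, h5, -, h6⟩ := h.state.of_req rfl
  refine ⟨J, n, O, ⟨h.fin, h.tell, h.dfl, h.cnt, h.single,
    .run rfl rfl h4 (by simp [MapPhase.req]) h5, h.out⟩,
    (LocalConf.weight_awake h1 (fun x' c' hx => ?_) n).trans hb⟩
  rw [h2] at hx; cases hx
  exact h6 ⟨rfl, rfl⟩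

theorem Bounded.wake_given_other {c : Cin} {i : ℕ} (h : Bounded F rem og (.given i c) rph j l b)
    (hij : j ≠ i) : Bounded F rem og .idle rph j l b :=
  h.rephase (fun _ _ => rfl) (fun _ _ => le_rfl) fun hs =>
    hs.congr (fun _ h => absurd h.1.symm hij) (fun c' => by simp [MapPhase.req, hij.symm])
      (fun _ h => h.elim) (fun _ h => h.elim) (fun _ h => h.elim) Iff.rfl (fun _ => rfl)

/-! ### REDUCE -/

theorem Bounded.rephase_red {og' : Queue Cout} (h : Bounded F rem og ph rph j l b)
    (hs : StateInv F.S ph rph j l → StateInv F.S ph rph' j l)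
    (ho : ∀ c, F.S.owner c = j → ∀ P : Queue Cout, (rph'.Sent j → P = []) →
      (¬ rph'.Sent j → P = l.port.outq) → ∃ P' : Queue Cout, (rph.Sent j → P' = []) ∧
      (¬ rph.Sent j → P' = l.port.outq) ∧
      Queue.onChannel og' c ++ P.onChannel c = og.onChannel c ++ P'.onChannel c) :
    Bounded F rem og' ph rph' j l b := by
  obtain ⟨J, n, O, h, hb⟩ := h
  refine ⟨J, n, O, ⟨h.fin, h.tell, h.dfl, h.cnt, h.single, hs h.state, fun c hc P h1 h2 => ?_⟩, hb⟩
  obtain ⟨P', h3, h4, h5⟩ := ho c hc P h1 h2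
  rw [h5]
  exact h.out c hc P' h3 h4

theorem Bounded.rephase_red_other (h : Bounded F rem og ph rph j l b)
    (h1 : rph.req ≠ some j) (h2 : rph'.req ≠ some j) : Bounded F rem og ph rph' j l b :=
  h.rephase_red (fun hs => hs.congr (fun _ h => h) (fun _ => Iff.rfl) (fun _ h => h) (fun _ h => h)
    (fun _ h => h) (by simp [h1, h2]) (fun h => absurd h h1)) fun c _ P _ hP =>
    ⟨P, fun h => absurd h (not_sent_of_req h1), fun _ => hP (not_sent_of_req h2), rfl⟩

theorem StateInv.of_red_req {S : Setting Cin Cout} (h : StateInv S ph rph j l)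
    (hr : rph.req = some j) :
    l.port.stt = .S ∧ l.prg.next = none ∧ l.port.sig = none ∧
      l.port.outq = rph.held ∧ ∀ c, ph.req ≠ some (j, c) := by
  cases h with
  | outServed h1 h2 h3 h4 h5 => exact ⟨h1, h2, h4, h5, h3⟩
  | _ => exact absurd hr (by assumption)

theorem Bounded.clearSig_output {c : Cout} (h : Bounded F rem og ph .idle j l b)
    (hl : l.asksOutput = some c) :
    ∃ b' w, b' + 49 ≤ b ∧ Bounded F rem og ph (.start j c w) j l.clearSig b' := by
  obtain ⟨J, n, O, h, hb⟩ := h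
  have key : l.port.stt = .S ∧ l.port.sig = some (.inr c) := by
    unfold LocalConf.asksOutput at hl
    split at hl
    · cases hl; exact ⟨by assumption, by assumption⟩
    · cases hl
  obtain ⟨k1, k2⟩ := key
  cases h.state with
  | outSignal c' w h1 h2 h3 h4 h5 h6 =>
    rw [k2] at h4; cases h4
    refine ⟨b - 49, w, ?_, J, n, O, ⟨h.fin, h.tell, h.dfl, h.cnt, h.single,
      .outServed k1 h2 h3 rfl h5 rfl, h.out⟩, ?_⟩
    · simp [LocalConf.weight, k1, k2] at hb; omega
    · simp [LocalConf.weight, k1, k2] at hb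
      simp [LocalConf.weight, LocalConf.clearSig, k1]; omega
  | _ => simp_all

theorem Bounded.outq_start {c : Cout} {w : Val} (h : Bounded F rem og ph (.start j c w) j l b) :
    l.port.outq = [(c, w)] := by
  obtain ⟨J, n, O, h, -⟩ := h
  exact (h.state.of_red_req rfl).2.2.2.1

/-- For the owner, the item passes from its local queue to the global output, with the same
concatenation. For everybody else the output on the channels they own is unaffected. -/
theorem Bounded.send {c : Cout} {w : Val} {i : ℕ} (h : Bounded F rem og ph (.start i c w) j l b) :
    Bounded F rem (if F.S.owner c = i then og ++ [(c, w)] else og) ph (.sent i c w) j l b := by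
  by_cases hij : i = j
  · subst hij
    have hq := h.outq_start
    refine h.rephase_red (fun hs => hs.congr (fun _ h => h) (fun _ => Iff.rfl) (fun _ h => h)
      (fun _ h => h) (fun _ h => h) Iff.rfl (fun _ => rfl)) fun c' hc' P hP _ =>
      ⟨_, fun h => h.elim, fun _ => rfl, ?_⟩
    rw [hP rfl, hq]
    split
    · simp [Queue.onChannel_append]
    · rename_i hc
      have : c ≠ c' := by rintro rfl; exact hc hc'
      simp [Queue.onChannel_singleton, this]
  · refine h.rephase_red (fun hs => hs.congr (fun _ h => h) (fun _ => Iff.rfl) (fun _ h => h)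
      (fun _ h => h) (fun _ h => h) Iff.rfl (fun _ => rfl)) fun c' hc' P _ hP =>
      ⟨P, fun h => h.elim, fun _ => hP hij, ?_⟩
    split
    · rename_i hc
      have : c ≠ c' := by rintro rfl; exact hij (hc.symm.trans hc')
      simp [Queue.onChannel_append, Queue.onChannel_singleton, this]
    · rfl

theorem Bounded.clean {c : Cout} {w : Val} (h : Bounded F rem og ph (.sent j c w) j l b) :
    Bounded F rem og ph (.cleaned j) j
      { l with port := { l.port with outq := Queue.remove c l.port.outq } } b := by
  obtain ⟨J, n, O, h, hb⟩ := h
  obtain ⟨h1, h2, h3, h4, h5⟩ := h.state.of_red_req rfl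
  have hr : Queue.remove c l.port.outq = [] := by
    rw [h4]; simp [RedPhase.held, Queue.remove, Queue.deq]
  refine ⟨J, n, O, ⟨h.fin, h.tell, h.dfl, h.cnt, h.single, .outServed h1 h2 h5 h3 hr rfl,
    fun c hc P _ hP => ?_⟩, hb⟩
  rw [hP fun h => h.elim, hr]
  exact h.out c hc [] (fun _ => rfl) (fun h => absurd rfl h)

theorem Bounded.wake_cleaned (h : Bounded F rem og ph (.cleaned j) j l b) :
    Bounded F rem og ph .idle j { l with port := l.port.awake } b := by
  obtain ⟨J, n, O, h, hb⟩ := h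
  obtain ⟨h1, h2, h3, h4, h5⟩ := h.state.of_red_req rfl
  exact ⟨J, n, O, ⟨h.fin, h.tell, h.dfl, h.cnt, h.single,
    .run rfl rfl h4 h5 (by simp [RedPhase.req]), h.out⟩,
    (LocalConf.weight_awake h1 (fun x' c' hx => by simp [h2] at hx) n).trans hb⟩

end

/-- The size of a program (its loops do not count). -/
def Stmt.size {E : Type*} {A : Type*} : Stmt E A → ℕ
  | .skip => 0
  | .assign _ _ => 1
  | .seq p q => p.size + q.size + 1
  | .cond _ p q => p.size + q.size + 1
  | .loop _ _ => 0
  | .act _ => 1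

section
variable {Cin : Type u} {Cout : Type v} [DecidableEq Cin] [DecidableEq Cout]

/-! ### The stack of local executions -/

/-- All local executions satisfy the invariant, with weights of sum `W`. -/
def Copies (F : Frame Cin Cout) (rem : Queue Cin) (og : Queue Cout) (ph : MapPhase Cin)
    (rph : RedPhase Cout) (ex : List (LocalConf Cin Cout)) (W : ℕ) : Prop :=
  ∃ f : ℕ → ℕ, (∀ j l, ex[j]? = some l → Bounded F rem og ph rph j l (f j)) ∧
    ∑ j ∈ Finset.range ex.length, f j = W

variable {F : Frame Cin Cout} {rem rem' : Queue Cin} {og og' : Queue Cout}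
  {ph ph' : MapPhase Cin} {rph rph' : RedPhase Cout} {ex : List (LocalConf Cin Cout)} {W : ℕ}

theorem Copies.imp (h : Copies F rem og ph rph ex W)
    (h' : ∀ j l b, Bounded F rem og ph rph j l b → Bounded F rem' og' ph' rph' j l b) :
    Copies F rem' og' ph' rph' ex W := by
  obtain ⟨f, h1, h2⟩ := h
  exact ⟨f, fun j l hl => h' _ _ _ (h1 j l hl), h2⟩

theorem Copies.mapIdx (h : Copies F rem og ph rph ex W)
    (g : ℕ → LocalConf Cin Cout → LocalConf Cin Cout)
    (h' : ∀ j l b, j < ex.length → Bounded F rem og ph rph j l b →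
      Bounded F rem' og' ph' rph' j (g j l) b) :
    Copies F rem' og' ph' rph' (ex.mapIdx g) W := by
  obtain ⟨f, h1, h2⟩ := h
  refine ⟨f, fun j l hl => ?_, by simpa using h2⟩
  rw [List.getElem?_mapIdx, Option.map_eq_some_iff] at hl
  obtain ⟨l, hl, rfl⟩ := hl
  exact h' _ _ _ (List.getElem?_eq_some_iff.1 hl).1 (h1 j l hl)

theorem Copies.set (h : Copies F rem og ph rph ex W) {i : ℕ} {l l' : LocalConf Cin Cout} {x : ℕ}
    (hi : ex[i]? = some l)
    (h' : ∀ j l b, j ≠ i → Bounded F rem og ph rph j l b → Bounded F rem' og' ph' rph' j l b)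
    (hl : ∀ b, Bounded F rem og ph rph i l b →
      ∃ b', b' + x ≤ b ∧ Bounded F rem' og' ph' rph' i l' b') :
    ∃ W', W' + x ≤ W ∧ Copies F rem' og' ph' rph' (ex.set i l') W' := by
  obtain ⟨f, h1, rfl⟩ := h
  obtain ⟨b', h2, h3⟩ := hl _ (h1 i l hi)
  have hlt := (List.getElem?_eq_some_iff.1 hi).1
  refine ⟨_, ?_, Function.update f i b', fun j k hk => ?_, rfl⟩
  · rw [List.length_set, Finset.sum_update_of_mem (Finset.mem_range.2 hlt),
      ← Finset.add_sum_erase _ f (Finset.mem_range.2 hlt), Finset.sdiff_singleton_eq_erase]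
    omega
  · rw [List.getElem?_set] at hk
    by_cases hij : i = j
    · subst hij
      simp only [if_true, hlt] at hk
      cases hk
      simpa using h3
    · simp only [hij, if_false] at hk
      rw [Function.update_of_ne (Ne.symm hij)]
      exact h' _ _ _ (Ne.symm hij) (h1 j k hk)

/-- The sum grows by the weight of the new copy, which is why the sum alone cannot serve as
termination measure. -/
theorem Copies.concat (h : Copies F rem og ph rph ex W) {l : LocalConf Cin Cout} {b : ℕ}
    (hl : Bounded F rem og ph rph ex.length l b) :
    Copies F rem og ph rph (ex ++ [l]) (W + b) := by
  obtain ⟨f, h1, rfl⟩ := h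
  refine ⟨Function.update f ex.length b, fun j k hk => ?_, ?_⟩
  · rw [List.getElem?_append] at hk
    split at hk
    · rename_i hj
      rw [Function.update_of_ne hj.ne]
      exact h1 j k hk
    · have hj : j - ex.length = 0 := by
        by_contra hne
        obtain ⟨m, hm⟩ := Nat.exists_eq_succ_of_ne_zero hne
        simp [hm] at hk
      have : j = ex.length := by omega
      subst this
      simp only [Nat.sub_self, List.getElem?_cons_zero, Option.some.injEq] at hk
      subst hk
      simpa using hl
  · rw [List.length_append, List.length_singleton, Finset.sum_range_succ, Function.update_self]
    congr 1
    refine Finset.sum_congr rfl fun j hj => ?_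
    rw [Function.update_of_ne (Finset.mem_range.1 hj).ne]

/-! ### The programs of MAP and REDUCE -/

/-- What remains to be done after sending the item to those entitled. -/
def supplyProg (d : Defaults Cin Cout) (c : Cin) : MapProg Cin Cout :=
  .seq (.act (.map (fun _ _ => d.inp c) c (cannotTell c))) (.act (.wake (isReady c)))

/-- What remains to be done after reading an item. -/
def tellProg (d : Defaults Cin Cout) (c : Cin) : MapProg Cin Cout :=
  .seq (.act (.map (fun _ m => m 0) c (canTell c))) (supplyProg d c)

/-- What remains to be done after the decision on sending an output. -/
def cleanProg (i : ℕ) (c : Cout) : RedProg Cin Cout :=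
  .seq (.act (.clean c (identical i))) (.act (.wake (identical i)))

/-- What remains to be done after retrieving an output. -/
def sendProg (i : ℕ) (c : Cout) : RedProg Cin Cout :=
  .seq (.cond (hasPriv .tell i c) (.act (.output (fun _ m => m 0) c)) .skip) (cleanProg i c)

/-- The program is `q`, possibly after a completed instruction. -/
def AfterSkip {E : Type*} {A : Type*} (q p : Stmt E A) : Prop := p = q ∨ p = .seq .skip q

/-- Programs of MAP that decide on the request of `i` on `c`, after cloning if `b`. -/
inductive Decides (F : Frame Cin Cout) (i : ℕ) (c : Cin) : Bool → MapProg Cin Cout → Prop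
  | fetch (b : Bool) : (Tells F.S i c ∨ F.k = .ri) → Decides F i c b (fetchAndMap F.d c)
  | give : ¬ Tells F.S i c → Decides F i c false (mapDefault F.d i c)
  | skipSeq {b p} : Decides F i c b p → Decides F i c b (.seq .skip p)
  | deny {e p q} (t : Bool) : (∀ T m, T i = F.k.column F.S i → e T m = .bool t) →
      (bif t then p else q) = .skip → F.S.lvlIn c = .low → i ≠ 1 →
      Decides F i c false (.cond e p q)
  | cond {b e p q} (t : Bool) : (∀ T m, T i = F.k.column F.S i → e T m = .bool t) →
      Decides F i c b (bif t then p else q) → Decides F i c b (.cond e p q)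
  | seqCond {b e p q r} (t : Bool) : (∀ T m, T i = F.k.column F.S i → e T m = .bool t) →
      Decides F i c b (.seq (bif t then p else q) r) → Decides F i c b (.seq (.cond e p q) r)
  | clone {p} : F.k = .di → F.S.lvlIn c = .high → i = 0 → Decides F i c true p →
      Decides F i c false (.seq (.act (.clone (identical i) (clonePrivIn F.S) fun _ => ∅)) p)

/-- The program of MAP in each phase. -/
inductive MapRuns (F : Frame Cin Cout) : MapPhase Cin → MapProg Cin Cout → Mem → Prop
  | idle (m) : MapRuns F .idle .skip m
  | dec {b i c p m} : Decides F i c b p → MapRuns F (.dec b i c) p m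
  | fetched {i c w p m} : (F.k ≠ .ri → Tells F.S i c) → m 0 = w → AfterSkip (tellProg F.d c) p →
      MapRuns F (.fetched i c w) p m
  | told {i c p m} : AfterSkip (supplyProg F.d c) p → MapRuns F (.told i c) p m
  | mapped {i c p m} : AfterSkip (.act (.wake (isReady c))) p → MapRuns F (.mapped i c) p m
  | given {i c p m} : AfterSkip (.act (.wake (identical i))) p → MapRuns F (.given i c) p m

/-- The program of REDUCE in each phase. -/
inductive RedRuns (F : Frame Cin Cout) : RedPhase Cout → RedProg Cin Cout → Mem → Prop
  | idle (m) : RedRuns F .idle .skip m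
  | init {i c w m} : RedRuns F (.start i c w) (reduceProg F.d i c) m
  | ask {i c w m p} :
      AfterSkip (.seq (.cond (hasPriv .ask i c) (.act (.retrieve 0 i c)) .skip) (sendProg i c)) p →
      RedRuns F (.start i c w) p m
  | retrieve {i c w m} : F.S.owner c = i →
      RedRuns F (.start i c w) (.seq (.act (.retrieve 0 i c)) (sendProg i c)) m
  | send {i c w m p} : (F.S.owner c = i → m 0 = w) → AfterSkip (sendProg i c) p →
      RedRuns F (.start i c w) p m
  | output {i c w m} : F.S.owner c = i → m 0 = w →
      RedRuns F (.start i c w) (.seq (.act (.output (fun _ m => m 0) c)) (cleanProg i c)) m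
  | sent {i c w m p} : AfterSkip (cleanProg i c) p → RedRuns F (.sent i c w) p m
  | cleaned {i m p} : AfterSkip (.act (.wake (identical i))) p → RedRuns F (.cleaned i) p m

/-- A symbolic evaluation of the three programs. It shows that only requests on low channels by
copies other than copy 1 are refused, and that cloning is always followed by a read. -/
theorem decides_mapProg (F : Frame Cin Cout) (i : ℕ) (c : Cin) :
    Decides F i c false ((F.k.mech F.S F.d).mapProg i c) := by
  have hp : ∀ (r : Priv) T m, T i = F.k.column F.S i →
      hasPriv r i c T m = .bool (decide (r ∈ F.k.column F.S i c)) := by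
    intro r T m h; simp [hasPriv, h]
  have ht := F.k.tell_mem_column F.S i c
  have fetch : ∀ b, Tells F.S i c → Decides F i c b (fetchAndMap F.d c) := fun b h => .fetch b (.inl h)
  obtain ⟨k, S, d, tg⟩ := F
  cases k with
  | ri =>
    refine if h : Priv.ask ∈ Kind.ri.column S i c then ?_ else ?_
    · exact .cond _ (hp .ask) (by simpa [h] using .fetch false (.inr rfl))
    · refine .deny _ (hp .ask) (by simp [h]) ?_ ?_ <;>
        cases hc : S.lvlIn c <;> by_cases hi : i = 0 <;> by_cases hi' : i = 1 <;>
        simp_all [Kind.column]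
  | ni =>
    refine .cond _ (hp .ask) ?_
    by_cases h : Priv.ask ∈ Kind.ni.column S i c
    · simp only [h, decide_true, cond_true]
      refine fetch _ (ht.1 ?_)
      cases hc : S.lvlIn c <;> by_cases hi : i = 0 <;> by_cases hi' : i = 1 <;>
        simp_all [Kind.column]
    · simp only [h, decide_false, cond_false]
      by_cases h' : Priv.tell ∈ Kind.ni.column S i c
      · refine .deny _ (hp .tell) (by simp [h']) ?_ ?_ <;>
          cases hc : S.lvlIn c <;> by_cases hi : i = 0 <;> by_cases hi' : i = 1 <;>
          simp_all [Kind.column]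
      · exact .cond _ (hp .tell) (by simpa [h'] using .give (fun h => h' (ht.2 h)))
  | di =>
    refine .seqCond (decide (S.lvlIn c = .high ∧ i = 0)) (fun _ _ _ => rfl) ?_
    have key : ∀ b, (b = true → S.lvlIn c = .high ∧ i = 0) → Decides ⟨.di, S, d, tg⟩ i c b
        (.cond (hasPriv .ask i c)
          (.cond (hasPriv .tell i c) (fetchAndMap d c) (mapDefault d i c)) .skip) := by
      intro b hb
      by_cases h : Priv.ask ∈ Kind.di.column S i c
      · refine .cond _ (hp .ask) ?_
        simp only [h, decide_true, cond_true]
        refine .cond _ (hp .tell) ?_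
        by_cases h' : Priv.tell ∈ Kind.di.column S i c
        · simp only [h', decide_true, cond_true]
          exact fetch b (ht.1 h')
        · simp only [h', decide_false, cond_false]
          -- After cloning, the request is one of copy 0, which has `t`; so a default item is given
          -- only where no cloning took place.
          have hb' : b = false := by
            by_contra hb'
            refine h' (ht.2 (.inr (hb ?_).2))
            simpa using hb'
          subst hb'
          exact .give fun h => h' (ht.2 h)
      · have hb' : b = false := by
          by_contra hb'
          obtain ⟨h1, h2⟩ := hb (by simpa using hb')
          simp [Kind.column, h1, h2] at h
        subst hb'
        refine .deny _ (hp .ask) (by simp [h]) ?_ ?_ <;>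
          cases hc : S.lvlIn c <;> by_cases hi : i = 0 <;> by_cases hi' : i = 1 <;>
          simp_all [Kind.column]
    by_cases h : S.lvlIn c = .high ∧ i = 0
    · simp only [h, and_self, decide_true, cond_true]
      have := key true (fun _ => h)
      obtain ⟨h1, rfl⟩ := h
      exact .clone rfl h1 rfl this
    · simp only [h, decide_false, cond_false]
      exact .skipSeq (key false (fun hb => by simp at hb))

theorem size_mapProg (F : Frame Cin Cout) (i : ℕ) (c : Cin) :
    ((F.k.mech F.S F.d).mapProg i c).size < 49 := by
  obtain ⟨k, S, d, tg⟩ := F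
  cases k <;> simp [Kind.mech, mechRI, mechDI, mechNI, fetchAndMap, mapDefault, Stmt.size]

theorem redProg_eq (F : Frame Cin Cout) (i : ℕ) (c : Cout) :
    (F.k.mech F.S F.d).redProg i c = reduceProg F.d i c := by
  obtain ⟨k, S, d, tg⟩ := F
  cases k <;> rfl

theorem size_reduceProg (d : Defaults Cin Cout) (i : ℕ) (c : Cout) :
    (reduceProg d i c).size < 49 := by
  simp [reduceProg, Stmt.size]

theorem Decides.ne_skip {i : ℕ} {c : Cin} {b : Bool} {p : MapProg Cin Cout}
    (h : Decides F i c b p) : p ≠ .skip := by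
  cases h <;> simp [fetchAndMap, mapDefault]

end

/-! ### The invariant of the whole mechanism and its preservation. -/

section
variable {Cin : Type u} {Cout : Type v} [DecidableEq Cin] [DecidableEq Cout]

/-- The invariant of the mechanism; the global input queue is left open. -/
structure Inv (F : Frame Cin Cout) (rem : Queue Cin) (ph : MapPhase Cin) (rph : RedPhase Cout)
    (γ : Config Cin Cout) (W : ℕ) : Prop where
  tm : ∀ j < γ.env.ex.length, γ.env.tm j = F.k.column F.S j
  tr : γ.env.tr = reduceTable F.S
  two_le : 2 ≤ γ.env.ex.length
  req : ∀ i c, ph.req = some (i, c) → i < γ.env.ex.length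
  rreq : ∀ i, rph.req = some i → i < γ.env.ex.length
  copies : Copies F rem γ.env.outq ph rph γ.env.ex W
  map : MapRuns F ph γ.mapPrg γ.mapMem
  red : RedRuns F rph γ.redPrg γ.redMem

/-- The mechanism that a frame refers to. -/
abbrev Frame.mech (F : Frame Cin Cout) : Mechanism Cin Cout := F.k.mech F.S F.d

variable {F : Frame Cin Cout} {rem rem' : Queue Cin} {ph ph' : MapPhase Cin}
  {rph rph' : RedPhase Cout} {γ γ' : Config Cin Cout} {W : ℕ}

theorem Inv.get (h : Inv F rem ph rph γ W) {i : ℕ} (hi : i < γ.env.ex.length) :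
    ∃ l b, γ.env.ex[i]? = some l ∧ Bounded F rem γ.env.outq ph rph i l b := by
  obtain ⟨f, h1, -⟩ := h.copies
  exact ⟨_, _, List.getElem?_eq_getElem hi, h1 i _ (List.getElem?_eq_getElem hi)⟩

/-! ### Moves of local executions, and activations -/

theorem Inv.step_loc {i : ℕ} (h : Inv F rem ph rph γ W)
    (hs : F.mech.step F.S γ (.loc i) = some γ') :
    ∃ W' < W, Inv F rem ph rph γ' W' ∧ γ'.mapPrg = γ.mapPrg ∧ γ'.redPrg = γ.redPrg := by
  simp only [Mechanism.step] at hs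
  split at hs
  · cases hs
  · rename_i l hl
    obtain ⟨l', hl', rfl⟩ := Option.map_eq_some_iff.1 hs
    obtain ⟨W', h1, h2⟩ := h.copies.set (x := 1) (l' := l') hl (fun _ _ _ _ h => h) fun b hb => by
      obtain ⟨b', h3, h4⟩ := hb.step hl'
      exact ⟨b', h3, h4⟩
    exact ⟨W', h1, ⟨by simpa [Config.setLocal] using h.tm, h.tr,
      by simpa [Config.setLocal] using h.two_le, by simpa [Config.setLocal] using h.req,
      by simpa [Config.setLocal] using h.rreq, h2, h.map, h.red⟩, rfl, rfl⟩

theorem Inv.idle_of_skip (h : Inv F rem ph rph γ W) (hp : γ.mapPrg = .skip) : ph = .idle := by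
  have hm := h.map
  rw [hp] at hm
  cases hm with
  | idle => rfl
  | dec h => exact absurd rfl h.ne_skip
  | fetched _ _ h => rcases h with h | h <;> simp [tellProg] at h
  | told h => rcases h with h | h <;> simp [supplyProg] at h
  | mapped h => rcases h with h | h <;> simp at h
  | given h => rcases h with h | h <;> simp at h

theorem Inv.red_idle_of_skip (h : Inv F rem ph rph γ W) (hp : γ.redPrg = .skip) : rph = .idle := by
  have hm := h.red
  rw [hp] at hm
  cases hm with
  | idle => rfl
  | ask h => rcases h with h | h <;> simp at h
  | send _ h => rcases h with h | h <;> simp [sendProg] at h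
  | sent h => rcases h with h | h <;> simp [cleanProg] at h
  | cleaned h => rcases h with h | h <;> simp at h

theorem Inv.step_mapActivate {i : ℕ} (h : Inv F rem ph rph γ W)
    (hs : F.mech.step F.S γ (.mapActivate i) = some γ') :
    ∃ W' ph', ph.credit = ph'.credit ∧ W' + γ'.mapPrg.size < W + γ.mapPrg.size ∧
      Inv F rem ph' rph γ' W' ∧ γ'.redPrg = γ.redPrg ∧ γ.mapPrg = .skip := by
  simp only [Mechanism.step] at hs
  split at hs
  · rename_i l hp hl
    obtain ⟨c, hc, rfl⟩ := Option.map_eq_some_iff.1 hs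
    obtain rfl := h.idle_of_skip hp
    obtain ⟨W', h1, h2⟩ := h.copies.set (x := 49) (l' := l.clearSig) hl
      (fun _ _ _ hne h => h.activate_other hne) fun b hb => hb.clearSig_input hc
    have hlt := (List.getElem?_eq_some_iff.1 hl).1
    refine ⟨W', .dec false i c, rfl, ?_, ⟨by simpa [Config.setLocal] using h.tm, h.tr,
      by simpa [Config.setLocal] using h.two_le, fun i' c' hr => ?_,
      by simpa [Config.setLocal] using h.rreq, h2, .dec (decides_mapProg F i c), h.red⟩, rfl, hp⟩
    · have : (F.mech.mapProg i c).size < 49 := size_mapProg F i c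
      simp only
      omega
    · cases hr
      simpa [Config.setLocal] using hlt
  · cases hs

theorem Inv.step_redActivate {i : ℕ} (h : Inv F rem ph rph γ W)
    (hs : F.mech.step F.S γ (.redActivate i) = some γ') :
    ∃ W' rph', W' + γ'.redPrg.size < W + γ.redPrg.size ∧ Inv F rem ph rph' γ' W' ∧
      γ'.mapPrg = γ.mapPrg := by
  simp only [Mechanism.step] at hs
  split at hs
  · rename_i l hp hl
    obtain ⟨c, hc, rfl⟩ := Option.map_eq_some_iff.1 hs
    obtain rfl := h.red_idle_of_skip hp
    obtain ⟨f, hf, -⟩ := h.copies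
    obtain ⟨b₀, w, -, -⟩ := (hf i l hl).clearSig_output hc
    have hlt := (List.getElem?_eq_some_iff.1 hl).1
    -- The phase must be named before the bound of the copy is known, so its value is read off the
    -- local output queue. That queue has exactly one item, so the fallback `.nat 0` never occurs.
    obtain ⟨W', h1, h2⟩ := h.copies.set (x := 49) (l' := l.clearSig)
      (rph' := .start i c ((l.port.outq.head?.map Prod.snd).getD (.nat 0))) hl
      (fun _ _ _ hne h => h.rephase_red_other (by simp [RedPhase.req])
        (by simp [RedPhase.req, hne.symm])) fun b hb => by
        obtain ⟨b', w, h3, h4⟩ := hb.clearSig_output hc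
        have := h4.outq_start
        simp only [LocalConf.clearSig] at this
        exact ⟨b', h3, by simpa [this] using h4⟩
    refine ⟨W', _, ?_, ⟨by simpa [Config.setLocal] using h.tm, h.tr,
      by simpa [Config.setLocal] using h.two_le, by simpa [Config.setLocal] using h.req,
      fun i' hr => ?_, h2, h.map, ?_⟩, rfl⟩
    · have := size_reduceProg F.d i c
      simp only [redProg_eq]
      omega
    · cases hr
      simpa [Config.setLocal] using hlt
    · simp only [redProg_eq]
      exact .init
  · cases hs

/-! ### Moves of REDUCE -/

theorem Env.wake_identical (s : Env Cin Cout) (i : ℕ) :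
    s.wake (identical i) = { s with ex := s.ex.mapIdx fun j l =>
      if j = i then { l with port := l.port.awake } else l } := by
  simp [Env.wake, Env.modify, identical, Port.awake]

/-- Progress and preservation together: REDUCE never gets stuck, because the item it retrieves is
there, and its program shrinks while the weights stay. -/
theorem Inv.step_red (h : Inv F rem ph rph γ W) (hp : γ.redPrg ≠ .skip) :
    ∃ γ' rph', F.mech.step F.S γ .redStep = some γ' ∧ Inv F rem ph rph' γ' W ∧
      γ'.redPrg.size < γ.redPrg.size ∧ γ'.mapPrg = γ.mapPrg := by
  obtain ⟨h1, h2, h3, h4, h5, h6, h7, h8⟩ := h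
  obtain ⟨s, mp, mm, p, m⟩ := γ
  simp only at h1 h2 h3 h4 h5 h6 h7 h8 hp
  have skipSeq : ∀ q, RedRuns F rph q m → ∃ γ' rph', F.mech.step F.S ⟨s, mp, mm, .seq .skip q, m⟩
      .redStep = some γ' ∧ Inv F rem ph rph' γ' W ∧
      γ'.redPrg.size < (Stmt.seq Stmt.skip q : RedProg Cin Cout).size ∧ γ'.mapPrg = mp := by
    intro q hq
    exact ⟨⟨s, mp, mm, q, m⟩, rph, rfl, ⟨h1, h2, h3, h4, h5, h6, h7, hq⟩,
      by simp [Stmt.size], rfl⟩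
  have priv : ∀ (r : Priv) (i : ℕ) (c : Cout),
      hasPriv r i c s.tr m = .bool (decide (F.S.owner c = i)) := by
    intro r i c
    simp [hasPriv, h2, mem_reduceTable]
  cases h8 with
  | idle => exact absurd rfl hp
  | @init i c w =>
    exact ⟨⟨s, mp, mm, _, _⟩, .start i c w, rfl,
      ⟨h1, h2, h3, h4, h5, h6, h7, .ask (.inr rfl)⟩, by simp [Stmt.size, reduceProg], rfl⟩
  | @ask i c w _ p hp' =>
    rcases hp' with rfl | rfl
    · by_cases hc : F.S.owner c = i
      · refine ⟨⟨s, mp, mm, .seq (.act (.retrieve 0 i c)) (sendProg i c), m⟩, .start i c w, ?_,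
          ⟨h1, h2, h3, h4, h5, h6, h7, .retrieve hc⟩, by simp [Stmt.size], rfl⟩
        simp [Mechanism.step, Stmt.step, priv, hc]
      · refine ⟨⟨s, mp, mm, .seq .skip (sendProg i c), m⟩, .start i c w, ?_,
          ⟨h1, h2, h3, h4, h5, h6, h7, .send (fun h => absurd h hc) (.inr rfl)⟩,
          by simp [Stmt.size], rfl⟩
        simp [Mechanism.step, Stmt.step, priv, hc]
    · exact skipSeq _ (.ask (.inl rfl))
  | @retrieve i c w _ hc =>
    obtain ⟨f, hf, hW⟩ := h6
    have hl := List.getElem?_eq_getElem (h5 i rfl)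
    have hq := (hf i _ hl).outq_start
    refine ⟨⟨s, mp, mm, .seq .skip (sendProg i c), m.upd 0 w⟩, .start i c w, ?_,
      ⟨h1, h2, h3, h4, h5, ⟨f, hf, hW⟩, h7, .send (fun _ => by simp [Mem.upd]) (.inr rfl)⟩,
      by simp [Stmt.size], rfl⟩
    simp [Mechanism.step, Stmt.step, RedAct.run, hl, hq, Queue.deq]
  | @send i c w _ p hm hp' =>
    rcases hp' with rfl | rfl
    · by_cases hc : F.S.owner c = i
      · refine ⟨⟨s, mp, mm, .seq (.act (.output (fun _ m => m 0) c)) (cleanProg i c), m⟩,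
          .start i c w, ?_, ⟨h1, h2, h3, h4, h5, h6, h7, .output hc (hm hc)⟩,
          by simp [Stmt.size, sendProg], rfl⟩
        simp [Mechanism.step, Stmt.step, priv, hc, sendProg]
      · refine ⟨⟨s, mp, mm, .seq .skip (cleanProg i c), m⟩, .sent i c w, ?_,
          ⟨h1, h2, h3, h4, h5, h6.imp fun j l b hb => ?_, h7, .sent (.inr rfl)⟩,
          by simp [Stmt.size, sendProg], rfl⟩
        · simp [Mechanism.step, Stmt.step, priv, hc, sendProg]
        · simpa [hc] using hb.send
    · exact skipSeq _ (.send hm (.inl rfl))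
  | @output i c w _ hc hm =>
    refine ⟨⟨{ s with outq := s.outq ++ [(c, w)] }, mp, mm, .seq .skip (cleanProg i c), m⟩,
      .sent i c w, ?_, ⟨h1, h2, h3, h4, h5, h6.imp fun j l b hb => ?_, h7, .sent (.inr rfl)⟩,
      by simp [Stmt.size], rfl⟩
    · simp [Mechanism.step, Stmt.step, RedAct.run, hm]
    · simpa [hc] using hb.send
  | @sent i c w _ p hp' =>
    rcases hp' with rfl | rfl
    · refine ⟨⟨{ s with ex := s.ex.mapIdx fun j l => if j = i then
          { l with port := { l.port with outq := Queue.remove c l.port.outq } } else l },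
          mp, mm, .seq .skip (.act (.wake (identical i))), m⟩, .cleaned i, ?_,
        ⟨by simpa using h1, h2, by simpa using h3, by simpa using h4, by simpa [RedPhase.req] using h5,
          h6.mapIdx _ fun j l b _ hb => ?_, h7, .cleaned (.inr rfl)⟩, by simp [Stmt.size, cleanProg], rfl⟩
      · simp [Mechanism.step, Stmt.step, RedAct.run, cleanProg, Env.modify, identical]
      · split
        · rename_i hj; subst hj; exact hb.clean
        · rename_i hj
          exact hb.rephase_red_other (by simpa [RedPhase.req] using Ne.symm hj)
            (by simpa [RedPhase.req] using Ne.symm hj)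
    · exact skipSeq _ (.sent (.inl rfl))
  | @cleaned i _ p hp' =>
    rcases hp' with rfl | rfl
    · refine ⟨⟨s.wake (identical i), mp, mm, .skip, m⟩, .idle, rfl, ?_, by simp [Stmt.size], rfl⟩
      rw [Env.wake_identical]
      refine ⟨by simpa using h1, h2, by simpa using h3, by simpa using h4,
        fun i hi => (by cases hi), h6.mapIdx _ fun j l b _ hb => ?_, h7, .idle _⟩
      split
      · rename_i hj; subst hj; exact hb.wake_cleaned
      · rename_i hj
        exact hb.rephase_red_other (by simpa [RedPhase.req] using Ne.symm hj) (by simp [RedPhase.req])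
    · exact skipSeq _ (.cleaned (.inl rfl))

/-! ### Moves of MAP -/

theorem Env.clone_zero (s : Env Cin Cout) {l : LocalConf Cin Cout} (hl : s.ex[0]? = some l)
    (privIn : Cin → Finset Priv) :
    s.clone (identical 0) privIn (fun _ => ∅) =
      { s with
        ex := s.ex ++ [{ l with port := { l.port with stt := .S } }]
        tm := fun j => if j = s.ex.length then privIn else s.tm j
        tr := fun j => if j = s.ex.length then fun _ => ∅ else s.tr j } := by
  obtain ⟨tm, tr, ex, inq, outq⟩ := s
  simp only at hl
  rcases ex with _ | ⟨k, ex⟩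
  · simp at hl
  · simp only [List.getElem?_cons_zero, Option.some.injEq] at hl
    subst hl
    have hnil : (ex.zipIdx 1).filter (fun r => identical (Cin := Cin) (Cout := Cout) 0 r.2 (tm r.2) r.1) = [] := by
      refine List.filter_eq_nil_iff.2 fun r hr => ?_
      have := List.mem_zipIdx hr
      simp only [identical, decide_eq_true_eq]
      omega
    have hnew : ∀ j, (decide (((k :: ex).length ≤ j)) && decide (j < (k :: ex).length + 1)) =
        decide (j = (k :: ex).length) := by
      intro j
      rw [← Bool.decide_and, decide_eq_decide]
      omega
    simp only [Env.clone, List.zipIdx_cons, zero_add]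
    rw [List.filter_cons_of_pos (by simp [identical]), hnil]
    simp only [List.map_cons, List.map_nil, List.length_singleton, Bool.decide_and, hnew,
      decide_eq_true_eq]

/-- MAP is about to read an item on `c`. -/
def Config.Wants (γ : Config Cin Cout) (c : Cin) : Prop := ∃ x, γ.mapPrg.next = some (.input x c)

/-- MAP only reads when an item on `c` is outstanding. The value must be the first one on `c` in
`rem`, but the rest `Q` of the actual queue is free. -/
theorem Inv.step_fetch {c : Cin} (h : Inv F rem ph rph γ W) (hw : γ.Wants c) :
    rem.onChannel c ≠ [] ∧ ∀ w rem' Q, Queue.deq c rem = some (w, rem') →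
      γ.env.inq = (c, w) :: Q → ∃ γ' ph', F.mech.step F.S γ .mapStep = some γ' ∧
        Inv F rem' ph' rph γ' W ∧ γ'.env.inq = Q ∧ ¬ ∃ c, γ'.Wants c := by
  obtain ⟨x, hw⟩ := hw
  have key : ∃ b i, ph = .dec b i c ∧ γ.mapPrg = fetchAndMap F.d c ∧ (Tells F.S i c ∨ F.k = .ri) := by
    have hm := h.map
    generalize γ.mapPrg = p at hm hw
    generalize γ.mapMem = m at hm
    cases hm with
    | dec h =>
      cases h with
      | fetch b ht =>
        simp only [fetchAndMap, Stmt.next, Option.some.injEq, MapAct.input.injEq] at hw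
        obtain ⟨-, rfl⟩ := hw
        exact ⟨_, _, rfl, rfl, ht⟩
      | _ => simp [mapDefault, Stmt.next] at hw
    | fetched _ _ h => rcases h with h | h <;> simp [h, tellProg, Stmt.next] at hw
    | told h => rcases h with h | h <;> simp [h, supplyProg, Stmt.next] at hw
    | mapped h => rcases h with h | h <;> simp [h, Stmt.next] at hw
    | given h => rcases h with h | h <;> simp [h, Stmt.next] at hw
    | idle => simp [Stmt.next] at hw
  obtain ⟨b, i, rfl, hp, ht⟩ := key
  have hi := h.req i c rfl
  obtain ⟨l, b', -, hb⟩ := h.get hi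
  refine ⟨hb.rem_ne_nil ht, fun w rem' Q hd hq => ?_⟩
  refine ⟨⟨{ γ.env with inq := Q }, .seq .skip (tellProg F.d c), γ.mapMem.upd 0 w, γ.redPrg,
    γ.redMem⟩, .fetched i c w, ?_, ⟨h.tm, h.tr, h.two_le, h.req, h.rreq,
    h.copies.imp fun j l b hb => hb.fetch hd, .fetched (fun h => ht.resolve_right h)
      (by simp [Mem.upd]) (.inr rfl), h.red⟩, rfl, ?_⟩
  · simp only [Mechanism.step, hp, fetchAndMap, Stmt.step, MapAct.run, hq]
    simp [tellProg, supplyProg]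
  · simp [Config.Wants, Stmt.next]

/-- Cloning is the only step that changes the weights; it spends the credit, which is restored by
the read that follows. -/
theorem Inv.step_map (h : Inv F rem ph rph γ W) (hp : γ.mapPrg ≠ .skip) (hw : ¬ ∃ c, γ.Wants c) :
    ∃ γ' ph' W', F.mech.step F.S γ .mapStep = some γ' ∧ Inv F rem ph' rph γ' W' ∧
      (ph'.credit < ph.credit ∨ ph'.credit = ph.credit ∧ W' = W ∧
        γ'.mapPrg.size < γ.mapPrg.size) ∧ γ'.redPrg = γ.redPrg := by
  obtain ⟨h1, h2, h3, h4, h5, h6, h7, h8⟩ := h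
  obtain ⟨s, p, m, rp, rm⟩ := γ
  simp only at h1 h2 h3 h4 h5 h6 h7 h8 hp
  have skipSeq : ∀ q, MapRuns F ph q m → ∃ γ' ph' W', F.mech.step F.S ⟨s, .seq .skip q, m, rp, rm⟩
      .mapStep = some γ' ∧ Inv F rem ph' rph γ' W' ∧
      (ph'.credit < ph.credit ∨ ph'.credit = ph.credit ∧ W' = W ∧
      γ'.mapPrg.size < (Stmt.seq Stmt.skip q : MapProg Cin Cout).size) ∧ γ'.redPrg = rp := by
    intro q hq
    exact ⟨⟨s, q, m, rp, rm⟩, ph, W, rfl, ⟨h1, h2, h3, h4, h5, h6, hq, h8⟩,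
      .inr ⟨rfl, rfl, by simp [Stmt.size]⟩, rfl⟩
  cases h7 with
  | idle => exact absurd rfl hp
  | @dec b i c p _ hd =>
    have hi := h4 i c rfl
    have hT := h1 i hi
    cases hd with
    | fetch => exact absurd ⟨c, 0, rfl⟩ hw
    | give ht =>
      refine ⟨⟨{ s with ex := s.ex.mapIdx fun j l => if j = i then
          { l with port := l.port.push c (F.d.inp c) } else l }, .seq .skip (.act (.wake (identical i))),
          m, rp, rm⟩, .given i c, W, ?_,
          ⟨by simpa using h1, h2, by simpa using h3, by simpa [MapPhase.req] using h4,
            by simpa using h5, h6.mapIdx _ fun j l b _ hb => ?_, .given (.inr rfl), h8⟩,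
          .inr ⟨rfl, rfl, by simp [Stmt.size, mapDefault]⟩, rfl⟩
      · simp [Mechanism.step, Stmt.step, MapAct.run, mapDefault, Env.modify, identical, Port.push]
      · split
        · rename_i hj; subst hj; exact hb.give ht
        · rename_i hj; exact hb.give_other hj
    | skipSeq hd => exact skipSeq _ (.dec hd)
    | @deny e p q t he hq hc hi1 =>
      refine ⟨⟨s, .skip, m, rp, rm⟩, .idle, W, ?_, ⟨h1, h2, h3, fun _ _ h => (by cases h), h5,
        h6.imp fun j l b hb => hb.deny hc hi1, .idle _, h8⟩,
        .inr ⟨rfl, rfl, by simp [Stmt.size]⟩, rfl⟩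
      cases t <;> simp at hq <;> simp [Mechanism.step, Stmt.step, he _ _ hT, hq]
    | @cond _ e p q t he hd =>
      refine ⟨⟨s, bif t then p else q, m, rp, rm⟩, .dec b i c, W, ?_,
        ⟨h1, h2, h3, h4, h5, h6, .dec hd, h8⟩, .inr ⟨rfl, rfl, ?_⟩, rfl⟩
      · cases t <;> simp [Mechanism.step, Stmt.step, he _ _ hT]
      · cases t <;> simp [Stmt.size]
    | @seqCond _ e p q r t he hd =>
      refine ⟨⟨s, .seq (bif t then p else q) r, m, rp, rm⟩, .dec b i c, W, ?_,
        ⟨h1, h2, h3, h4, h5, h6, .dec hd, h8⟩, .inr ⟨rfl, rfl, ?_⟩, rfl⟩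
      · cases t <;> simp [Mechanism.step, Stmt.step, he _ _ hT]
      · cases t <;> simp [Stmt.size]
    | @clone p hk hc hi0 hd =>
      subst hi0
      obtain ⟨f, hf, hW⟩ := h6
      have hl := List.getElem?_eq_getElem hi
      -- The clone has index at least 2, while outputs are owned by 0 and 1.
      have how : ∀ c, F.S.owner c ≠ s.ex.length := by
        intro c
        cases hc : F.S.lvlOut c <;> simp [Setting.owner, hc] <;> omega
      obtain ⟨b', hb'⟩ := (hf 0 _ hl).clone (i := s.ex.length) hk hc h3
        (fun hr => absurd (h5 _ hr) (lt_irrefl _)) how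
      have hC := Copies.concat (Copies.imp ⟨f, hf, hW⟩ fun j l b hb => hb.cloned) hb'
      refine ⟨⟨s.clone (identical 0) (clonePrivIn F.S) (fun _ => ∅), .seq .skip p, m, rp, rm⟩,
        .dec true 0 c, W + b', rfl, ?_, .inl (by simp [MapPhase.credit]), rfl⟩
      rw [Env.clone_zero s hl]
      refine ⟨fun j hj => ?_, ?_, ?_, ?_, ?_, hC, .dec (.skipSeq hd), h8⟩
      · simp only [List.length_append, List.length_singleton] at hj
        by_cases hjs : j = s.ex.length
        · have h0 : j ≠ 0 := by omega
          have h1 : j ≠ 1 := by omega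
          funext c'
          simp only [hjs, if_true]
          rw [← hjs]
          cases hc' : F.S.lvlIn c' <;> simp [clonePrivIn, Kind.column, hc', h0, h1, hk]
        · simp only [hjs, if_false]
          exact h1 j (by omega)
      · funext j
        simp only
        split
        · rename_i hj
          funext c'
          have := how c'
          refine (Finset.eq_empty_of_forall_notMem fun r hr => ?_).symm
          rw [mem_reduceTable, hj] at hr
          exact this hr
        · exact congrFun h2 j
      · simp only [List.length_append, List.length_singleton]; omega
      · intro i' c' hr
        have := h4 i' c' hr
        simp only [List.length_append, List.length_singleton]; omega
      · intro i' hr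
        have := h5 i' hr
        simp only [List.length_append, List.length_singleton]; omega
  | @fetched i c w p _ ht hm hp' =>
    rcases hp' with rfl | rfl
    · refine ⟨⟨{ s with ex := s.ex.mapIdx fun j l =>
          if Priv.tell ∈ s.tm j c then { l with port := l.port.push c w } else l },
          .seq .skip (supplyProg F.d c), m, rp, rm⟩, .told i c, W, ?_,
          ⟨by simpa using h1, h2, by simpa using h3, by simpa [MapPhase.req] using h4,
            by simpa using h5, h6.mapIdx _ fun j l b hj hb => ?_, .told (.inr rfl), h8⟩,
          .inr ⟨rfl, rfl, by simp [Stmt.size, tellProg]⟩, rfl⟩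
      · simp [Mechanism.step, Stmt.step, MapAct.run, tellProg, Env.modify, canTell, Port.push, hm]
      · have hT : Priv.tell ∈ s.tm j c ↔ Tells F.S j c := by rw [h1 j hj, F.k.tell_mem_column]
        split
        · rename_i hj; exact hb.tell ht (hT.1 hj)
        · rename_i hj; exact hb.tell_other (mt hT.2 hj)
    · exact skipSeq _ (.fetched ht hm (.inl rfl))
  | @told i c p _ hp' =>
    rcases hp' with rfl | rfl
    · refine ⟨⟨{ s with ex := s.ex.mapIdx fun j l =>
          if Priv.tell ∉ s.tm j c then
            { l with port := l.port.push c (F.d.inp c) } else l },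
          .seq .skip (.act (.wake (isReady c))), m, rp, rm⟩, .mapped i c, W, ?_,
          ⟨by simpa using h1, h2, by simpa using h3, by simpa [MapPhase.req] using h4,
            by simpa using h5, h6.mapIdx _ fun j l b hj hb => ?_, .mapped (.inr rfl), h8⟩,
          .inr ⟨rfl, rfl, by simp [Stmt.size, supplyProg]⟩, rfl⟩
      · simp [Mechanism.step, Stmt.step, MapAct.run, supplyProg, Env.modify, cannotTell, Port.push]
      · have hT : Priv.tell ∈ s.tm j c ↔ Tells F.S j c := by rw [h1 j hj, F.k.tell_mem_column]
        split
        · rename_i hj; exact hb.supply (mt hT.2 hj)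
        · rename_i hj; exact hb.supply_other (hT.1 (not_not.1 hj))
    · exact skipSeq _ (.told (.inl rfl))
  | @mapped i c p _ hp' =>
    rcases hp' with rfl | rfl
    · refine ⟨⟨{ s with ex := s.ex.mapIdx fun j l =>
          if (isReady c j (s.tm j) l) = true then { l with port := l.port.awake } else l },
          .skip, m, rp, rm⟩, .idle, W, rfl,
          ⟨by simpa using h1, h2, by simpa using h3, fun _ _ h => (by cases h),
            by simpa using h5, h6.mapIdx _ fun j l b hj hb => ?_, .idle _, h8⟩,
          .inr ⟨rfl, rfl, by simp [Stmt.size]⟩, rfl⟩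
      split
      · rename_i hj; exact hb.wake_ready hj
      · rename_i hj; exact hb.wake_unready hj
    · exact skipSeq _ (.mapped (.inl rfl))
  | @given i c p _ hp' =>
    rcases hp' with rfl | rfl
    · refine ⟨⟨s.wake (identical i), .skip, m, rp, rm⟩, .idle, W, rfl, ?_,
        .inr ⟨rfl, rfl, by simp [Stmt.size]⟩, rfl⟩
      rw [Env.wake_identical]
      refine ⟨by simpa using h1, h2, by simpa using h3, fun _ _ h => (by cases h),
        by simpa using h5, h6.mapIdx _ fun j l b _ hb => ?_, .idle _, h8⟩
      split
      · rename_i hj; subst hj; exact hb.wake_given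
      · rename_i hj; exact hb.wake_given_other hj
    · exact skipSeq _ (.given (.inl rfl))

end

section
variable {Cin : Type u} {Cout : Type v} [DecidableEq Cin] [DecidableEq Cout]

/-! ### The global input queue -/

/-- Replace the global input queue. -/
def Config.withInq (γ : Config Cin Cout) (Q : Queue Cin) : Config Cin Cout :=
  { γ with env := { γ.env with inq := Q } }

/-- Nothing but an input instruction of MAP looks at the global queue, so which other moves are
possible, and their effect, can be found before the queue is chosen. -/
theorem Mechanism.step_withInq (S : Setting Cin Cout) (M : Mechanism Cin Cout)
    (γ : Config Cin Cout) (Q : Queue Cin) {μ : Move} (h : μ = .mapStep → ¬ ∃ c, γ.Wants c) :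
    M.step S (γ.withInq Q) μ = (M.step S γ μ).map fun γ' => γ'.withInq Q := by
  cases μ with
  | loc i =>
    simp only [Mechanism.step, Config.withInq]
    cases γ.env.ex[i]? with
    | none => rfl
    | some l => simp only [Option.map_map]; rfl
  | mapStep =>
    simp only [Mechanism.step, Config.withInq]
    cases hn : γ.mapPrg.next with
    | none =>
      rw [Stmt.step_of_next_none _ _ hn, Stmt.step_of_next_none _ _ hn]
      simp only [Option.map_map]
      rfl
    | some a =>
      rw [Stmt.step_of_next _ _ hn, Stmt.step_of_next _ _ hn]
      cases a with
      | input x c => exact absurd ⟨c, x, hn⟩ (h rfl)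
      | map e c P => rfl
      | wake P => rfl
      | clone P a b => rfl
  | mapActivate i =>
    simp only [Mechanism.step, Config.withInq]
    cases γ.mapPrg with
    | skip =>
      cases γ.env.ex[i]? with
      | none => rfl
      | some l => simp only [Option.map_map]; rfl
    | _ => rfl
  | redStep =>
    simp only [Mechanism.step, Config.withInq]
    cases hn : γ.redPrg.next with
    | none =>
      rw [Stmt.step_of_next_none _ _ hn, Stmt.step_of_next_none _ _ hn]
      simp only [Option.map_map]
      rfl
    | some a =>
      rw [Stmt.step_of_next _ _ hn, Stmt.step_of_next _ _ hn]
      cases a with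
      | retrieve x i c =>
        simp only [RedAct.run]
        cases γ.env.ex[i]? with
        | none => rfl
        | some l =>
          simp only
          cases Queue.deq c l.port.outq <;> rfl
      | _ => rfl
  | redActivate i =>
    simp only [Mechanism.step, Config.withInq]
    cases γ.redPrg with
    | skip =>
      cases γ.env.ex[i]? with
      | none => rfl
      | some l => simp only [Option.map_map]; rfl
    | _ => rfl

theorem Mechanism.mapStep_withInq (S : Setting Cin Cout) (M : Mechanism Cin Cout)
    (γ : Config Cin Cout) {c : Cin} (h : γ.Wants c) (w : Val) (Q R : Queue Cin) :
    M.step S (γ.withInq ((c, w) :: Q)) .mapStep =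
      (M.step S (γ.withInq ((c, w) :: R)) .mapStep).map fun γ' => γ'.withInq Q := by
  obtain ⟨x, hn⟩ := h
  simp only [Mechanism.step, Config.withInq]
  rw [Stmt.step_of_next _ _ hn, Stmt.step_of_next _ _ hn]
  simp [MapAct.run]

variable {F : Frame Cin Cout} {rem rem' : Queue Cin} {ph ph' : MapPhase Cin}
  {rph rph' : RedPhase Cout} {γ γ' : Config Cin Cout} {W : ℕ}

theorem Inv.withInq (h : Inv F rem ph rph γ W) (Q : Queue Cin) :
    Inv F rem ph rph (γ.withInq Q) W :=
  ⟨h.tm, h.tr, h.two_le, h.req, h.rreq, h.copies, h.map, h.red⟩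

/-- Every move that does not read from the global input keeps the invariant and decreases the
measure. -/
theorem Inv.step (h : Inv F rem ph rph γ W) {μ : Move} (hμ : μ = .mapStep → ¬ ∃ c, γ.Wants c)
    (hs : F.mech.step F.S γ μ = some γ') :
    ∃ ph' rph' W', Inv F rem ph' rph' γ' W' ∧ (ph'.credit < ph.credit ∨ ph'.credit = ph.credit ∧
      W' + γ'.mapPrg.size + γ'.redPrg.size < W + γ.mapPrg.size + γ.redPrg.size) ∧
      (γ'.mapPrg = γ.mapPrg ∨ γ.mapPrg = .skip ∨ μ = .mapStep) := by
  cases μ with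
  | loc i =>
    obtain ⟨W', h1, h2, h3, h4⟩ := h.step_loc hs
    exact ⟨ph, rph, W', h2, .inr ⟨rfl, by rw [h3, h4]; omega⟩, .inl h3⟩
  | mapStep =>
    have hp : γ.mapPrg ≠ .skip := by
      intro hp
      simp [Mechanism.step, hp, Stmt.step] at hs
    obtain ⟨γ₁, ph', W', h1, h2, h3, h4⟩ := h.step_map hp (hμ rfl)
    rw [hs] at h1; cases h1
    refine ⟨ph', rph, W', h2, h3.imp id fun h => ⟨h.1, ?_⟩, .inr (.inr rfl)⟩
    rw [h4, h.2.1]; omega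
  | mapActivate i =>
    obtain ⟨W', ph', h1, h2, h3, h4, h5⟩ := h.step_mapActivate hs
    exact ⟨ph', rph, W', h3, .inr ⟨h1.symm, by rw [h4]; omega⟩, .inr (.inl h5)⟩
  | redStep =>
    have hp : γ.redPrg ≠ .skip := by
      intro hp
      simp [Mechanism.step, hp, Stmt.step] at hs
    obtain ⟨γ₁, rph', h1, h2, h3, h4⟩ := h.step_red hp
    rw [hs] at h1; cases h1
    exact ⟨ph, rph', W, h2, .inr ⟨rfl, by rw [h4]; omega⟩, .inl h4⟩
  | redActivate i =>
    obtain ⟨W', rph', h1, h2, h3⟩ := h.step_redActivate hs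
    exact ⟨ph, rph', W', h2, .inr ⟨rfl, by rw [h3]; omega⟩, .inl h3⟩

/-- When no move is possible, the mechanism has terminated properly. -/
theorem Inv.terminated (h : Inv F rem ph rph γ W) (hw : ¬ ∃ c, γ.Wants c)
    (hs : ∀ μ, F.mech.step F.S γ μ = none) :
    rem = [] ∧ (γ.withInq []).Terminated ∧
      ∀ c, γ.env.outq.onChannel c = F.target.onChannel c := by
  have hm : γ.mapPrg = .skip := by
    by_contra hp
    obtain ⟨γ₁, _, _, h1, -⟩ := h.step_map hp hw
    simp [hs] at h1
  have hr : γ.redPrg = .skip := by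
    by_contra hp
    obtain ⟨γ₁, _, h1, -⟩ := h.step_red hp
    simp [hs] at h1
  obtain rfl := h.idle_of_skip hm
  obtain rfl := h.red_idle_of_skip hr
  obtain ⟨f, hf, -⟩ := h.copies
  have hloc : ∀ (j : ℕ) (l : LocalConf Cin Cout), γ.env.ex[j]? = some l → l.step = none := by
    intro j l hl
    simpa [Mechanism.step, hl] using hs (.loc j)
  have hask : ∀ (j : ℕ) (l : LocalConf Cin Cout), γ.env.ex[j]? = some l → l.asksInput = none := by
    intro j l hl
    simpa [Mechanism.step, hl, hm] using hs (.mapActivate j)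
  have hout : ∀ (j : ℕ) (l : LocalConf Cin Cout), γ.env.ex[j]? = some l → l.asksOutput = none := by
    intro j l hl
    simpa [Mechanism.step, hl, hr] using hs (.redActivate j)
  -- With MAP and REDUCE idle and no signal left to take up, the only sleepers are copies refused a
  -- low item, and that item is still in `rem`.
  have hsleep : ∀ (j : ℕ) (l : LocalConf Cin Cout), γ.env.ex[j]? = some l → l.port.stt = .S →
      ∃ c, F.S.lvlIn c = .low ∧ j ≠ 1 ∧ rem.onChannel c ≠ [] := by
    intro j l hl hS
    obtain ⟨J, n, O, hc, -⟩ := hf j l hl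
    cases hc.state with
    | run h1 => simp [hS] at h1
    | inSignal x c _ h2 _ _ _ h6 =>
      have := hask j l hl
      simp [LocalConf.asksInput, hS, h2, h6] at this
    | inServed _ _ _ _ _ _ _ _ h7 => simp [MapPhase.req] at h7
    | inDenied x c _ h2 _ _ h5 h6 h7 h8 =>
      have hlow : F.S.lvlIn c = .low := h7.resolve_right fun h => h.1.elim
      have hq : l.port.inq.onChannel c = [] := h5.resolve_left fun h => h.elim
      refine ⟨c, hlow, h8, ?_⟩
      have h9 := hc.tell c (.inl hlow)
      rw [hq] at h9
      simp only [MapPhase.flight, List.nil_append] at h9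
      rw [← h9]
      exact (hc.fin.cons_of_next h2).1
    | outSignal c w _ _ _ h4 =>
      have := hout j l hl
      simp [LocalConf.asksOutput, hS, h4] at this
    | outServed _ _ _ _ _ h6 => simp [RedPhase.req] at h6
  have hskip : ∀ (j : ℕ) (l : LocalConf Cin Cout), γ.env.ex[j]? = some l → l.port.stt = .E →
      (∀ c, Tells F.S j c → rem.onChannel c = []) ∧
      ∀ c, F.S.owner c = j → γ.env.outq.onChannel c = F.target.onChannel c := by
    intro j l hl hE
    have hp := (hf j l hl).eq_skip hE (hloc j l hl)
    obtain ⟨J, n, O, hc, -⟩ := hf j l hl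
    have hfin := hc.fin
    rw [hp] at hfin
    have hJO : J = [] ∧ O = [] := by
      cases hfin with
      | skip => exact ⟨rfl, rfl⟩
      | tau _ h => simp [Stmt.tau, Stmt.step] at h
      | inp h => simp [Stmt.next] at h
      | out h => simp [Stmt.next] at h
    obtain ⟨rfl, rfl⟩ := hJO
    have hq : l.port.outq = [] := by
      cases hc.state <;> simp_all
    refine ⟨fun c hc' => ?_, fun c ho => ?_⟩
    · have := hc.tell c hc'
      exact (List.append_eq_nil_iff.1 this.symm).2
    · simpa using hc.out c ho [] (fun h => h.elim) fun _ => hq.symm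
  -- Copy 1 is never refused, so it has finished and nothing low is left in `rem`; this excludes the
  -- other sleepers.
  have hawake : ∀ (j : ℕ) (l : LocalConf Cin Cout), γ.env.ex[j]? = some l → l.port.stt = .E := by
    obtain ⟨l₁, _, hl₁, -⟩ := h.get (i := 1) h.two_le
    have h₁ : l₁.port.stt = .E := by
      cases hS : l₁.port.stt with
      | E => rfl
      | S =>
        obtain ⟨c, -, h2, -⟩ := hsleep 1 l₁ hl₁ hS
        exact absurd rfl h2
    intro j l hl
    cases hS : l.port.stt with
    | E => rfl
    | S =>
      obtain ⟨c, h1, -, h2⟩ := hsleep j l hl hS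
      exact absurd ((hskip 1 l₁ hl₁ h₁).1 c (.inl h1)) h2
  obtain ⟨l₀, _, hl₀, -⟩ := h.get (i := 0) (by have := h.two_le; omega)
  obtain ⟨l₁, _, hl₁, -⟩ := h.get (i := 1) h.two_le
  refine ⟨Queue.eq_nil_of_onChannel fun c => (hskip 0 l₀ hl₀ (hawake 0 l₀ hl₀)).1 c (.inr rfl),
    ⟨hm, hr, rfl, fun l hl => ?_⟩, fun c => ?_⟩
  · obtain ⟨j, hj⟩ := List.mem_iff_getElem?.1 hl
    exact ⟨(hf j l hj).eq_skip (hawake j l hj) (hloc j l hj), hawake j l hj⟩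
  · cases hc : F.S.lvlOut c with
    | high => exact (hskip 0 l₀ hl₀ (hawake 0 l₀ hl₀)).2 c (by simp [Setting.owner, hc])
    | low => exact (hskip 1 l₁ hl₁ (hawake 1 l₁ hl₁)).2 c (by simp [Setting.owner, hc])

/-! ### Executions in a given order -/

/-- The configuration after the move at time `t`. -/
def Mechanism.after (S : Setting Cin Cout) (M : Mechanism Cin Cout) (ord : Order) (t : ℕ)
    (γ : Config Cin Cout) : Config Cin Cout :=
  (M.step S γ (ord.pick t {μ | (M.step S γ μ).isSome})).getD γ

/-- The execution that is at `γ` at time `t` leads to `γ'`. -/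
inductive Mechanism.Leads (S : Setting Cin Cout) (M : Mechanism Cin Cout) (ord : Order) :
    ℕ → Config Cin Cout → Config Cin Cout → Prop
  | refl (t γ) : Mechanism.Leads S M ord t γ γ
  | head {t γ γ'} : Mechanism.Leads S M ord (t + 1) (M.after S ord t γ) γ' →
      Mechanism.Leads S M ord t γ γ'

theorem Mechanism.Leads.exists_run {S : Setting Cin Cout} {M : Mechanism Cin Cout} {ord : Order}
    {t : ℕ} (h : Mechanism.Leads S M ord t γ γ') {π : Prog Cin Cout} {I : Queue Cin}
    (hγ : M.run S π I ord t = γ) : ∃ n, M.run S π I ord n = γ' := by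
  induction h with
  | refl t γ => exact ⟨t, hγ⟩
  | @head t γ γ' _ ih => exact ih (by rw [← hγ]; rfl)

theorem Mechanism.after_eq {S : Setting Cin Cout} {M : Mechanism Cin Cout} {ord : Order} {t : ℕ}
    {X : Set Move} {γ₁ : Config Cin Cout} (hX : ∀ μ, (M.step S γ μ).isSome ↔ μ ∈ X)
    (h : M.step S γ (ord.pick t X) = some γ₁) : M.after S ord t γ = γ₁ := by
  have : {μ | (M.step S γ μ).isSome} = X := by
    ext μ; exact hX μ
  rw [Mechanism.after, this, h]
  rfl

/-- The queue is built backwards along the execution, by induction on the lexicographic measure. The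
difficulty is that the order of execution sees the set of possible moves, which depends on whether
the head of the queue suits MAP. So the conclusion also promises that, while MAP is about to read on
`c`, the queue begins with an item on `c`; the set of possible moves is then known without the
queue. -/
theorem Inv.exists_queue (ord : Order) (A : ℕ) : ∀ (B t : ℕ) (γ : Config Cin Cout)
    (rem : Queue Cin) (ph : MapPhase Cin) (rph : RedPhase Cout) (W : ℕ), Inv F rem ph rph γ W →
    2 * rem.length + ph.credit = A → W + γ.mapPrg.size + γ.redPrg.size = B →
    ∃ (Q : Queue Cin) (γ' : Config Cin Cout), (∀ c, Q.onChannel c = rem.onChannel c) ∧ (∀ c, γ.Wants c → ∃ w R, Q = (c, w) :: R) ∧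
      F.mech.Leads F.S ord t (γ.withInq Q) γ' ∧ γ'.Terminated ∧
      ∀ c, γ'.env.outq.onChannel c = F.target.onChannel c := by
  induction A using Nat.strong_induction_on with
  | _ A ihA =>
  intro B
  induction B using Nat.strong_induction_on with
  | _ B ihB =>
  intro t γ rem ph rph W h hA hB
  have IH : ∀ γ₁ ph₁ rph₁ W₁, Inv F rem ph₁ rph₁ γ₁ W₁ → (ph₁.credit < ph.credit ∨
      ph₁.credit = ph.credit ∧ W₁ + γ₁.mapPrg.size + γ₁.redPrg.size <
        W + γ.mapPrg.size + γ.redPrg.size) →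
      ∃ (Q : Queue Cin) (γ' : Config Cin Cout), (∀ c, Q.onChannel c = rem.onChannel c) ∧
        (∀ c, γ₁.Wants c → ∃ w R, Q = (c, w) :: R) ∧
        F.mech.Leads F.S ord (t + 1) (γ₁.withInq Q) γ' ∧ γ'.Terminated ∧
        ∀ c, γ'.env.outq.onChannel c = F.target.onChannel c := by
    intro γ₁ ph₁ rph₁ W₁ h₁ hlt
    rcases hlt with hlt | ⟨he, hlt⟩
    · exact ihA _ (by omega) _ _ _ _ _ _ _ h₁ rfl rfl
    · exact ihB _ (by omega) _ _ _ _ _ _ h₁ (by omega) rfl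
  by_cases hw : ∃ c, γ.Wants c
  · obtain ⟨c, hw⟩ := hw
    have hne := (h.step_fetch hw).1
    obtain ⟨w, rem', hd⟩ := Queue.exists_deq hne
    obtain ⟨d1, d2, d3, -⟩ := Queue.deq_spec hd
    have hsome : ∀ w R, (F.mech.step F.S (γ.withInq ((c, w) :: R)) .mapStep).isSome := by
      intro w' R
      rw [F.mech.mapStep_withInq F.S γ hw w' R []]
      obtain ⟨x, hn⟩ := hw
      simp only [Mechanism.step, Config.withInq]
      rw [Stmt.step_of_next _ _ hn]
      simp [MapAct.run]
    -- The possible moves for every queue that begins with an item on `c`.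
    let X : Set Move := {μ | μ = .mapStep ∨ (F.mech.step F.S γ μ).isSome}
    have hX : ∀ w R μ, (F.mech.step F.S (γ.withInq ((c, w) :: R)) μ).isSome ↔ μ ∈ X := by
      intro w R μ
      by_cases hμ : μ = .mapStep
      · subst hμ; simp [hsome, X]
      · rw [F.mech.step_withInq F.S γ _ fun h => absurd h hμ]
        simp [X, hμ]
    have hpick := ord.pick_mem t X ⟨.mapStep, .inl rfl⟩
    by_cases hμ : ord.pick t X = .mapStep
    · obtain ⟨γ₁, ph₁, h1, h2, h3, h4⟩ := (h.withInq ((c, w) :: rem')).step_fetch hw |>.2 w rem'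
        rem' hd rfl
      have hcr : ph₁.credit ≤ 1 := by
        unfold MapPhase.credit; split <;> omega
      obtain ⟨Q, γ', k1, -, k3, k4⟩ := ihA (2 * rem'.length + ph₁.credit) (by omega) _ (t + 1) γ₁
        rem' ph₁ rph W h2 rfl rfl
      refine ⟨(c, w) :: Q, γ', fun c' => ?_, fun c' hc' => ?_, .head ?_, k4⟩
      · by_cases hc : c = c'
        · subst hc; rw [Queue.onChannel_cons_self, d1, k1]
        · rw [Queue.onChannel_cons_ne _ hc, k1, d2 _ (Ne.symm hc)]
      · obtain ⟨x, hx⟩ := hw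
        obtain ⟨x', hx'⟩ := hc'
        rw [hx] at hx'; cases hx'
        exact ⟨w, Q, rfl⟩
      · rw [Mechanism.after_eq (γ₁ := γ₁.withInq Q) (hX w Q) ?_]
        · exact k3
        · rw [hμ, F.mech.mapStep_withInq F.S γ hw w Q rem', h1]
          rfl
    · have hs := hpick.resolve_left hμ
      obtain ⟨γ₁, hs⟩ := Option.isSome_iff_exists.1 hs
      obtain ⟨ph₁, rph₁, W₁, h1, h2, h3⟩ := h.step (fun h => absurd h hμ) hs
      -- Another component moved, so MAP still waits to read on `c`, and the queue obtained for the
      -- next configuration begins on `c`.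
      have hp : γ₁.mapPrg = γ.mapPrg := by
        rcases h3 with h3 | h3 | h3
        · exact h3
        · obtain ⟨x, hx⟩ := hw
          simp [h3, Stmt.next] at hx
        · exact absurd h3 hμ
      have hwants : ∀ c, γ₁.Wants c ↔ γ.Wants c := fun c => by simp [Config.Wants, hp]
      obtain ⟨Q, γ', k1, k2, k3, k4⟩ := IH γ₁ ph₁ rph₁ W₁ h1 h2
      refine ⟨Q, γ', k1, fun c' hc' => k2 c' ((hwants c').2 hc'), .head ?_, k4⟩
      obtain ⟨w', R, rfl⟩ := k2 c ((hwants c).2 hw)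
      rw [Mechanism.after_eq (γ₁ := γ₁.withInq ((c, w') :: R)) (hX w' R) ?_]
      · exact k3
      · rw [F.mech.step_withInq F.S γ _ fun h => absurd h hμ, hs]
        rfl
  · let X : Set Move := {μ | (F.mech.step F.S γ μ).isSome}
    have hX : ∀ Q μ, (F.mech.step F.S (γ.withInq Q) μ).isSome ↔ μ ∈ X := by
      intro Q μ
      rw [F.mech.step_withInq F.S γ _ fun _ => hw]
      simp [X]
    by_cases hne : X.Nonempty
    · obtain ⟨γ₁, hs⟩ := Option.isSome_iff_exists.1 (ord.pick_mem t X hne)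
      obtain ⟨ph₁, rph₁, W₁, h1, h2, -⟩ := h.step (fun _ => hw) hs
      obtain ⟨Q, γ', k1, -, k3, k4⟩ := IH γ₁ ph₁ rph₁ W₁ h1 h2
      refine ⟨Q, γ', k1, fun c' hc' => absurd ⟨c', hc'⟩ hw, .head ?_, k4⟩
      rw [Mechanism.after_eq (γ₁ := γ₁.withInq Q) (hX Q) ?_]
      · exact k3
      · rw [F.mech.step_withInq F.S γ _ fun _ => hw, hs]
        rfl
    · have hnone : ∀ μ, F.mech.step F.S γ μ = none := by
        intro μ
        by_contra hμ
        exact hne ⟨μ, Option.isSome_iff_ne_none.2 hμ⟩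
      obtain ⟨rfl, h1, h2⟩ := h.terminated hw hnone
      exact ⟨[], _, fun _ => rfl, fun c' hc' => absurd ⟨c', hc'⟩ hw, .refl _ _, h1, h2⟩

/-! ### Precision -/

/-- The common core of the three positive claims: a run for copy 0 and a default run for copy 1 with
the same low input and output suffice, given the count for RI and the clonable run for DI. -/
theorem Kind.terminatesIn (k : Kind) (S : Setting Cin Cout) (d : Defaults Cin Cout)
    {π : Prog Cin Cout} {I I₁ : Queue Cin} {O O₁ : Queue Cout} {n n₁ : ℕ}
    (h : Completes₀ π S.m0 I n O)
    (hdi : k = .di → Completes (Clonable S d) π S.m0 I n O)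
    (h₁ : Completes₀ π S.m0 I₁ n₁ O₁)
    (hlow : I₁.onLevel S.lvlIn .low = I.onLevel S.lvlIn .low)
    (hdef : I₁.HighDefault S.lvlIn d.inp)
    (hri : k = .ri → ∀ c, (I₁.onChannel c).length ≤ (I.onChannel c).length)
    (hout : O₁.onLevel S.lvlOut .low = O.onLevel S.lvlOut .low) (ord : Order) :
    ∃ I' O', (∀ c, Queue.onChannel I' c = I.onChannel c) ∧
      (∀ c, Queue.onChannel O' c = O.onChannel c) ∧ (k.mech S d).TerminatesIn S π I' ord O' := by
  let F : Frame Cin Cout := ⟨k, S, d, O⟩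
  have h0 : Bounded F I [] .idle .idle 0 (LocalConf.initial S π) (100 * n + 60) := by
    refine ⟨I, n, O, ⟨?_, fun c _ => rfl, fun h => absurd rfl h, fun _ h => absurd rfl h,
      fun _ _ c _ h => absurd rfl h,
      .run rfl rfl rfl (by simp [MapPhase.req]) (by simp [RedPhase.req]), fun c _ P _ hP => ?_⟩,
      LocalConf.weight_le _ _⟩
    · by_cases hk : k = .di
      · exact (hdi hk).mono fun _ _ _ h _ _ => h
      · exact h.mono fun _ _ _ _ hk' => absurd hk' hk
    · rw [hP fun h => h.elim]
      simp [LocalConf.initial, F]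
  have h1 : Bounded F I [] .idle .idle 1 (LocalConf.initial S π) (100 * n₁ + 60) := by
    refine ⟨I₁, n₁, O₁, ⟨h₁.mono fun _ _ _ _ _ h => by simp at h, fun c hc => ?_,
      fun _ => ⟨hdef, fun q hq => by simp [LocalConf.initial] at hq⟩,
      fun hk _ c _ => by simpa [LocalConf.initial, MapPhase.dflight] using hri hk c,
      fun _ h => by simp at h,
      .run rfl rfl rfl (by simp [MapPhase.req]) (by simp [RedPhase.req]), fun c hc P _ hP => ?_⟩,
      LocalConf.weight_le _ _⟩
    · have hc' : S.lvlIn c = .low := hc.resolve_right (by omega)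
      exact Queue.onChannel_eq_of_onLevel hlow hc'
    · rw [hP fun h => h.elim]
      have hc' : S.lvlOut c = .low := by
        cases hl : S.lvlOut c with
        | low => rfl
        | high => simp [Setting.owner, F, hl] at hc
      simpa [LocalConf.initial] using Queue.onChannel_eq_of_onLevel hout hc'
  have hinv : Inv F I .idle .idle ((k.mech S d).initial S π [])
      (∑ j ∈ Finset.range 2, if j = 0 then 100 * n + 60 else 100 * n₁ + 60) := by
    refine ⟨fun j hj => ?_, ?_, le_rfl, fun _ _ h => (by cases h), fun _ h => (by cases h),
      ⟨_, fun j l hl => ?_, rfl⟩, .idle _, .idle _⟩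
    · simp only [Mechanism.initial, List.length_cons, List.length_nil] at hj
      funext c
      have : j = 0 ∨ j = 1 := by omega
      rcases this with rfl | rfl <;> cases hc : S.lvlIn c <;> cases k <;>
        simp [Mechanism.initial, Kind.mech, mechRI, mechDI, mechNI, Kind.column, F, hc]
    · cases k <;> rfl
    · rcases j with _ | _ | j
      · cases hl; exact h0
      · cases hl; exact h1
      · simp [Mechanism.initial] at hl
  obtain ⟨Q, γ', k1, -, k3, k4, k5⟩ := hinv.exists_queue ord _ _ 0 _ _ _ _ _ rfl rfl
  obtain ⟨N, hN⟩ := k3.exists_run (π := π) (I := Q) rfl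
  exact ⟨Q, γ'.env.outq, k1, k5, N, by rw [show (k.mech S d) = F.mech from rfl]; rw [hN]; exact k4,
    by rw [show (k.mech S d) = F.mech from rfl]; rw [hN]⟩

theorem mechRI_precise (S : Setting Cin Cout) (d : Defaults Cin Cout) :
    (mechRI S d).Precise S (RI S d) := by
  intro π hπ I O hI ord
  obtain ⟨I', O', h1, h2, h3, h4, h5⟩ := hπ I O hI
  obtain ⟨n, hn⟩ := terminates_iff.1 hI
  obtain ⟨n', hn'⟩ := terminates_iff.1 h4
  exact Kind.terminatesIn .ri S d hn (by simp) hn' h1 h2 (fun _ => h3) h5 ord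

theorem mechNI_precise (S : Setting Cin Cout) (d : Defaults Cin Cout) :
    (mechNI S d).Precise S (TSNI S) := by
  intro π hπ I O hI ord
  -- On constant default streams, TSNI yields a run whose high inputs are default ones.
  obtain ⟨I', O', h1, h2, h3, h4⟩ := hπ I O hI fun c _ => d.inp c
  obtain ⟨n, hn⟩ := terminates_iff.1 hI
  obtain ⟨n', hn'⟩ := terminates_iff.1 h3
  refine Kind.terminatesIn .ni S d hn (by simp) hn' h1 (fun q hq hc => ?_) (by simp) h4 ord
  obtain ⟨m, hm⟩ := h2 q.1 hc
  have : q.2 ∈ (I'.onChannel q.1).map Prod.snd :=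
    List.mem_map.2 ⟨q, Queue.mem_onChannel.2 ⟨hq, rfl⟩, rfl⟩
  rw [hm] at this
  simp only [List.mem_map, List.mem_range] at this
  obtain ⟨_, -, h⟩ := this
  exact h.symm

theorem mechDI_precise (S : Setting Cin Cout) (d : Defaults Cin Cout) :
    (mechDI S d).Precise S (DI S d) := by
  intro π hπ I O hI ord
  obtain ⟨n, hn⟩ := terminates_iff.1 hI
  have key : ∀ X c w Z, I.onLevel S.lvlIn .high = X ++ (c, w) :: Z → ∃ J' n' O' Y,
      Completes₀ π S.m0 J' n' O' ∧ J'.onLevel S.lvlIn .low = I.onLevel S.lvlIn .low ∧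
        J'.onLevel S.lvlIn .high = X ++ (c, d.inp c) :: Y ∧ (∀ q ∈ Y, q.2 = d.inp q.1) ∧
        O'.onLevel S.lvlOut .low = O.onLevel S.lvlOut .low := by
    intro X c w Z hX
    obtain ⟨Y, hY, J', O', h1, h2, h3, h4⟩ := hπ.terminatesOn X (I.onLevel S.lvlIn .low)
      (O.onLevel S.lvlOut .low) Z c w [] (by simp) ⟨I, O, hI, by simpa using hX, rfl, rfl⟩
    obtain ⟨n', hn'⟩ := terminates_iff.1 h1
    exact ⟨J', n', O', Y, hn', h3, h2, hY, h4⟩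
  have hcl : Completes (Clonable S d) π S.m0 I n O := hn.clonable fun X c w Z hX => by
    obtain ⟨J', n', O', Y, h1, h2, h3, h4, -⟩ := key X c w Z hX
    exact ⟨J', n', O', Y, h1, h2, h3, h4⟩
  -- Without high items copy 1 can follow the given run itself; otherwise all high items, from the
  -- first on, are replaced.
  cases hh : I.onLevel S.lvlIn .high with
  | nil =>
    exact Kind.terminatesIn .di S d hn (fun _ => hcl) hn rfl (highDefault_iff.2 (by simp [hh]))
      (by simp) rfl ord
  | cons q Z =>
    obtain ⟨J', n', O', Y, h1, h2, h3, h4, h5⟩ := key [] q.1 q.2 Z (by simp [hh])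
    refine Kind.terminatesIn .di S d hn (fun _ => hcl) h1 h2 (highDefault_iff.2 ?_) (by simp) h5 ord
    rw [h3]
    simpa using h4

end

section
variable {Cin : Type u} {Cout : Type v} [DecidableEq Cin] [DecidableEq Cout]

/-! ### A program that waits for a special value -/

/-- Loop unless the variable `0` has the value `w`. -/
def waitLoop (w : Val) : Prog Cin Cout := .loop (fun m => .bool (decide (m 0 ≠ w))) .skip

/-- Read an item on `c`, and loop unless it is `w`. -/
def waitProg (c : Cin) (w : Val) : Prog Cin Cout := .seq (.act (.input 0 c)) (waitLoop w)

/-- The four listed programs are closed under steps, and none of them can output. -/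
theorem waitProg_output {c : Cin} {w : Val} {p : Prog Cin Cout} {m : Mem} {I : Queue Cin} {n : ℕ}
    {O : Queue Cout} (h : Completes₀ p m I n O)
    (hp : p = waitProg c w ∨ p = .seq .skip (waitLoop w) ∨ p = waitLoop w ∨ p = .skip) :
    O = [] := by
  induction h with
  | skip => rfl
  | @tau p m p' m' J n O h1 h2 _ ih =>
    refine ih ?_
    rcases hp with rfl | rfl | rfl | rfl
    · simp [waitProg, Stmt.next] at h1
    · simp only [Prog.tau, Stmt.tau, Stmt.step, Option.map_some, Option.some.injEq,
        Prod.mk.injEq] at h2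
      exact .inr (.inr (.inl h2.1.symm))
    · by_cases hm : m 0 = w
      · simp only [Prog.tau, Stmt.tau, waitLoop, Stmt.step, hm, ne_eq, not_true_eq_false,
          decide_false, Option.map_some, Option.some.injEq, Prod.mk.injEq] at h2
        exact .inr (.inr (.inr h2.1.symm))
      · simp only [Prog.tau, Stmt.tau, waitLoop, Stmt.step, hm, ne_eq, not_false_eq_true,
          decide_true, Option.map_some, Option.some.injEq, Prod.mk.injEq] at h2
        exact .inr (.inl h2.1.symm)
    · simp [Stmt.tau, Stmt.step] at h2
  | inp h1 _ _ ih =>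
    refine ih ?_
    rcases hp with rfl | rfl | rfl | rfl
    · exact .inr (.inl rfl)
    · simp [Stmt.next] at h1
    · simp [waitLoop, Stmt.next] at h1
    · simp [Stmt.next] at h1
  | out h1 =>
    rcases hp with rfl | rfl | rfl | rfl
    · simp [waitProg, Stmt.next] at h1
    · simp [Stmt.next] at h1
    · simp [waitLoop, Stmt.next] at h1
    · simp [Stmt.next] at h1

theorem waitProg_TINI (S : Setting Cin Cout) (c : Cin) (w : Val) :
    TINI S (waitProg c w : Prog Cin Cout) := by
  intro I I' O O' _ h h'
  obtain ⟨n, hn⟩ := terminates_iff.1 h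
  obtain ⟨n', hn'⟩ := terminates_iff.1 h'
  rw [waitProg_output hn (.inl rfl), waitProg_output hn' (.inl rfl)]

theorem waitProg_terminates (S : Setting Cin Cout) (c : Cin) (w : Val) :
    Terminates S (waitProg c w : Prog Cin Cout) [(c, w)] [] := by
  refine terminates_iff.2 ⟨3, .inp (x := 0) rfl trivial (.tau rfl rfl (.tau (p' := .skip)
    (m' := S.m0.upd 0 w) rfl ?_ (.skip _)))⟩
  simp [Stmt.tau, Stmt.step, waitLoop, Mem.upd]

/-! ### The low execution of the waiting program -/

open scoped Classical in
/-- The order that prefers the low execution, and MAP working for it. -/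
noncomputable def lowFirst : Order where
  pick _ X :=
    if .loc 1 ∈ X then .loc 1 else if .mapStep ∈ X then .mapStep
    else if .mapActivate 1 ∈ X then .mapActivate 1
    else if h : X.Nonempty then h.choose else .loc 0
  pick_mem _ X hX := by
    split
    · assumption
    split
    · assumption
    split
    · assumption
    exact hX.choose_spec

/-- The configurations of the low execution of the waiting program, and of MAP, that occur when
the low execution never gets the value `w` but only `w'`. -/
inductive LowWaits (d : Defaults Cin Cout) (c : Cin) (w : Val) :
    LocalConf Cin Cout → MapProg Cin Cout → Prop
  | start (m) : LowWaits d c w ⟨waitProg c w, m, ⟨.E, none, [], []⟩⟩ .skip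
  | asks (m) : LowWaits d c w ⟨waitProg c w, m, ⟨.S, some (.inl c), [], []⟩⟩ .skip
  | decide (m) : LowWaits d c w ⟨waitProg c w, m, ⟨.S, none, [], []⟩⟩
      (.cond (hasPriv .ask 1 c) (fetchAndMap d c)
        (.cond (hasPriv .tell 1 c) .skip (mapDefault d 1 c)))
  | decide' (m) : LowWaits d c w ⟨waitProg c w, m, ⟨.S, none, [], []⟩⟩
      (.cond (hasPriv .tell 1 c) .skip (mapDefault d 1 c))
  | give (m) : LowWaits d c w ⟨waitProg c w, m, ⟨.S, none, [], []⟩⟩ (mapDefault d 1 c)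
  | given (m p) : AfterSkip (.act (.wake (identical 1))) p →
      LowWaits d c w ⟨waitProg c w, m, ⟨.S, none, [(c, d.inp c)], []⟩⟩ p
  | ready (m) : LowWaits d c w ⟨waitProg c w, m, ⟨.E, none, [(c, d.inp c)], []⟩⟩ .skip
  | loop (m p) : m 0 = d.inp c → AfterSkip (waitLoop w) p →
      LowWaits d c w ⟨p, m, ⟨.E, none, [], []⟩⟩ .skip

variable {S : Setting Cin Cout} {M : Mechanism Cin Cout} {γ γ₁ : Config Cin Cout} {t : ℕ}

theorem after_lowFirst_loc (h : M.step S γ (.loc 1) = some γ₁) : M.after S lowFirst t γ = γ₁ := by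
  simp [Mechanism.after, lowFirst, h]

theorem after_lowFirst_mapStep (h : M.step S γ (.loc 1) = none)
    (h' : M.step S γ .mapStep = some γ₁) : M.after S lowFirst t γ = γ₁ := by
  simp [Mechanism.after, lowFirst, h, h']

theorem after_lowFirst_mapActivate (h : M.step S γ (.loc 1) = none)
    (h' : M.step S γ .mapStep = none) (h'' : M.step S γ (.mapActivate 1) = some γ₁) :
    M.after S lowFirst t γ = γ₁ := by
  simp [Mechanism.after, lowFirst, h, h', h'']

/-- In each of these configurations one of the three preferred moves is possible. So copy 0 never
moves, MAP works for copy 1 only, and copy 1 receives just the default item. -/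
theorem LowWaits.after {d : Defaults Cin Cout} {c : Cin} {w : Val} (hc : S.lvlIn c = .high)
    (hw : d.inp c ≠ w) (htm : γ.env.tm = (mechNI S d).tm)
    (h : ∃ l, γ.env.ex[1]? = some l ∧ LowWaits d c w l γ.mapPrg) :
    ((mechNI S d).after S lowFirst t γ).env.tm = (mechNI S d).tm ∧
    ∃ l, ((mechNI S d).after S lowFirst t γ).env.ex[1]? = some l ∧
      LowWaits d c w l ((mechNI S d).after S lowFirst t γ).mapPrg := by
  obtain ⟨l, hl, h⟩ := h
  have hlt : 1 < γ.env.ex.length := (List.getElem?_eq_some_iff.1 hl).1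
  have hset : ∀ l', (γ.env.ex.set 1 l')[1]? = some l' := fun l' => by simp [hlt]
  have hask : ∀ r m, hasPriv r 1 c γ.env.tm m = .bool false := by
    intro r m; simp [hasPriv, htm, mechNI, hc]
  have hsleep : l.port.stt = .S → (mechNI S d).step S γ (.loc 1) = none := by
    intro hS; simp [Mechanism.step, hl, LocalConf.step, hS]
  have hstep : ∀ l', l.step = some l' →
      (mechNI S d).step S γ (.loc 1) = some (γ.setLocal 1 l') := by
    intro l' hl'; simp [Mechanism.step, hl, hl']
  generalize hp : γ.mapPrg = p at h
  cases h with
  | start m =>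
    rw [after_lowFirst_loc (hstep _ rfl)]
    exact ⟨htm, _, hset _, hp ▸ .asks m⟩
  | asks m =>
    rw [after_lowFirst_mapActivate (hsleep rfl) (by simp [Mechanism.step, hp, Stmt.step])
      (γ₁ := { γ.setLocal 1 ⟨waitProg c w, m, ⟨.S, none, [], []⟩⟩ with
        mapPrg := (mechNI S d).mapProg 1 c, mapMem := S.m0 })
      (by simp [Mechanism.step, hp, hl, LocalConf.asksInput, waitProg, Stmt.next,
        LocalConf.clearSig])]
    exact ⟨htm, _, hset _, .decide m⟩
  | decide m =>
    rw [after_lowFirst_mapStep (hsleep rfl) (γ₁ := { γ with mapPrg :=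
      (.cond (hasPriv .tell 1 c) .skip (mapDefault d 1 c)) })
      (by simp [Mechanism.step, hp, Stmt.step, hask])]
    exact ⟨htm, _, hl, .decide' m⟩
  | decide' m =>
    rw [after_lowFirst_mapStep (hsleep rfl) (γ₁ := { γ with mapPrg := mapDefault d 1 c })
      (by simp [Mechanism.step, hp, Stmt.step, hask])]
    exact ⟨htm, _, hl, .give m⟩
  | give m =>
    rw [after_lowFirst_mapStep (hsleep rfl) (by rw [Mechanism.step, hp]; rfl)]
    exact ⟨htm, _, by simp [Env.modify, identical, hl], .given m _ (.inr rfl)⟩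
  | given m p h =>
    rcases h with rfl | rfl
    · rw [after_lowFirst_mapStep (hsleep rfl) (by rw [Mechanism.step, hp]; rfl)]
      exact ⟨htm, _, by simp [Env.wake, Env.modify, identical, hl], .ready m⟩
    · rw [after_lowFirst_mapStep (hsleep rfl) (by rw [Mechanism.step, hp]; rfl)]
      exact ⟨htm, _, hl, .given m _ (.inl rfl)⟩
  | ready m =>
    rw [after_lowFirst_loc (hstep ⟨.seq .skip (waitLoop w), m.upd 0 (d.inp c),
      ⟨.E, none, [], []⟩⟩ (by simp [LocalConf.step, waitProg, Stmt.step, Act.runLocal, Queue.deq]))]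
    exact ⟨htm, _, hset _, hp ▸ .loop _ _ (by simp [Mem.upd]) (.inr rfl)⟩
  | loop m p hm h =>
    rcases h with rfl | rfl
    · rw [after_lowFirst_loc (hstep ⟨.seq .skip (waitLoop w), m, ⟨.E, none, [], []⟩⟩
        (by simp [LocalConf.step, waitLoop, Stmt.step, hm, hw]))]
      exact ⟨htm, _, hset _, hp ▸ .loop _ _ hm (.inr rfl)⟩
    · rw [after_lowFirst_loc (hstep ⟨waitLoop w, m, ⟨.E, none, [], []⟩⟩
        (by simp [LocalConf.step, Stmt.step]))]
      exact ⟨htm, _, hset _, hp ▸ .loop _ _ hm (.inl rfl)⟩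

theorem mechNI_not_precise_TINI (S : Setting Cin Cout) (d : Defaults Cin Cout) {c : Cin}
    (hc : S.lvlIn c = .high) : ¬ (mechNI S d).Precise S (TINI S) := by
  intro h
  obtain ⟨w, hw⟩ : ∃ w, d.inp c ≠ w := by
    by_cases h : d.inp c = .nat 0
    · exact ⟨.nat 1, by simp [h]⟩
    · exact ⟨_, h⟩
  -- The contradiction needs nothing about the global input `I`, since copy 1 has no access to real
  -- high items.
  obtain ⟨I, O, -, -, n, hn, -⟩ := h (waitProg c w) (waitProg_TINI S c w) [(c, w)] []
    (waitProg_terminates S c w) lowFirst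
  have key : ∀ n, ((mechNI S d).run S (waitProg c w) I lowFirst n).env.tm = (mechNI S d).tm ∧
      ∃ l, ((mechNI S d).run S (waitProg c w) I lowFirst n).env.ex[1]? = some l ∧
        LowWaits d c w l ((mechNI S d).run S (waitProg c w) I lowFirst n).mapPrg := by
    intro n
    induction n with
    | zero => exact ⟨rfl, _, rfl, .start _⟩
    | succ n ih => exact LowWaits.after hc hw ih.1 ih.2
  obtain ⟨-, l, hl, hwait⟩ := key n
  have hskip := (hn.2.2.2 l (List.mem_of_getElem? hl)).1
  generalize Config.mapPrg _ = q at hwait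
  cases hwait with
  | loop m p _ h => rcases h with rfl | rfl <;> simp [waitLoop] at hskip
  | _ => simp [waitProg] at hskip

end

end InfoFlow

theorem theorem2 {Cin : Type*} {Cout : Type*} [DecidableEq Cin] [DecidableEq Cout]
    (S : InfoFlow.Setting Cin Cout) (d : InfoFlow.Defaults Cin Cout) :
    (InfoFlow.mechRI S d).Precise S (InfoFlow.RI S d) ∧
    (InfoFlow.mechDI S d).Precise S (InfoFlow.DI S d) ∧
    (InfoFlow.mechNI S d).Precise S (InfoFlow.TSNI S) ∧
    ((∃ c : Cin, S.lvlIn c = InfoFlow.Level.high) →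
      ¬ (InfoFlow.mechNI S d).Precise S (InfoFlow.TINI S)) :=
  ⟨InfoFlow.mechRI_precise S d, InfoFlow.mechDI_precise S d, InfoFlow.mechNI_precise S d,
    fun ⟨_, hc⟩ => InfoFlow.mechNI_not_precise_TINI S d hc⟩
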